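/- All point sets are finite subsets of $\mathbb{R}^2$. The \emph{shell} of a point set $S$ is the set of points of $S$ on the boundary of the convex hull of $S$. A nonempty set $S$ \emph{lies on one shell} if it equals its shell, and for $k\ge 2$ it \emph{lies on $k$ shells} if removing its shell leaves a nonempty set that lies on $k-1$ shells. Let $\mathcal{P}(S)$ be the set of all simple polygons (closed regions bounded by a simple closed polygonal chain) whose vertex set is exactly $S$; angles equal to $\pi$ at vertices are allowed. For a polygon $P$, a point $g\in P$ sees $a\in P$ if the segment $ga$ is contained in $P$. A set $G\subseteq S$ is a \emph{universal guard set} for $S$ if for every $P\in\mathcal{P}(S)$ each point of $P$ is seen by some $g\in G$. Let $UG_2(n)$ be the maximum, over all sets $S$ of $n$ points lying on two shells, of the minimum cardinality of a universal guard set for $S$ (the maximum of the empty set being $0$). \textbf{Theorem.} (1) There is an algorithm (a single program for the real RAM, which handles real numbers exactly and performs each memory access, arithmetic operation and comparison in unit time) and a constant $C$ such that, for every point set $S$ lying on two shells, given as a list of its points in arbitrary order, the algorithm computes in at most $C\,|S|\log|S|$ time a universal guard set $G\subseteq S$ for $S$ with $$|G|\le\left(1-\frac{1}{\sqrt{6|S|}}\right)|S|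 .$$ (2) Consequently, $UG_2(n)\le\left(1-\frac{1}{\sqrt{6n}}\right)n$ for every positive integer $n$. -/

import Mathlib

/-- The plane `ℝ²`. -/
abbrev Plane : Type := ℝ × ℝ

/-! ### Shells of a finite point set -/

namespace UniversalGuards

noncomputable section

open scoped Classical in
/-- The (outer) shell of a finite point set: its points on the topological boundary of its
convex hull. -/
def shell (S : Finset Plane) : Finset Plane :=
  S.filter fun p => p ∈ frontier (convexHull ℝ (S : Set Plane))

open scoped Classical in
/-- `S` lies on (exactly) `k` shells: only the empty set lies on no shell, and a set lies on
`k + 1` shells if it is nonempty and removing its shell leaves a set that lies on `k` shells. -/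
def LiesOnShells : ℕ → Finset Plane → Prop
  | 0, S => S = ∅
  | k + 1, S => S.Nonempty ∧ LiesOnShells k (S \ shell S)

/-! ### Simple polygons with a prescribed vertex set -/

/-- The closed polygonal chain `poly` is simple: at least three vertices, all distinct, two
consecutive edges share only their common vertex, other pairs of edges are disjoint.
An angle of `π` at a vertex is allowed. -/
structure IsSimple {n : ℕ} (poly : Polygon Plane n) : Prop where
  three_le : 3 ≤ n
  injective : Function.Injective poly.vertices
  consecutive : ∀ i : Fin n,
    poly.edgeSet ℝ i ∩ poly.edgeSet ℝ (finRotate n i) = {poly (finRotate n i)}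
  disjoint : ∀ i j : Fin n, j ≠ i → j ≠ finRotate n i → i ≠ finRotate n j →
    Disjoint (poly.edgeSet ℝ i) (poly.edgeSet ℝ j)

/-- The closed region bounded by `poly`: its boundary together with all points that lie in a
bounded connected component of the complement of the boundary. -/
def region {n : ℕ} (poly : Polygon Plane n) : Set Plane :=
  {x | x ∈ poly.boundary ℝ ∨
    (x ∉ poly.boundary ℝ ∧ Bornology.IsBounded (connectedComponentIn (poly.boundary ℝ)ᶜ x))}

/-- The set `𝒫(S)` of all simple polygons (as closed regions) whose vertex set is `S`. -/
def simplePolygons (S : Finset Plane) : Set (Set Plane) :=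
  {P | ∃ poly : Polygon Plane S.card,
    IsSimple poly ∧ Set.range poly.vertices = (S : Set Plane) ∧ P = region poly}

/-! ### Guarding -/

/-- `p` sees `q` with respect to `P`. -/
def Sees (P : Set Plane) (p q : Plane) : Prop := segment ℝ p q ⊆ P

/-- The visible region of `g` with respect to `P`. -/
def visibleRegion (P : Set Plane) (g : Plane) : Set Plane := {a | a ∈ P ∧ Sees P g a}

/-- `G` is a guard set for `P`: every point of `P` is seen by a point of `G`. -/
def Guards (G : Finset Plane) (P : Set Plane) : Prop := ⋃ g ∈ G, visibleRegion P g = P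

/-- `G` is a universal guard set for `S`: `G ⊆ S` is a guard set for every simple polygon
with vertex set `S`. -/
def IsUniversalGuardSet (S G : Finset Plane) : Prop :=
  G ⊆ S ∧ ∀ P ∈ simplePolygons S, Guards G P

/-- The minimum cardinality of a universal guard set for `S`
(it would be `⊤` if there were none). -/
def minGuards (S : Finset Plane) : ℕ∞ :=
  ⨅ (G : Finset Plane) (_ : IsUniversalGuardSet S G), (G.card : ℕ∞)

/-- The `m`-shelled universal guard number `UG_m(n)`: the maximum of `minGuards S` over all
sets `S` of `n` points that lie on `m` shells. -/
def UG (m n : ℕ) : ℕ∞ :=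
  ⨆ (S : Finset Plane) (_ : S.card = n ∧ LiesOnShells m S), minGuards S

end

end UniversalGuards

/-! ### The real RAM

A uniform real RAM with structured control flow. Its memory consists of arrays of natural
numbers and arrays of exact real numbers, both with random access; a program is a finite text
and so refers to finitely many arrays, and `nat a 0`, `real a 0` serve as scalar variables.
Every memory access, arithmetic operation, comparison and assignment costs one time unit.
Indices are natural numbers, with addition, truncated subtraction and halving; reals have
exact `+`, `-`, `*` and comparisons. There is no rounding and no way to move
a real into the integer memory except through comparisons. -/

namespace RealRAM

noncomputable section

/-- The memory: cell `i` of the natural-number array `a`, and cell `i` of the real array `a`. -/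
structure State where
  nat : ℕ → ℕ → ℕ
  real : ℕ → ℕ → ℝ

/-- Expressions with natural-number values. -/
inductive NatExp where
  | lit (k : ℕ)
  | get (a : ℕ) (i : NatExp)
  | add (e f : NatExp)
  | sub (e f : NatExp)
  | half (e : NatExp)

/-- Expressions with real values. -/
inductive RealExp where
  | lit (z : ℤ)
  | get (a : ℕ) (i : NatExp)
  | add (e f : RealExp)
  | sub (e f : RealExp)
  | mul (e f : RealExp)

/-- Tests. -/
inductive Test where
  | natLt (e f : NatExp)
  | realLt (e f : RealExp)
  | not (b : Test)
  | and (b c : Test)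

def NatExp.eval (s : State) : NatExp → ℕ
  | .lit k => k
  | .get a i => s.nat a (i.eval s)
  | .add e f => e.eval s + f.eval s
  | .sub e f => e.eval s - f.eval s
  | .half e => e.eval s / 2

def RealExp.eval (s : State) : RealExp → ℝ
  | .lit z => (z : ℝ)
  | .get a i => s.real a (i.eval s)
  | .add e f => e.eval s + f.eval s
  | .sub e f => e.eval s - f.eval s
  | .mul e f => e.eval s * f.eval s

def Test.Holds (s : State) : Test → Prop
  | .natLt e f => e.eval s < f.eval s
  | .realLt e f => e.eval s < f.eval s
  | .not b => ¬ b.Holds s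
  | .and b c => b.Holds s ∧ c.Holds s

/-- The time to evaluate an expression: one unit for each operation in it. -/
def NatExp.cost : NatExp → ℕ
  | .lit _ => 1
  | .get _ i => i.cost + 1
  | .add e f => e.cost + f.cost + 1
  | .sub e f => e.cost + f.cost + 1
  | .half e => e.cost + 1

def RealExp.cost : RealExp → ℕ
  | .lit _ => 1
  | .get _ i => i.cost + 1
  | .add e f => e.cost + f.cost + 1
  | .sub e f => e.cost + f.cost + 1
  | .mul e f => e.cost + f.cost + 1

def Test.cost : Test → ℕ
  | .natLt e f => e.cost + f.cost + 1
  | .realLt e f => e.cost + f.cost + 1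
  | .not b => b.cost + 1
  | .and b c => b.cost + c.cost + 1

/-- Programs. -/
inductive Program where
  | skip
  | setNat (a : ℕ) (i e : NatExp)
  | setReal (a : ℕ) (i : NatExp) (e : RealExp)
  | seq (p q : Program)
  | ite (b : Test) (p q : Program)
  | while (b : Test) (p : Program)

/-- Overwrite cell `i` of the natural-number array `a` by `k`. -/
def State.updateNat (s : State) (a i k : ℕ) : State :=
  { s with nat := Function.update s.nat a (Function.update (s.nat a) i k) }

/-- Overwrite cell `i` of the real array `a` by `x`. -/
def State.updateReal (s : State) (a i : ℕ) (x : ℝ) : State :=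
  { s with real := Function.update s.real a (Function.update (s.real a) i x) }

/-- `Exec p s s' t`: started in memory state `s`, the program `p` halts in memory state `s'`
after exactly `t` time units. -/
inductive Exec : Program → State → State → ℕ → Prop
  | skip (s : State) : Exec .skip s s 1
  | setNat (s : State) (a : ℕ) (i e : NatExp) :
      Exec (.setNat a i e) s (s.updateNat a (i.eval s) (e.eval s)) (i.cost + e.cost + 1)
  | setReal (s : State) (a : ℕ) (i : NatExp) (e : RealExp) :
      Exec (.setReal a i e) s (s.updateReal a (i.eval s) (e.eval s)) (i.cost + e.cost + 1)
  | seq {p q : Program} {s s₁ s₂ : State} {t₁ t₂ : ℕ} :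
      Exec p s s₁ t₁ → Exec q s₁ s₂ t₂ → Exec (.seq p q) s s₂ (t₁ + t₂)
  | iteTrue {b : Test} {p q : Program} {s s' : State} {t : ℕ} :
      b.Holds s → Exec p s s' t → Exec (.ite b p q) s s' (b.cost + t + 1)
  | iteFalse {b : Test} {p q : Program} {s s' : State} {t : ℕ} :
      ¬ b.Holds s → Exec q s s' t → Exec (.ite b p q) s s' (b.cost + t + 1)
  | whileFalse {b : Test} {p : Program} {s : State} :
      ¬ b.Holds s → Exec (.while b p) s s (b.cost + 1)
  | whileTrue {b : Test} {p : Program} {s s₁ s₂ : State} {t₁ t₂ : ℕ} :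
      b.Holds s → Exec p s s₁ t₁ → Exec (.while b p) s₁ s₂ t₂ →
      Exec (.while b p) s s₂ (b.cost + t₁ + t₂ + 1)

/-- The initial memory for the input points `p 0, …, p (n - 1)`: cell `0` of the
natural-number array `0` holds `n`, the real arrays `0` and `1` hold the two coordinates of the
points, all other cells hold `0`. -/
def input {n : ℕ} (p : Fin n ↪ Plane) : State where
  nat a i := if a = 0 ∧ i = 0 then n else 0
  real a i :=
    if h : i < n then
      if a = 0 then (p ⟨i, h⟩).1 else if a = 1 then (p ⟨i, h⟩).2 else 0
    else 0

/-- The subset of the input points that a final memory state represents: `p i` belongs to it if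
and only if cell `i` of the natural-number array `1` holds `1`. -/
def output {n : ℕ} (p : Fin n ↪ Plane) (s : State) : Finset Plane :=
  (Finset.univ.filter fun i : Fin n => s.nat 1 i = 1).map p

end

end RealRAM

namespace UniversalGuards

noncomputable section

/-! ### Orientation of triples of points -/

/-! Write n for the number of points of S and let K be the least natural number with 6K² ≥ n. Then K
≥ n/√(6n), so it suffices to find, fast enough, a set B of at least K points of S that need no
guards.

The criterion for B is `isUniversalGuardSet_sdiff`. The part of a polygon seen by finitely many
guards is closed, and the polygon is the closure of its inside, because the winding number jumps
across an edge. So only inside points x on no line through two points of S matter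
(`guards_of_generic`). Suppose that such an x sees no guard. Then it sees only vertices in B, and it
lies in the convex hull of B, since every direction from x lies in an angle between two visible
vertices (`mem_convexHull_of_visible`). A part of an edge p q that x sees is delimited by visible
vertices l and r, which either are the ends p and q or stand in front of the edge and hide its ends;
this situation is a `Window`. If points l, r of B are never able to hide anything from points of
conv B, then x sees every edge that it sees at all up to both ends, and turning past an end it meets
the next edge of the polygon. Hence x sees all vertices (`all_visible_of_windows`), so all of S lies
in B, which is absurd if B ≠ S.

Two kinds of sets satisfy this. First, B may be the outer shell: a hiding vertex would be interior
to a triangle with corners in the hull of S (`isUniversalGuardSet_sdiff_shell`). Second, take a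
block of 2m consecutive edges on the boundary of the hull of the inner points such that each outer
point is strictly outside of all of these edges or of none; then B may consist of the m + 1 vertices
of even position in the block (`isUniversalGuardSet_sdiff_chain`). Between two points of B on the
block there is an odd vertex. An edge that passes in front of it and behind a hiding end of the
block's chord would have an end that is outside of some edges of the block only, or outside of all
of them but then on the wrong side of the odd vertex.

If the outer shell has at least K points, it serves as B. Otherwise put m = K - 1; the shell has at
most m points and 6m² < n. The inner points all lie on their own hull, hence on two chains, an upper
and a lower one, which are cut into blocks of 2m edges. A block spoiled by an outer point w contains
the contact point of a tangent from w in its relative interior, and w has only one tangent of each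
of the two kinds (`IsChain.blocks_le`). So at most 2m blocks are spoiled, and for m ≥ 3 there are
more blocks than that (`exists_passing`).

The program sorts lexicographically by a bottom-up merge sort, finds the shell and the two inner
chains by monotone chain scans, and searches the blocks. All of this except sorting is linear, the
search because a block costs no more rounds than it has edges. Programs are verified by the rules
for `Runs`, which carry a postcondition together with a time bound. The bound for `UG 2 n` follows
by running the program on an enumeration of the points. -/

/-- Twice the signed area of the triangle `a b c`. -/
def orient (a b c : Plane) : ℝ := (b.1 - a.1) * (c.2 - a.2) - (b.2 - a.2) * (c.1 - a.1)

lemma orient_self_left (a b : Plane) : orient a a b = 0 := by simp [orient]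

lemma orient_self_right (a b : Plane) : orient a b b = 0 := by simp only [orient]; ring

lemma orient_self_mid (a b : Plane) : orient a b a = 0 := by simp [orient]

lemma orient_rotate (a b c : Plane) : orient b c a = orient a b c := by
  simp only [orient]; ring

lemma orient_swap (a b c : Plane) : orient b a c = -orient a b c := by
  simp only [orient]; ring

lemma orient_swap' (a b c : Plane) : orient a c b = -orient a b c := by
  simp only [orient]; ring

lemma orient_line (a b c d : Plane) (t : ℝ) :
    orient a b (c + t • (d - c)) = (1 - t) * orient a b c + t * orient a b d := by
  simp only [orient, Prod.fst_add, Prod.snd_add, Prod.smul_fst, Prod.smul_snd, Prod.fst_sub,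
    Prod.snd_sub, smul_eq_mul]
  ring

lemma continuous_orient (a b : Plane) : Continuous fun z => orient a b z := by
  unfold orient; fun_prop

/-! ### Winding numbers -/

/-- The angle under which the segment `a b` is seen from `z`. -/
def turn (a b z : Plane) : ℝ :=
  Complex.arg ⟨(a.1 - z.1) * (b.1 - z.1) + (a.2 - z.2) * (b.2 - z.2), orient z a b⟩

/-- The difference vector as a complex number. -/
def cx (z a : Plane) : ℂ := ⟨a.1 - z.1, a.2 - z.2⟩

lemma cx_ne_zero {z a : Plane} (h : z ≠ a) : cx z a ≠ 0 := by
  intro h0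
  apply h
  have h1 := congrArg Complex.re h0
  have h2 := congrArg Complex.im h0
  simp only [cx, Complex.zero_re, Complex.zero_im] at h1 h2
  exact Prod.ext (by linarith) (by linarith)

lemma turn_eq (a b z : Plane) :
    turn a b z = Complex.arg (cx z b * (starRingEnd ℂ) (cx z a)) := by
  unfold turn
  congr 1
  apply Complex.ext
  · simp [cx]; ring
  · simp [cx, orient]; ring

/-- Modulo 2π a turn is a difference of two directions, which is what makes sums around a closed
polygon telescope. -/
lemma turn_coe {a b z : Plane} (ha : z ≠ a) (hb : z ≠ b) :
    ((turn a b z : ℝ) : Real.Angle) = Complex.arg (cx z b) - Complex.arg (cx z a) := by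
  rw [turn_eq, Complex.arg_mul_coe_angle (cx_ne_zero hb)
    ((map_ne_zero _).2 (cx_ne_zero ha)), Complex.arg_conj_coe_angle, sub_eq_add_neg]

/-- A point on the line `a b` which sees `a` and `b` in opposite directions is between them. -/
lemma mem_segment_of_dot {a b z : Plane} (h0 : orient z a b = 0)
    (h : (a.1 - z.1) * (b.1 - z.1) + (a.2 - z.2) * (b.2 - z.2) ≤ 0) : z ∈ segment ℝ a b := by
  by_cases hab : a = b
  · subst hab
    have h1 : a.1 - z.1 = 0 := by nlinarith [sq_nonneg (a.1 - z.1), sq_nonneg (a.2 - z.2)]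
    have h2 : a.2 - z.2 = 0 := by nlinarith [sq_nonneg (a.1 - z.1), sq_nonneg (a.2 - z.2)]
    have : z = a := Prod.ext (by linarith) (by linarith)
    rw [this]; exact left_mem_segment ℝ a a
  · have hD : 0 < (b.1 - a.1) ^ 2 + (b.2 - a.2) ^ 2 := by
      by_contra hD
      apply hab
      have h1 : b.1 - a.1 = 0 := by nlinarith [sq_nonneg (b.1 - a.1), sq_nonneg (b.2 - a.2)]
      have h2 : b.2 - a.2 = 0 := by nlinarith [sq_nonneg (b.1 - a.1), sq_nonneg (b.2 - a.2)]
      exact Prod.ext (by linarith) (by linarith)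
    set D := (b.1 - a.1) ^ 2 + (b.2 - a.2) ^ 2 with hDdef
    rw [segment_eq_image']
    set T := (z.1 - a.1) * (b.1 - a.1) + (z.2 - a.2) * (b.2 - a.2) with hT
    have e1 : T * (b.1 - a.1) = D * (z.1 - a.1) := by
      simp only [orient] at h0; rw [hT, hDdef]; linear_combination (b.2 - a.2) * h0
    have e2 : T * (b.2 - a.2) = D * (z.2 - a.2) := by
      simp only [orient] at h0; rw [hT, hDdef]; linear_combination -(b.1 - a.1) * h0
    refine ⟨T / D, ⟨?_, ?_⟩, ?_⟩
    · apply div_nonneg _ hD.le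
      rw [hT]; nlinarith [sq_nonneg (a.1 - z.1), sq_nonneg (a.2 - z.2)]
    · rw [div_le_one hD, hT, hDdef]; nlinarith [sq_nonneg (b.1 - z.1), sq_nonneg (b.2 - z.2)]
    · apply Prod.ext
      · simp only [Prod.fst_add, Prod.smul_fst, Prod.fst_sub, smul_eq_mul]
        rw [div_mul_eq_mul_div, e1]; field_simp; ring
      · simp only [Prod.snd_add, Prod.smul_snd, Prod.snd_sub, smul_eq_mul]
        rw [div_mul_eq_mul_div, e2]; field_simp; ring

/-- The argument is discontinuous only on the nonpositive real axis, and a value there means that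
`z` lies on the line `a b` and sees `a` and `b` in opposite directions or coincides with one of
them. -/
lemma continuousAt_turn {a b z : Plane} (h : z ∉ segment ℝ a b) : ContinuousAt (turn a b) z := by
  have hslit : (⟨(a.1 - z.1) * (b.1 - z.1) + (a.2 - z.2) * (b.2 - z.2), orient z a b⟩ : ℂ)
      ∈ Complex.slitPlane := by
    rw [Complex.mem_slitPlane_iff]
    by_contra hc
    push Not at hc
    exact h (mem_segment_of_dot hc.2 hc.1)
  refine ContinuousAt.comp (g := Complex.arg)
    (f := fun z : Plane => (⟨(a.1 - z.1) * (b.1 - z.1) + (a.2 - z.2) * (b.2 - z.2),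
      orient z a b⟩ : ℂ)) (Complex.continuousAt_arg hslit) ?_
  have : Continuous fun z : Plane =>
      Complex.equivRealProdCLM.symm ((a.1 - z.1) * (b.1 - z.1) + (a.2 - z.2) * (b.2 - z.2),
      orient z a b) := by
    apply Complex.equivRealProdCLM.symm.continuous.comp
    unfold orient
    fun_prop
  exact this.continuousAt

variable {n : ℕ}

lemma edgeSet_eq (poly : Polygon Plane n) (i : Fin n) :
    poly.edgeSet ℝ i = segment ℝ (poly i) (poly (finRotate n i)) :=
  affineSegment_eq_segment ..

lemma mem_boundary {poly : Polygon Plane n} {z : Plane} :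
    z ∈ poly.boundary ℝ ↔ ∃ i, z ∈ segment ℝ (poly i) (poly (finRotate n i)) := by
  simp [Polygon.boundary, edgeSet_eq]

lemma isCompact_boundary (poly : Polygon Plane n) : IsCompact (poly.boundary ℝ) := by
  apply isCompact_iUnion
  intro i
  rw [edgeSet_eq, segment_eq_image']
  exact isCompact_Icc.image (by fun_prop)

lemma vertex_mem_boundary (poly : Polygon Plane n) (i : Fin n) : poly i ∈ poly.boundary ℝ :=
  mem_boundary.2 ⟨i, left_mem_segment ..⟩

/-- `2π` times the winding number of the polygon around `z`. -/
def winding (poly : Polygon Plane n) (z : Plane) : ℝ :=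
  ∑ i, turn (poly i) (poly (finRotate n i)) z

lemma winding_coe (poly : Polygon Plane n) {z : Plane} (hz : z ∉ poly.boundary ℝ) :
    ((winding poly z : ℝ) : Real.Angle) = 0 := by
  have hne : ∀ i, z ≠ poly i := fun i h => hz (h ▸ vertex_mem_boundary poly i)
  have : ((winding poly z : ℝ) : Real.Angle) =
      ∑ i, (turn (poly i) (poly (finRotate n i)) z : Real.Angle) := by
    unfold winding
    exact map_sum Real.Angle.coeHom _ _
  rw [this, Finset.sum_congr rfl fun i _ => turn_coe (hne i) (hne _), Finset.sum_sub_distrib,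
    Equiv.sum_comp (finRotate n) fun i => ((Complex.arg (cx z (poly i)) : ℝ) : Real.Angle),
    sub_self]

lemma continuousOn_winding (poly : Polygon Plane n) :
    ContinuousOn (winding poly) (poly.boundary ℝ)ᶜ := by
  intro z hz
  apply ContinuousAt.continuousWithinAt
  unfold winding
  apply tendsto_finsetSum
  intro i _
  exact continuousAt_turn fun h => hz (mem_boundary.2 ⟨i, h⟩)

/-- The winding number is constant on connected subsets of the complement of the boundary. -/
lemma winding_eq_of_isPreconnected (poly : Polygon Plane n) {s : Set Plane}
    (hs : IsPreconnected s) (hsub : s ⊆ (poly.boundary ℝ)ᶜ) {x y : Plane} (hx : x ∈ s)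
    (hy : y ∈ s) : winding poly x = winding poly y := by
  have hcont : ContinuousOn (winding poly) s := (continuousOn_winding poly).mono hsub
  have himg := (hs.image _ hcont).ordConnected
  by_contra hne
  wlog hlt : winding poly x < winding poly y generalizing x y
  · exact this hy hx (Ne.symm hne) (lt_of_le_of_ne (not_lt.1 hlt) (Ne.symm hne))
  have hval : ∀ r ∈ winding poly '' s, ∃ k : ℤ, r = 2 * Real.pi * k := by
    rintro _ ⟨z, hz, rfl⟩
    have := winding_coe poly (hsub hz)
    rw [← Real.Angle.coe_zero, Real.Angle.angle_eq_iff_two_pi_dvd_sub] at this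
    obtain ⟨k, hk⟩ := this
    exact ⟨k, by linarith⟩
  obtain ⟨k, hk⟩ := hval _ ⟨x, hx, rfl⟩
  obtain ⟨l, hl⟩ := hval _ ⟨y, hy, rfl⟩
  have hpi := Real.pi_pos
  have hkl : (k : ℝ) < l := by
    rw [hk, hl] at hlt
    exact lt_of_mul_lt_mul_left hlt (by positivity)
  have hkl' : (k : ℝ) + 1 ≤ l := by exact_mod_cast hkl
  -- The image of a connected set is an interval, so two different multiples of 2π in it would force
  -- an odd multiple of π.
  have hmem : 2 * Real.pi * k + Real.pi ∈ winding poly '' s := by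
    apply himg.out ⟨x, hx, rfl⟩ ⟨y, hy, rfl⟩
    rw [hk, hl]
    constructor <;> nlinarith
  obtain ⟨j, hj⟩ := hval _ hmem
  have : (2 * j : ℝ) = 2 * k + 1 := by
    have : Real.pi * (2 * j - 2 * k - 1) = 0 := by linarith
    rcases mul_eq_zero.1 this with h | h
    · exact absurd h hpi.ne'
    · linarith
  have : (2 * j : ℤ) = 2 * k + 1 := by exact_mod_cast this
  omega

/-- The winding number around a point far away is zero. -/
lemma winding_eq_zero_of_far (poly : Polygon Plane n) {z : Plane}
    (hz : ∀ i, (poly i).1 * z.1 + (poly i).2 * z.2 < z.1 * z.1 + z.2 * z.2) :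
    winding poly z = 0 := by
  -- This is the conjugate of -z. Multiplication by it turns all vertices, seen from `z`, into the
  -- open right half-plane, where differences of arguments are the turns themselves and not only
  -- modulo 2π.
  set u : ℂ := ⟨-z.1, z.2⟩ with hu
  have hre : ∀ i, 0 < (cx z (poly i) * u).re := by
    intro i
    simp [cx, hu]
    nlinarith [hz i]
  have hne : ∀ i, z ≠ poly i := by
    intro i h
    have := hz i
    rw [← h] at this
    exact lt_irrefl _ this
  have key : ∀ i, turn (poly i) (poly (finRotate n i)) z =
      Complex.arg (cx z (poly (finRotate n i)) * u) - Complex.arg (cx z (poly i) * u) := by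
    intro i
    have hu0 : u ≠ 0 := by
      intro h
      have := hre i
      rw [h] at this
      simp at this
    have h1 : |Complex.arg (cx z (poly (finRotate n i)) * u)| < Real.pi / 2 :=
      Complex.abs_arg_lt_pi_div_two_iff.2 (Or.inl (hre _))
    have h2 : |Complex.arg (cx z (poly i) * u)| < Real.pi / 2 :=
      Complex.abs_arg_lt_pi_div_two_iff.2 (Or.inl (hre _))
    rw [abs_lt] at h1 h2
    have hco : ((turn (poly i) (poly (finRotate n i)) z : ℝ) : Real.Angle) =
        ((Complex.arg (cx z (poly (finRotate n i)) * u) - Complex.arg (cx z (poly i) * u) : ℝ) :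
          Real.Angle) := by
      rw [turn_coe (hne _) (hne _), Real.Angle.coe_sub,
        Complex.arg_mul_coe_angle (cx_ne_zero (hne _)) hu0,
        Complex.arg_mul_coe_angle (cx_ne_zero (hne _)) hu0]
      abel
    rw [Real.Angle.angle_eq_iff_two_pi_dvd_sub] at hco
    obtain ⟨k, hk⟩ := hco
    have h3 := Complex.neg_pi_lt_arg (⟨((poly i).1 - z.1) * ((poly (finRotate n i)).1 - z.1) +
      ((poly i).2 - z.2) * ((poly (finRotate n i)).2 - z.2), orient z (poly i)
      (poly (finRotate n i))⟩)
    have h4 := Complex.arg_le_pi (⟨((poly i).1 - z.1) * ((poly (finRotate n i)).1 - z.1) +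
      ((poly i).2 - z.2) * ((poly (finRotate n i)).2 - z.2), orient z (poly i)
      (poly (finRotate n i))⟩)
    change -Real.pi < turn (poly i) (poly (finRotate n i)) z at h3
    change turn (poly i) (poly (finRotate n i)) z ≤ Real.pi at h4
    have hpi := Real.pi_pos
    have k1 : (k : ℝ) < 1 := by
      by_contra hc
      push Not at hc
      nlinarith
    have k2 : (-1 : ℝ) < k := by
      by_contra hc
      push Not at hc
      nlinarith
    have k1' : k < 1 := by exact_mod_cast k1
    have k2' : -1 < k := by exact_mod_cast k2
    have : k = 0 := by omega
    rw [this] at hk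
    push_cast at hk
    linarith
  unfold winding
  rw [Finset.sum_congr rfl fun i _ => key i, Finset.sum_sub_distrib,
    Equiv.sum_comp (finRotate n) fun i => Complex.arg (cx z (poly i) * u), sub_self]

lemma exists_far (poly : Polygon Plane n) {s : Set Plane} (hs : ¬ Bornology.IsBounded s) :
    ∃ z ∈ s, ∀ i, (poly i).1 * z.1 + (poly i).2 * z.2 < z.1 * z.1 + z.2 * z.2 := by
  obtain ⟨M, hM⟩ := (Set.finite_range poly.vertices).isBounded.exists_norm_le
  by_contra hc
  push Not at hc
  apply hs
  rw [isBounded_iff_forall_norm_le]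
  -- The norm is the maximum norm: the inner product of `z` with a vertex is at most 2M‖z‖, while
  -- that of `z` with itself is at least ‖z‖².
  refine ⟨2 * M, fun z hz => ?_⟩
  obtain ⟨i, hi⟩ := hc z hz
  have hi' := hM (poly i) ⟨i, rfl⟩
  have a1 := (norm_fst_le (poly i)).trans hi'
  have a2 := (norm_snd_le (poly i)).trans hi'
  have z1 := norm_fst_le z
  have z2 := norm_snd_le z
  rw [Real.norm_eq_abs] at a1 a2 z1 z2
  by_contra hlt
  push Not at hlt
  have hM0 : 0 ≤ M := (norm_nonneg _).trans hi'
  have hz0 : 0 < ‖z‖ := by linarith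
  have b1 : (poly i).1 * z.1 ≤ M * ‖z‖ := (le_abs_self _).trans (by
    rw [abs_mul]; exact mul_le_mul a1 z1 (abs_nonneg _) hM0)
  have b2 : (poly i).2 * z.2 ≤ M * ‖z‖ := (le_abs_self _).trans (by
    rw [abs_mul]; exact mul_le_mul a2 z2 (abs_nonneg _) hM0)
  have c : ‖z‖ * ‖z‖ ≤ z.1 * z.1 + z.2 * z.2 := by
    rcases max_choice ‖z.1‖ ‖z.2‖ with h | h
    · rw [Prod.norm_def, h, Real.norm_eq_abs, abs_mul_abs_self]; nlinarith [sq_nonneg z.2]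
    · rw [Prod.norm_def, h, Real.norm_eq_abs, abs_mul_abs_self]; nlinarith [sq_nonneg z.1]
  nlinarith

/-- A point with nonzero winding number lies in a bounded component of the complement. -/
lemma isBounded_of_winding_ne_zero (poly : Polygon Plane n) {z : Plane}
    (hz : z ∉ poly.boundary ℝ) (hw : winding poly z ≠ 0) :
    Bornology.IsBounded (connectedComponentIn (poly.boundary ℝ)ᶜ z) := by
  by_contra hb
  obtain ⟨y, hy, hfar⟩ := exists_far poly hb
  apply hw
  rw [winding_eq_of_isPreconnected poly isPreconnected_connectedComponentIn
    (connectedComponentIn_subset _ _) (mem_connectedComponentIn hz) hy]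
  exact winding_eq_zero_of_far poly hfar

/-- The bounded part of the complement of the boundary. -/
def inside (poly : Polygon Plane n) : Set Plane :=
  {x | x ∉ poly.boundary ℝ ∧ Bornology.IsBounded (connectedComponentIn (poly.boundary ℝ)ᶜ x)}

lemma region_eq (poly : Polygon Plane n) : region poly = poly.boundary ℝ ∪ inside poly := by
  ext x; simp [region, inside]

lemma isOpen_compl_boundary (poly : Polygon Plane n) : IsOpen (poly.boundary ℝ)ᶜ :=
  (isCompact_boundary poly).isClosed.isOpen_compl

lemma isOpen_inside (poly : Polygon Plane n) : IsOpen (inside poly) := by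
  rw [isOpen_iff_mem_nhds]
  rintro x ⟨hx, hb⟩
  filter_upwards [((isOpen_compl_boundary poly).connectedComponentIn (x := x)).mem_nhds
    (mem_connectedComponentIn hx)] with y hy
  exact ⟨connectedComponentIn_subset _ _ hy, by rwa [← connectedComponentIn_eq hy]⟩

/-- The complement is the union of the unbounded components of an open set, and components of open
sets in the plane are open. -/
lemma isClosed_region (poly : Polygon Plane n) : IsClosed (region poly) := by
  rw [← isOpen_compl_iff, isOpen_iff_mem_nhds]
  intro x hx
  rw [region_eq, Set.mem_compl_iff, Set.mem_union, not_or] at hx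
  obtain ⟨hx, hb⟩ := hx
  filter_upwards [((isOpen_compl_boundary poly).connectedComponentIn (x := x)).mem_nhds
    (mem_connectedComponentIn hx)] with y hy
  have hy' : y ∉ poly.boundary ℝ := connectedComponentIn_subset _ _ hy
  rw [region_eq, Set.mem_compl_iff, Set.mem_union, not_or]
  refine ⟨hy', fun h => hb ⟨hx, ?_⟩⟩
  rw [connectedComponentIn_eq hy]
  exact h.2

end

end UniversalGuards

/-! ### The polygon as the closure of its inside; reduction to generic points. -/

namespace UniversalGuards

noncomputable section

open Filter Topology

variable {n : ℕ}

/-- A common point of two edges of a simple polygon is an endpoint of both. -/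
lemma IsSimple.eq_vertex {poly : Polygon Plane n} (h : IsSimple poly) {i j : Fin n} (hij : j ≠ i)
    {z : Plane} (hi : z ∈ segment ℝ (poly i) (poly (finRotate n i)))
    (hj : z ∈ segment ℝ (poly j) (poly (finRotate n j))) :
    z = poly i ∨ z = poly (finRotate n i) := by
  rw [← edgeSet_eq] at hi hj
  by_cases h1 : j = finRotate n i
  · subst h1
    have := h.consecutive i
    right
    exact this.subset ⟨hi, hj⟩
  by_cases h2 : i = finRotate n j
  · subst h2
    have := h.consecutive j
    left
    exact this.subset ⟨hj, hi⟩
  exact absurd hj (Set.disjoint_left.1 (h.disjoint i j hij h1 h2) hi)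

lemma IsSimple.rotate_ne {poly : Polygon Plane n} (h : IsSimple poly) (i : Fin n) :
    finRotate n i ≠ i := by
  obtain ⟨m, rfl⟩ : ∃ m, n = m + 2 := ⟨n - 2, by have := h.three_le; omega⟩
  rw [finRotate_apply]
  simp

lemma IsSimple.vertex_ne {poly : Polygon Plane n} (h : IsSimple poly) (i : Fin n) :
    poly i ≠ poly (finRotate n i) := fun he => h.rotate_ne i (h.injective he).symm

lemma sq_add_sq_pos_of_ne {a b : Plane} (h : a ≠ b) :
    0 < (b.1 - a.1) ^ 2 + (b.2 - a.2) ^ 2 := by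
  by_contra hD
  apply h
  have h1 : b.1 - a.1 = 0 := by nlinarith [sq_nonneg (b.1 - a.1), sq_nonneg (b.2 - a.2)]
  have h2 : b.2 - a.2 = 0 := by nlinarith [sq_nonneg (b.1 - a.1), sq_nonneg (b.2 - a.2)]
  exact Prod.ext (by linarith) (by linarith)

/-- The normal vector of the segment `a b`. -/
def normal (a b : Plane) : Plane := (-(b.2 - a.2), b.1 - a.1)

lemma orient_add_normal (a b x : Plane) (t : ℝ) :
    orient a b (x + t • normal a b) =
      orient a b x + t * ((b.1 - a.1) ^ 2 + (b.2 - a.2) ^ 2) := by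
  simp only [orient, normal, Prod.fst_add, Prod.snd_add, Prod.smul_fst, Prod.smul_snd, smul_eq_mul]
  ring

lemma turn_of_dot_neg {a b z : Plane}
    (h : (a.1 - z.1) * (b.1 - z.1) + (a.2 - z.2) * (b.2 - z.2) < 0) :
    (0 < orient a b z → Real.pi / 2 < turn a b z) ∧
      (orient a b z < 0 → turn a b z < -(Real.pi / 2)) := by
  have habs : Real.pi / 2 < |turn a b z| := by
    by_contra hc
    exact absurd (Complex.abs_arg_le_pi_div_two_iff.1 (not_lt.1 hc)) (not_le.2 h)
  constructor
  · intro ho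
    have h0 : 0 ≤ turn a b z := Complex.arg_nonneg_iff.2 (by
      change 0 ≤ orient z a b; rw [← orient_rotate]; exact ho.le)
    rwa [abs_of_nonneg h0] at habs
  · intro ho
    have h0 : turn a b z < 0 := Complex.arg_neg_iff.2 (by
      change orient z a b < 0; rw [← orient_rotate]; exact ho)
    rw [abs_of_neg h0] at habs
    linarith

/-- Just beside `x`, on the two sides of its edge, the turn of this edge exceeds π/2 and is below
-π/2 respectively, while the sum of the other turns stays within π/2 of its value at `x`. So the two
winding numbers cannot both vanish, and a point with nonzero winding number is inside. -/
lemma openSegment_subset_closure_inside {poly : Polygon Plane n} (h : IsSimple poly) (i : Fin n)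
    {x : Plane} (hx : x ∈ openSegment ℝ (poly i) (poly (finRotate n i))) :
    x ∈ closure (inside poly) := by
  set a := poly i with ha
  set b := poly (finRotate n i) with hb
  have hab : a ≠ b := h.vertex_ne i
  have hxs := openSegment_subset_segment _ _ _ hx
  have hxa : x ≠ a := by rintro rfl; exact hab (left_mem_openSegment_iff.1 hx)
  have hxb : x ≠ b := by rintro rfl; exact hab (right_mem_openSegment_iff.1 hx)
  have hother : ∀ j, j ≠ i → x ∉ segment ℝ (poly j) (poly (finRotate n j)) := by
    intro j hj hxj
    rcases h.eq_vertex hj hxs hxj with h1 | h1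
    · exact hxa h1
    · exact hxb h1
  have hD := sq_add_sq_pos_of_ne hab
  have hx0 : orient a b x = 0 := by
    obtain ⟨t, -, rfl⟩ := (segment_eq_image' ℝ a b ▸ hxs : x ∈ _ '' _)
    rw [orient_line, orient_self_mid, orient_self_right]; ring
  have hdot : (a.1 - x.1) * (b.1 - x.1) + (a.2 - x.2) * (b.2 - x.2) < 0 := by
    rw [openSegment_eq_image'] at hx
    obtain ⟨t, ⟨h0, h1⟩, rfl⟩ := hx
    simp only [Prod.fst_add, Prod.snd_add, Prod.smul_fst, Prod.smul_snd, Prod.fst_sub,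
      Prod.snd_sub, smul_eq_mul]
    nlinarith [mul_pos (mul_pos h0 (sub_pos.2 h1)) hD]
  set f : Plane → ℝ := fun z => ∑ j ∈ Finset.univ.erase i, turn (poly j) (poly (finRotate n j)) z
    with hf
  have hfc : ContinuousAt f x := by
    apply tendsto_finsetSum
    intro j hj
    exact continuousAt_turn (hother j (Finset.ne_of_mem_erase hj))
  have hsum : ∀ z, winding poly z = turn a b z + f z := by
    intro z
    unfold winding
    rw [← Finset.add_sum_erase _ _ (Finset.mem_univ i)]
  rw [mem_closure_iff_nhds]
  intro N hN
  have e1 : ∀ᶠ z in 𝓝 x, (a.1 - z.1) * (b.1 - z.1) + (a.2 - z.2) * (b.2 - z.2) < 0 := by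
    have : Continuous fun z : Plane =>
      (a.1 - z.1) * (b.1 - z.1) + (a.2 - z.2) * (b.2 - z.2) := by fun_prop
    exact this.continuousAt.eventually_lt continuousAt_const hdot
  have e2 : ∀ᶠ z in 𝓝 x, |f z - f x| < Real.pi / 2 := by
    have := Metric.continuousAt_iff'.1 hfc (Real.pi / 2) (by positivity)
    simpa [Real.dist_eq] using this
  have e3 : ∀ᶠ z in 𝓝 x, ∀ j, j ≠ i → z ∉ segment ℝ (poly j) (poly (finRotate n j)) := by
    rw [eventually_all]
    intro j
    by_cases hj : j = i
    · simp [hj]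
    · have hcl : IsClosed (segment ℝ (poly j) (poly (finRotate n j))) := by
        rw [segment_eq_image']
        exact (isCompact_Icc.image (by fun_prop)).isClosed
      filter_upwards [hcl.isOpen_compl.mem_nhds (hother j hj)] with z hz _
      exact hz
  have hall := e1.and (e2.and (e3.and (eventually_mem_set.2 hN)))
  have htend : ∀ s : ℝ, Tendsto (fun ε : ℝ => x + (s * ε) • normal a b) (𝓝 0) (𝓝 x) := by
    intro s
    have : Continuous fun ε : ℝ => x + (s * ε) • normal a b := by fun_prop
    simpa using this.tendsto 0
  have hboth := (((htend 1).eventually hall).and ((htend (-1)).eventually hall)).filter_mono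
    (nhdsWithin_le_nhds (s := Set.Ioi 0))
  obtain ⟨ε, ⟨hp, hm⟩, hε⟩ := (hboth.and self_mem_nhdsWithin).exists
  have hε : 0 < ε := hε
  have notin : ∀ z, (∀ j, j ≠ i → z ∉ segment ℝ (poly j) (poly (finRotate n j))) →
      orient a b z ≠ 0 → z ∉ poly.boundary ℝ := by
    intro z hz hz0 hzb
    obtain ⟨j, hj⟩ := mem_boundary.1 hzb
    by_cases hji : j = i
    · subst hji
      rw [segment_eq_image'] at hj
      obtain ⟨t, -, rfl⟩ := hj
      apply hz0
      rw [orient_line, orient_self_mid, orient_self_right]; ring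
    · exact hz j hji hj
  have op : 0 < orient a b (x + (1 * ε) • normal a b) := by
    rw [orient_add_normal, hx0]; nlinarith
  have om : orient a b (x + (-1 * ε) • normal a b) < 0 := by
    rw [orient_add_normal, hx0]; nlinarith
  have np := notin _ hp.2.2.1 op.ne'
  have nm := notin _ hm.2.2.1 om.ne
  by_cases wp : winding poly (x + (1 * ε) • normal a b) = 0
  · by_cases wm : winding poly (x + (-1 * ε) • normal a b) = 0
    · exfalso
      have t1 := (turn_of_dot_neg hp.1).1 op
      have t2 := (turn_of_dot_neg hm.1).2 om
      rw [hsum] at wp wm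
      have h1 := abs_lt.1 hp.2.1
      have h2 := abs_lt.1 hm.2.1
      linarith [h1.1, h1.2, h2.1, h2.2]
    · exact ⟨_, hm.2.2.2, nm, isBounded_of_winding_ne_zero poly nm wm⟩
  · exact ⟨_, hp.2.2.2, np, isBounded_of_winding_ne_zero poly np wp⟩

lemma boundary_subset_closure_inside {poly : Polygon Plane n} (h : IsSimple poly) :
    poly.boundary ℝ ⊆ closure (inside poly) := by
  intro x hx
  obtain ⟨i, hi⟩ := mem_boundary.1 hx
  rw [← closure_openSegment] at hi
  exact closure_minimal (fun y hy => openSegment_subset_closure_inside h i hy) isClosed_closure hi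

/-! ### Generic points -/

/-- The point `x` is on no line through two points of `S`. -/
def Generic (S : Finset Plane) (x : Plane) : Prop :=
  ∀ s ∈ S, ∀ t ∈ S, s ≠ t → orient x s t ≠ 0

lemma dense_orient_ne {s t : Plane} (h : s ≠ t) : Dense {z : Plane | orient z s t ≠ 0} := by
  intro z
  by_cases hz : orient z s t = 0
  · have hc : Continuous fun ε : ℝ => z + ε • normal s t := by fun_prop
    have ht : Tendsto (fun ε : ℝ => z + ε • normal s t) (𝓝[≠] 0) (𝓝 z) := by
      have := hc.tendsto 0
      rw [zero_smul, add_zero] at this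
      exact this.mono_left nhdsWithin_le_nhds
    apply mem_closure_of_tendsto ht
    filter_upwards [self_mem_nhdsWithin] with ε hε
    have hε : ε ≠ 0 := hε
    rw [← orient_rotate, orient_add_normal, orient_rotate, hz, zero_add]
    exact mul_ne_zero hε (sq_add_sq_pos_of_ne h).ne'
  · exact subset_closure hz

lemma dense_generic (S : Finset Plane) : Dense {z | Generic S z} := by
  have : {z | Generic S z} =
      ⋂ p ∈ ((S ×ˢ S).filter fun p => p.1 ≠ p.2 : Finset (Plane × Plane)),
        {z : Plane | orient z p.1 p.2 ≠ 0} := by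
    ext z
    simp only [Generic, Set.mem_ofPred_eq, Set.mem_iInter, Finset.mem_filter, Finset.mem_product]
    exact ⟨fun h p hp => h _ hp.1.1 _ hp.1.2 hp.2, fun h s hs t ht hst => h (s, t) ⟨⟨hs, ht⟩, hst⟩⟩
  rw [this]
  apply dense_biInter_of_isOpen
  · intro p _
    have hc : Continuous fun z : Plane => orient z p.1 p.2 := by unfold orient; fun_prop
    exact isOpen_ne_fun hc continuous_const
  · exact Finset.countable_toSet _
  · intro p hp
    exact dense_orient_ne (Finset.mem_filter.1 hp).2

/-- To guard a simple polygon it suffices to see its generic interior points. -/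
lemma guards_of_generic {poly : Polygon Plane n} (h : IsSimple poly) (S G : Finset Plane)
    (hG : ∀ x ∈ inside poly, Generic S x → ∃ g ∈ G, segment ℝ g x ⊆ region poly) :
    Guards G (region poly) := by
  -- As a finite union of closed sets this is closed, so it contains the region as soon as it
  -- contains a dense part of the inside.
  set T : Set Plane := ⋃ g ∈ G, {x | segment ℝ g x ⊆ region poly} with hT
  have hclosed : IsClosed T := by
    apply G.finite_toSet.isClosed_biUnion
    intro g _
    have : {x | segment ℝ g x ⊆ region poly} =
        ⋂ t ∈ Set.Icc (0 : ℝ) 1, (fun x => g + t • (x - g)) ⁻¹' region poly := by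
      ext x
      simp only [Set.mem_ofPred_eq, Set.mem_iInter, segment_eq_image', Set.image_subset_iff]
      rfl
    rw [this]
    apply isClosed_biInter
    intro t _
    exact (isClosed_region poly).preimage (by fun_prop)
  have hsub : inside poly ∩ {x | Generic S x} ⊆ T := by
    rintro x ⟨hx, hg⟩
    obtain ⟨g, hgG, hs⟩ := hG x hx hg
    exact Set.mem_biUnion hgG hs
  have h1 : inside poly ⊆ T := fun x hx => by
    have := (dense_generic S).open_subset_closure_inter (isOpen_inside poly) hx
    exact closure_minimal hsub hclosed this
  have h2 : region poly ⊆ T := by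
    rw [region_eq]
    exact Set.union_subset ((boundary_subset_closure_inside h).trans (closure_minimal h1 hclosed))
      h1
  unfold Guards
  apply Set.Subset.antisymm
  · exact Set.iUnion₂_subset fun g _ x hx => hx.1
  · intro x hx
    obtain ⟨g, hgG, hs⟩ := Set.mem_iUnion₂.1 (h2 hx)
    exact Set.mem_biUnion hgG ⟨hx, hs⟩

end

end UniversalGuards

/-! ### Visible vertices next to a visible point of an edge. -/

namespace UniversalGuards

noncomputable section

open Filter Topology

variable {n : ℕ}

/-- The Grassmann–Plücker relation. -/
lemma orient_plucker (x a b c d : Plane) :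
    orient x a b * orient x c d - orient x a c * orient x b d + orient x a d * orient x b c = 0 := by
  simp only [orient]; ring

lemma orient_line_left (x a c d : Plane) (t : ℝ) :
    orient x (c + t • (d - c)) a = (1 - t) * orient x c a + t * orient x d a := by
  simp only [orient, Prod.fst_add, Prod.snd_add, Prod.smul_fst, Prod.smul_snd, Prod.fst_sub,
    Prod.snd_sub, smul_eq_mul]
  ring

lemma exists_line_param {a b z : Plane} (hab : a ≠ b) (h : orient a b z = 0) :
    ∃ t : ℝ, z = a + t • (b - a) := by
  have hD := sq_add_sq_pos_of_ne hab
  set D := (b.1 - a.1) ^ 2 + (b.2 - a.2) ^ 2 with hDdef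
  refine ⟨((z.1 - a.1) * (b.1 - a.1) + (z.2 - a.2) * (b.2 - a.2)) / D, ?_⟩
  simp only [orient] at h
  apply Prod.ext
  · simp only [Prod.fst_add, Prod.smul_fst, Prod.fst_sub, smul_eq_mul]
    field_simp
    rw [hDdef]
    linear_combination -(b.2 - a.2) * h
  · simp only [Prod.snd_add, Prod.smul_snd, Prod.snd_sub, smul_eq_mul]
    field_simp
    rw [hDdef]
    linear_combination (b.1 - a.1) * h

lemma line_param_mem_segment {a b : Plane} {t : ℝ} (h0 : 0 ≤ t) (h1 : t ≤ 1) :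
    a + t • (b - a) ∈ segment ℝ a b := by
  rw [segment_eq_image']; exact ⟨t, ⟨h0, h1⟩, rfl⟩

/-! ### Visibility -/

/-- The half-open segment from `x` to `y` avoids `Γ`. -/
def Visible (Γ : Set Plane) (x y : Plane) : Prop :=
  ∀ t : ℝ, 0 ≤ t → t < 1 → x + t • (y - x) ∉ Γ

/-- Without its end on the boundary the segment is connected and avoids the boundary, so it stays in
the bounded component of `x`. -/
lemma Visible.segment_subset {poly : Polygon Plane n} {x y : Plane} (hx : x ∈ inside poly)
    (hy : y ∈ poly.boundary ℝ) (h : Visible (poly.boundary ℝ) x y) :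
    segment ℝ y x ⊆ region poly := by
  rw [segment_symm, segment_eq_image']
  rintro _ ⟨t, ⟨h0, h1⟩, rfl⟩
  rw [region_eq]
  rcases h1.lt_or_eq with h1 | rfl
  · right
    refine ⟨h t h0 h1, ?_⟩
    have hpre : IsPreconnected ((fun s : ℝ => x + s • (y - x)) '' Set.Ico 0 1) :=
      isPreconnected_Ico.image _ (by fun_prop)
    have hsub : (fun s : ℝ => x + s • (y - x)) '' Set.Ico 0 1 ⊆ (poly.boundary ℝ)ᶜ := by
      rintro _ ⟨s, ⟨hs0, hs1⟩, rfl⟩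
      exact h s hs0 hs1
    have hmem : x + t • (y - x) ∈ connectedComponentIn (poly.boundary ℝ)ᶜ x :=
      hpre.subset_connectedComponentIn ⟨0, by simp, by simp⟩ hsub ⟨t, ⟨h0, h1⟩, rfl⟩
    rw [← connectedComponentIn_eq hmem]
    exact hx.2
  · left
    simpa using hy

lemma exists_first_hit {poly : Polygon Plane n} {x d : Plane} (hx : x ∈ inside poly)
    (hd : d ≠ 0) : ∃ t : ℝ, 0 < t ∧ x + t • d ∈ poly.boundary ℝ ∧
      Visible (poly.boundary ℝ) x (x + t • d) := by
  set f : ℝ → Plane := fun s => x + s • d with hf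
  have hfc : Continuous f := by fun_prop
  set T := {s : ℝ | 0 ≤ s ∧ f s ∈ poly.boundary ℝ} with hT
  have hTc : IsClosed T :=
    isClosed_Ici.inter ((isCompact_boundary poly).isClosed.preimage hfc)
  -- A ray that misses the boundary would lie entirely in the bounded component of `x`.
  have hne : T.Nonempty := by
    by_contra hemp
    rw [Set.not_nonempty_iff_eq_empty] at hemp
    have hsub : f '' Set.Ici 0 ⊆ (poly.boundary ℝ)ᶜ := by
      rintro _ ⟨s, hs, rfl⟩ hs'
      exact (hemp ▸ (⟨hs, hs'⟩ : s ∈ T) : s ∈ (∅ : Set ℝ))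
    have hsub' := (isPreconnected_Ici.image f hfc.continuousOn).subset_connectedComponentIn
      (x := x) ⟨0, by simp, by simp [hf]⟩ hsub
    obtain ⟨M, hM⟩ := (hx.2.subset hsub').exists_norm_le
    have hdn : 0 < ‖d‖ := norm_pos_iff.2 hd
    have hM0 : 0 ≤ M := (norm_nonneg x).trans (hM x ⟨0, by simp, by simp [hf]⟩)
    set s := (M + ‖x‖ + 1) / ‖d‖ with hs
    have hs0 : 0 ≤ s := by positivity
    have h1 := hM (f s) ⟨s, hs0, rfl⟩
    have h2 : ‖s • d‖ ≤ ‖f s‖ + ‖x‖ := by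
      have : s • d = f s - x := by simp [hf]
      rw [this]; exact norm_sub_le _ _
    rw [norm_smul, Real.norm_of_nonneg hs0, hs, div_mul_cancel₀ _ hdn.ne'] at h2
    linarith
  have hbdd : BddBelow T := ⟨0, fun s hs => hs.1⟩
  have hmem := hTc.csInf_mem hne hbdd
  have hpos : 0 < sInf T := by
    rcases hmem.1.lt_or_eq with h | h
    · exact h
    · exfalso
      have := hmem.2
      rw [← h] at this
      exact hx.1 (by simpa [hf] using this)
  refine ⟨sInf T, hpos, hmem.2, fun t h0 h1 hb => ?_⟩
  have : t * sInf T ∈ T := by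
    refine ⟨by positivity, ?_⟩
    convert hb using 1
    simp [hf, mul_smul]
  have := csInf_le hbdd this
  nlinarith

/-- `a` and `b` are the endpoints of the edge `i`, in one of the two orders. -/
def IsEdge (poly : Polygon Plane n) (i : Fin n) (a b : Plane) : Prop :=
  (a = poly i ∧ b = poly (finRotate n i)) ∨ (b = poly i ∧ a = poly (finRotate n i))

lemma IsEdge.symm {poly : Polygon Plane n} {i : Fin n} {a b : Plane} (h : IsEdge poly i a b) :
    IsEdge poly i b a := Or.symm h

lemma IsEdge.segment_eq {poly : Polygon Plane n} {i : Fin n} {a b : Plane}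
    (h : IsEdge poly i a b) : segment ℝ a b = segment ℝ (poly i) (poly (finRotate n i)) := by
  rcases h with ⟨rfl, rfl⟩ | ⟨rfl, rfl⟩
  · rfl
  · exact segment_symm ..

lemma IsEdge.subset_boundary {poly : Polygon Plane n} {i : Fin n} {a b : Plane}
    (h : IsEdge poly i a b) : segment ℝ a b ⊆ poly.boundary ℝ := fun _ hz =>
  mem_boundary.2 ⟨i, h.segment_eq ▸ hz⟩

lemma IsEdge.left_mem {poly : Polygon Plane n} {i : Fin n} {a b : Plane}
    (h : IsEdge poly i a b) : a ∈ Set.range poly.vertices := by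
  rcases h with ⟨rfl, rfl⟩ | ⟨rfl, rfl⟩ <;> exact ⟨_, rfl⟩

lemma IsEdge.ne {poly : Polygon Plane n} (hs : IsSimple poly) {i : Fin n} {a b : Plane}
    (h : IsEdge poly i a b) : a ≠ b := by
  rcases h with ⟨rfl, rfl⟩ | ⟨rfl, rfl⟩
  · exact hs.vertex_ne i
  · exact (hs.vertex_ne i).symm

lemma IsEdge.eq_vertex {poly : Polygon Plane n} (hs : IsSimple poly) {i j : Fin n}
    {a b c d : Plane} (hi : IsEdge poly i a b) (hj : IsEdge poly j c d) (hij : j ≠ i) {z : Plane}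
    (h1 : z ∈ segment ℝ a b) (h2 : z ∈ segment ℝ c d) : z = a ∨ z = b := by
  have := hs.eq_vertex hij (hi.segment_eq ▸ h1) (hj.segment_eq ▸ h2)
  rcases hi with ⟨rfl, rfl⟩ | ⟨rfl, rfl⟩
  · exact this
  · exact this.symm

/-- A vertex on an edge is one of its endpoints. -/
lemma IsEdge.eq_of_vertex_mem {poly : Polygon Plane n} (hs : IsSimple poly) {i : Fin n}
    {a b v : Plane} (hi : IsEdge poly i a b) (hv : v ∈ Set.range poly.vertices)
    (h : v ∈ segment ℝ a b) : v = a ∨ v = b := by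
  obtain ⟨j, rfl⟩ := hv
  by_cases hij : j = i
  · subst hij
    rcases hi with ⟨rfl, rfl⟩ | ⟨rfl, rfl⟩
    · exact Or.inl rfl
    · exact Or.inr rfl
  · exact hi.eq_vertex hs (Or.inl ⟨rfl, rfl⟩) hij h (left_mem_segment ..)

/-- No edge crosses the view from `x` to the vertex `v`, where `v` is the angularly first vertex
next to the visible point `y` of the edge `a b`. -/
lemma slide_crossing {poly : Polygon Plane n} (hs : IsSimple poly) {x a b v c z : Plane}
    {i : Fin n} {σ ty : ℝ} (hi : IsEdge poly i a b)
    (h0 : 0 < ty) (h1 : ty < 1) (hab : 0 < σ * orient x a b)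
    (hv1 : 0 < σ * orient x (a + ty • (b - a)) v) (hv2 : 0 ≤ σ * orient x v b)
    (hz1 : 0 < σ * orient x (a + ty • (b - a)) z) (hz2 : 0 < σ * orient a b z)
    (hzv : orient x v z = 0) (hc1 : 0 ≤ σ * orient x (a + ty • (b - a)) c)
    (hc2 : σ * orient a b c < 0) (hcv : σ * orient x v c < 0)
    (hmeet : ∀ w ∈ segment ℝ z c, w ∈ segment ℝ a b → w = a ∨ w = b) : False := by
  set y := a + ty • (b - a) with hy
  set F := σ * orient a b z with hF
  set F' := σ * orient a b c with hF'
  have hden : 0 < F - F' := by linarith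
  -- The parameter at which the segment `z c` passes the line `a b`. The rest shows that the
  -- crossing point lies on the edge strictly between the visible point and `b`.
  set τ := F / (F - F') with hτ
  have τ0 : 0 < τ := by positivity
  have τ1 : τ < 1 := by rw [hτ, div_lt_one hden]; linarith
  set w := z + τ • (c - z) with hw
  have hσ : σ ≠ 0 := by rintro rfl; simp at hab
  have w2 : orient a b w = 0 := by
    rw [hw, orient_line]
    have : σ * ((1 - τ) * orient a b z + τ * orient a b c) = 0 := by
      have : (1 - τ) * F + τ * F' = 0 := by rw [hτ]; field_simp; ring
      rw [hF, hF'] at this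
      linarith
    exact (mul_eq_zero.1 this).resolve_left hσ
  have w1 : 0 < σ * orient x y w := by
    rw [hw, orient_line]
    have := mul_pos (sub_pos.2 τ1) hz1
    have := mul_nonneg τ0.le hc1
    linarith
  have wv : σ * orient x v w < 0 := by
    rw [hw, orient_line, hzv]
    have := mul_pos_of_neg_of_neg (neg_lt_zero.2 τ0) hcv
    linarith
  have hne := hi.ne hs
  obtain ⟨r, hr⟩ := exists_line_param hne w2
  have e1 : orient x y w = (r - ty) * orient x a b := by
    rw [hr, hy]
    simp only [orient, Prod.fst_add, Prod.snd_add, Prod.smul_fst, Prod.smul_snd, Prod.fst_sub,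
      Prod.snd_sub, smul_eq_mul]
    ring
  have hr0 : ty < r := by
    rw [e1] at w1
    by_contra hc
    push Not at hc
    nlinarith
  have e2 : orient x w b = (1 - r) * orient x a b := by
    rw [hr]
    simp only [orient, Prod.fst_add, Prod.snd_add, Prod.smul_fst, Prod.smul_snd, Prod.fst_sub,
      Prod.snd_sub, smul_eq_mul]
    ring
  have e3 : orient x y b = (1 - ty) * orient x a b := by
    rw [hy]
    simp only [orient, Prod.fst_add, Prod.snd_add, Prod.smul_fst, Prod.smul_snd, Prod.fst_sub,
      Prod.snd_sub, smul_eq_mul]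
    ring
  have hr1 : r < 1 := by
    by_contra hc
    push Not at hc
    have gp := orient_plucker x y w v b
    rw [orient_swap' x w v] at wv
    have k1 : σ * orient x w b ≤ 0 := by rw [e2]; nlinarith
    have k2 : 0 < σ * orient x y b := by rw [e3]; nlinarith
    have k3 : (σ * orient x y w) * (σ * orient x v b) - (σ * orient x y v) * (σ * orient x w b) +
        (σ * orient x y b) * (σ * orient x w v) = 0 := by linear_combination σ ^ 2 * gp
    have k4 : 0 < σ * orient x w v := by linarith
    nlinarith [mul_nonneg w1.le hv2, mul_pos k2 k4, mul_nonneg hv1.le (neg_nonneg.2 k1)]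
  have hwab : w ∈ segment ℝ a b := by
    rw [hr]; exact line_param_mem_segment (by linarith) hr1.le
  have hwzc : w ∈ segment ℝ z c := line_param_mem_segment τ0.le τ1.le
  rcases hmeet w hwzc hwab with h | h
  · have : orient x y a = -ty * orient x a b := by
      rw [hy]
      simp only [orient, Prod.fst_add, Prod.snd_add, Prod.smul_fst, Prod.smul_snd, Prod.fst_sub,
        Prod.snd_sub, smul_eq_mul]
      ring
    rw [h, this] at w1
    nlinarith
  · rw [h, orient_self_right] at e2
    have : 0 < (1 - r) * (σ * orient x a b) := mul_pos (by linarith) hab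
    rw [mul_left_comm, ← e2, mul_zero] at this
    exact lt_irrefl _ this

/-- From a visible point `y` of an edge `a b`, turning towards `b` one meets a visible vertex
before the edge ends. -/
lemma exists_visible_vertex {poly : Polygon Plane n} (hs : IsSimple poly) {S : Finset Plane}
    (hS : Set.range poly.vertices = S) {x a b : Plane} (hx : x ∉ poly.boundary ℝ)
    (hgen : Generic S x) {i : Fin n} (hi : IsEdge poly i a b) {σ ty : ℝ}
    (h0 : 0 < ty) (h1 : ty < 1) (hab : 0 < σ * orient x a b)
    (hvis : Visible (poly.boundary ℝ) x (a + ty • (b - a))) :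
    ∃ v ∈ S, Visible (poly.boundary ℝ) x v ∧ 0 < σ * orient x (a + ty • (b - a)) v ∧
      0 ≤ σ * orient x v b ∧ 0 ≤ σ * orient a b v ∧ (v ≠ b → 0 < σ * orient a b v) ∧
      ∀ g ∈ S, 0 < σ * orient x (a + ty • (b - a)) g → 0 < σ * orient x g v →
        σ * orient a b g < 0 := by
  classical
  set y := a + ty • (b - a) with hy
  have hσ : σ ≠ 0 := by rintro rfl; simp at hab
  have hyb : 0 < σ * orient x y b := by
    have : orient x y b = (1 - ty) * orient x a b := by
      rw [hy]
      simp only [orient, Prod.fst_add, Prod.snd_add, Prod.smul_fst, Prod.smul_snd, Prod.fst_sub,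
        Prod.snd_sub, smul_eq_mul]
      ring
    rw [this]
    nlinarith
  have hne := hi.ne hs
  have memS : ∀ {v}, v ∈ S ↔ v ∈ Set.range poly.vertices := by intro v; rw [hS]; simp
  have hbS : b ∈ S := memS.2 hi.symm.left_mem
  -- The candidates are the vertices in the triangle `x y b` off the ray from `x` through `y`; `b`
  -- itself is one of them.
  set T := S.filter fun g => 0 < σ * orient x y g ∧ 0 ≤ σ * orient x g b ∧ 0 ≤ σ * orient a b g
    with hT
  have hbT : b ∈ T := by
    rw [hT, Finset.mem_filter]
    exact ⟨hbS, hyb, by simp [orient_self_right], by simp [orient_self_right]⟩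
  -- The minimized quotient is the parameter at which the ray from `x` through `g` meets the segment
  -- from `y` to `b`, so it orders the candidates by angle.
  obtain ⟨v, hvT, hmin⟩ := T.exists_min_image
    (fun g => (σ * orient x y g) / (σ * orient x y g + σ * orient x g b)) ⟨b, hbT⟩
  rw [hT, Finset.mem_filter] at hvT
  obtain ⟨hvS, hv1, hv2, hv3⟩ := hvT
  have gp : ∀ g, (σ * orient x y v) * (σ * orient x g b) - (σ * orient x y g) * (σ * orient x v b)
      = (σ * orient x y b) * (σ * orient x g v) := by
    intro g
    linear_combination (-σ ^ 2) * orient_plucker x y g v b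
  have hclean : ∀ g ∈ S, 0 < σ * orient x y g → 0 < σ * orient x g v → σ * orient a b g < 0 := by
    intro g hg hg1 hg2
    by_contra hc
    push Not at hc
    have hpos : 0 < (σ * orient x y b) * (σ * orient x g v) := mul_pos hyb hg2
    rw [← gp g] at hpos
    have hB : 0 ≤ σ * orient x g b := by
      by_contra hB
      push Not at hB
      nlinarith [mul_nonneg hg1.le hv2]
    have := hmin g (by rw [hT, Finset.mem_filter]; exact ⟨hg, hg1, hB, hc⟩)
    rw [div_le_div_iff₀ (by linarith) (by linarith)] at this
    nlinarith
  have hstrict : v ≠ b → 0 < σ * orient a b v := by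
    intro hvb
    rcases hv3.lt_or_eq with h | h
    · exact h
    exfalso
    have h' : orient a b v = 0 := (mul_eq_zero.1 h.symm).resolve_left hσ
    obtain ⟨r, hr⟩ := exists_line_param hne h'
    have e1 : orient x y v = (r - ty) * orient x a b := by
      rw [hr, hy]
      simp only [orient, Prod.fst_add, Prod.snd_add, Prod.smul_fst, Prod.smul_snd, Prod.fst_sub,
        Prod.snd_sub, smul_eq_mul]
      ring
    have e2 : orient x v b = (1 - r) * orient x a b := by
      rw [hr]
      simp only [orient, Prod.fst_add, Prod.snd_add, Prod.smul_fst, Prod.smul_snd, Prod.fst_sub,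
        Prod.snd_sub, smul_eq_mul]
      ring
    have hr0 : ty < r := by
      rw [e1] at hv1
      by_contra hc
      push Not at hc
      nlinarith
    have hr1 : r ≤ 1 := by
      rw [e2] at hv2
      by_contra hc
      push Not at hc
      nlinarith
    have hmem : v ∈ segment ℝ a b := by
      rw [hr]; exact line_param_mem_segment (by linarith) hr1
    rcases hi.eq_of_vertex_mem hs (memS.1 hvS) hmem with h2 | h2
    · have : r • (b - a) = 0 := by rw [h2] at hr; simpa using hr.symm
      rcases smul_eq_zero.1 this with h3 | h3
      · linarith
      · exact hne (sub_eq_zero.1 h3).symm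
    · exact hvb h2
  refine ⟨v, hvS, ?_, hv1, hv2, hv3, hstrict, hclean⟩
  have hvΓ : v ∈ poly.boundary ℝ := by
    obtain ⟨j, hj⟩ := memS.1 hvS
    rw [← hj]; exact vertex_mem_boundary poly j
  have hvx : v ≠ x := fun h => hx (h ▸ hvΓ)
  intro t t0 t1 hz
  have tpos : 0 < t := by
    rcases t0.lt_or_eq with h | h
    · exact h
    · rw [← h] at hz; simp at hz; exact absurd hz hx
  set z := x + t • (v - x) with hzdef
  have habx : 0 < σ * orient a b x := by rwa [orient_rotate]
  have hz2 : 0 < σ * orient a b z := by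
    rw [hzdef, orient_line]
    have := mul_pos (sub_pos.2 t1) habx
    have := mul_nonneg tpos.le hv3
    linarith
  have hz1 : 0 < σ * orient x y z := by
    rw [hzdef, orient_line, orient_self_mid]
    have := mul_pos tpos hv1
    linarith
  have hzv : orient x v z = 0 := by
    rw [hzdef, orient_line, orient_self_mid, orient_self_right]; ring
  have hzv' : z ≠ v := by
    intro h
    have : (1 - t) • (v - x) = 0 := by
      have h2 : z - v = -((1 - t) • (v - x)) := by
        rw [hzdef, sub_smul, one_smul]; abel
      rw [h, sub_self] at h2
      exact neg_eq_zero.1 h2.symm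
    rcases smul_eq_zero.1 this with h3 | h3
    · linarith
    · exact hvx (sub_eq_zero.1 h3)
  obtain ⟨j, hj⟩ := mem_boundary.1 hz
  have hji : j ≠ i := by
    rintro rfl
    rw [← hi.segment_eq, segment_eq_image'] at hj
    obtain ⟨r, -, hr⟩ := hj
    have : orient a b z = 0 := by
      rw [← hr, orient_line, orient_self_mid, orient_self_right]; ring
    rw [this] at hz2
    simp at hz2
  -- Here `c` is the end on `y`'s side of an edge that crosses the view to `v`. If `c` is angularly
  -- between `y` and `v`, the minimality of `v` puts it behind `a b`. Otherwise the edge reaches the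
  -- line `x y`: in front of `y` it would block `y`, at `y` it would touch the interior of the edge
  -- `a b`, and behind `y` it has crossed `a b`.
  have main : ∀ c d : Plane, IsEdge poly j c d → z ∈ segment ℝ c d → σ * orient x v c < 0 →
      False := by
    intro c d hcd hzcd hc
    have hcS : c ∈ S := memS.2 hcd.left_mem
    have hsub : segment ℝ z c ⊆ segment ℝ c d :=
      (convex_segment c d).segment_subset hzcd (left_mem_segment ..)
    have hmeet : ∀ w ∈ segment ℝ z c, w ∈ segment ℝ a b → w = a ∨ w = b := fun w hw hw' =>
      hi.eq_vertex hs hcd hji hw' (hsub hw)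
    have hcv : 0 < σ * orient x c v := by rw [orient_swap']; linarith
    by_cases hc1 : 0 < σ * orient x y c
    · exact slide_crossing hs hi h0 h1 hab hv1 hv2 hz1 hz2 hzv hc1.le
        (hclean c hcS hc1 hcv) hc hmeet
    · push Not at hc1
      set F := σ * orient x y z with hF
      set F' := σ * orient x y c with hF'
      have hden : 0 < F - F' := by linarith
      set τ := F / (F - F') with hτ
      have τ0 : 0 < τ := by positivity
      have τ1 : τ ≤ 1 := by rw [hτ, div_le_one hden]; linarith
      set w := z + τ • (c - z) with hw
      have w1 : orient x y w = 0 := by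
        rw [hw, orient_line]
        have : σ * ((1 - τ) * orient x y z + τ * orient x y c) = 0 := by
          have : (1 - τ) * F + τ * F' = 0 := by rw [hτ]; field_simp; ring
          rw [hF, hF'] at this
          linarith
        exact (mul_eq_zero.1 this).resolve_left hσ
      have wv : σ * orient x v w < 0 := by
        rw [hw, orient_line, hzv]
        have := mul_pos_of_neg_of_neg (neg_lt_zero.2 τ0) hc
        linarith
      have hwzc : w ∈ segment ℝ z c := line_param_mem_segment τ0.le τ1
      by_cases hw2 : σ * orient a b w < 0
      · exact slide_crossing hs hi h0 h1 hab hv1 hv2 hz1 hz2 hzv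
          (by rw [w1, mul_zero]) hw2 wv fun u hu => hmeet u
            ((convex_segment z c).segment_subset (left_mem_segment ..) hwzc hu)
      · push Not at hw2
        have hyab : y ∈ segment ℝ a b := line_param_mem_segment h0.le h1.le
        have hxy : x ≠ y := fun h => hx (h ▸ hi.subset_boundary hyab)
        obtain ⟨r, hr⟩ := exists_line_param hxy w1
        have hr0 : 0 < r := by
          rw [hr, orient_line, orient_self_mid, orient_swap' x y v] at wv
          by_contra hcon
          push Not at hcon
          nlinarith [mul_nonneg (neg_nonneg.2 hcon) hv1.le]
        have hyline : orient a b y = 0 := by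
          rw [hy, orient_line, orient_self_mid, orient_self_right]; ring
        have hr1 : r ≤ 1 := by
          rw [hr, orient_line, hyline] at hw2
          by_contra hcon
          push Not at hcon
          nlinarith [mul_pos (sub_pos.2 hcon) habx]
        rcases hr1.lt_or_eq with hr1 | hr1
        · exact hvis r hr0.le hr1 (hr ▸ hcd.subset_boundary (hsub hwzc))
        · rw [hr1, one_smul, add_sub_cancel] at hr
          have hyne : y ≠ a ∧ y ≠ b := by
            constructor
            · intro h
              have : ty • (b - a) = 0 := by
                have : a + ty • (b - a) = a := h
                simpa using this
              rcases smul_eq_zero.1 this with h3 | h3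
              · linarith
              · exact hne (sub_eq_zero.1 h3).symm
            · intro h
              rw [h, orient_self_right] at hyb
              simp at hyb
          rcases hmeet w hwzc (hr ▸ hyab) with h | h
          · exact hyne.1 (hr ▸ h)
          · exact hyne.2 (hr ▸ h)
  set c := poly j with hc
  set d := poly (finRotate n j) with hd
  have hcd : IsEdge poly j c d := Or.inl ⟨rfl, rfl⟩
  have hcS : c ∈ S := memS.2 ⟨j, rfl⟩
  have hdS : d ∈ S := memS.2 ⟨_, rfl⟩
  have hcdne := hcd.ne hs
  obtain ⟨r, ⟨r0, r1⟩, hr⟩ := (segment_eq_image' ℝ c d ▸ hj : z ∈ _ '' _)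
  have hsum : (1 - r) * orient x v c + r * orient x v d = 0 := by
    rw [← orient_line]; simp only at hr; rw [hr]; exact hzv
  have hcv : c ≠ v := by
    intro h
    rw [h, orient_self_right, mul_zero, zero_add] at hsum
    rcases mul_eq_zero.1 hsum with h3 | h3
    · apply hzv'
      rw [← hr, h3]; simp [h]
    · exact hgen v hvS d hdS (fun h4 => hcdne (h.trans h4)) h3
  have hdv : d ≠ v := by
    intro h
    rw [h, orient_self_right, mul_zero, add_zero] at hsum
    rcases mul_eq_zero.1 hsum with h3 | h3
    · apply hzv'
      rw [← hr, show r = 1 by linarith]; simp [h]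
    · exact hgen v hvS c hcS (fun h4 => hcdne (h4.symm.trans h.symm)) h3
  have hco := hgen v hvS c hcS hcv.symm
  have hdo := hgen v hvS d hdS hdv.symm
  rcases lt_or_gt_of_ne (mul_ne_zero hσ hco) with h | h
  · exact main c d hcd hj h
  · refine main d c hcd.symm (segment_symm ℝ c d ▸ hj) ?_
    have hsum' : (1 - r) * (σ * orient x v c) + r * (σ * orient x v d) = 0 := by
      linear_combination σ * hsum
    by_contra hcon
    push Not at hcon
    have hrne : r ≠ 1 := by
      rintro rfl
      rw [sub_self, zero_mul, one_mul, zero_add] at hsum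
      exact hdo hsum
    have : 0 < 1 - r := lt_of_le_of_ne (by linarith) (fun h => hrne (by linarith))
    nlinarith [mul_pos this h, mul_nonneg r0 hcon]

end

end UniversalGuards

/-! ### Windows, and the criterion for sets of points without guards. -/

namespace UniversalGuards

noncomputable section

open Filter Topology

variable {n : ℕ}

/-- The edge `p q` is seen from `x` between the points `l` and `r`: `l` hides the part of the
edge next to `p` (or equals `p`), `r` the part next to `q`, and the part of the triangle below the
visible part of the edge contains no further points of `S`. -/
structure Window (S : Finset Plane) (x p q l r : Plane) : Prop where
  p_mem : p ∈ S
  q_mem : q ∈ S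
  edge : 0 < orient x q p
  view : 0 < orient x r l
  left : 0 ≤ orient x l p
  right : 0 ≤ orient x q r
  left' : 0 < orient x q l
  right' : 0 < orient x r p
  left_front : l ≠ p → 0 < orient q p l
  right_front : r ≠ q → 0 < orient q p r
  clean : ∀ g ∈ S, 0 < orient x r g → 0 < orient x g l → orient q p g < 0

lemma orient_edge_point (x a b : Plane) (t : ℝ) :
    orient x (a + t • (b - a)) b = (1 - t) * orient x a b ∧
      orient x (a + t • (b - a)) a = -t * orient x a b := by
  constructor <;>
  · simp only [orient, Prod.fst_add, Prod.snd_add, Prod.smul_fst, Prod.smul_snd, Prod.fst_sub,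
      Prod.snd_sub, smul_eq_mul]
    ring

/-- Turning from the visible point `y` towards either end gives `l` and `r`, by
`exists_visible_vertex` with both signs. Together the two emptiness statements cover the whole angle
from `r` to `l` except the ray through `y`, where a point of `S` must be behind the edge because `y`
is visible and is no vertex. -/
lemma exists_window {poly : Polygon Plane n} (hs : IsSimple poly) {S : Finset Plane}
    (hS : Set.range poly.vertices = S) {x p q : Plane} (hx : x ∉ poly.boundary ℝ)
    (hgen : Generic S x) {i : Fin n} (hi : IsEdge poly i q p) {t : ℝ}
    (h0 : 0 < t) (h1 : t < 1) (hqp : 0 < orient x q p)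
    (hvis : Visible (poly.boundary ℝ) x (q + t • (p - q))) :
    ∃ l ∈ S, ∃ r ∈ S, Visible (poly.boundary ℝ) x l ∧ Visible (poly.boundary ℝ) x r ∧
      Window S x p q l r ∧ 0 < orient x (q + t • (p - q)) l ∧
      0 < orient x r (q + t • (p - q)) := by
  obtain ⟨l, hlS, hlv, l1, l2, l3, l4, l5⟩ := exists_visible_vertex hs hS hx hgen hi (σ := 1)
    h0 h1 (by rwa [one_mul]) hvis
  have hy : p + (1 - t) • (q - p) = q + t • (p - q) := by
    rw [sub_smul, one_smul, ← neg_sub p q, smul_neg]; abel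
  obtain ⟨r, hrS, hrv, r1, r2, r3, r4, r5⟩ := exists_visible_vertex hs hS hx hgen hi.symm
    (σ := -1) (ty := 1 - t) (by linarith) (by linarith)
    (by rw [orient_swap' x q p]; linarith) (by rwa [hy])
  rw [hy] at r1 r5
  obtain ⟨e1, e2⟩ := orient_edge_point x q p t
  have hyab : q + t • (p - q) ∈ segment ℝ q p := line_param_mem_segment h0.le h1.le
  have hyne : ∀ g ∈ S, g ≠ q + t • (p - q) := by
    rintro g hg h
    have : g ∈ Set.range poly.vertices := by rw [hS]; exact hg
    rcases hi.eq_of_vertex_mem hs this (h ▸ hyab) with h' | h'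
    · rw [← h, h', orient_self_right] at e2
      nlinarith
    · rw [← h, h', orient_self_right] at e1
      nlinarith
  have hyp : 0 < orient x (q + t • (p - q)) p := by rw [e1]; exact mul_pos (by linarith) hqp
  have hyq : 0 < orient x q (q + t • (p - q)) := by rw [orient_swap', e2]; nlinarith
  have hyline : orient q p (q + t • (p - q)) = 0 := by
    rw [orient_line, orient_self_mid, orient_self_right]; ring
  set y := q + t • (p - q) with hydef
  simp only [one_mul] at l1 l2 l3 l4 l5
  rw [orient_swap' x r y] at r1
  rw [orient_swap' x q r] at r2
  rw [orient_swap q p r] at r3 r4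
  have r1' : 0 < orient x r y := by linarith
  have r2' : 0 ≤ orient x q r := by linarith
  have hql : 0 < orient x q l := by
    have := orient_plucker x q y l p
    by_contra hc
    push Not at hc
    nlinarith [mul_nonneg hyq.le l2, mul_pos hqp l1, mul_nonneg (neg_nonneg.2 hc) hyp.le]
  have hrp : 0 < orient x r p := by
    have := orient_plucker x q r y p
    by_contra hc
    push Not at hc
    nlinarith [mul_nonneg r2' hyp.le, mul_pos hqp r1', mul_nonneg (neg_nonneg.2 hc) hyq.le]
  have hrl : 0 < orient x r l := by
    have := orient_plucker x r y l p
    by_contra hc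
    push Not at hc
    nlinarith [mul_nonneg r1'.le l2, mul_pos hrp l1, mul_nonneg (neg_nonneg.2 hc) hyp.le]
  have memS : ∀ {v}, v ∈ S ↔ v ∈ Set.range poly.vertices := by intro v; rw [hS]; simp
  refine ⟨l, hlS, r, hrS, hlv, hrv, ⟨memS.2 hi.symm.left_mem, memS.2 hi.left_mem, hqp, hrl, l2,
    r2', hql, hrp, l4, fun h => by have := r4 h; linarith, ?_⟩, l1, r1'⟩
  intro g hg g1 g2
  rcases lt_trichotomy (orient x y g) 0 with h | h | h
  · have := r5 g hg (by linarith) (by rw [orient_swap' x r g]; linarith)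
    rw [orient_swap q p g] at this
    linarith
  · have hxy : x ≠ y := fun h => hx (h ▸ hi.subset_boundary hyab)
    obtain ⟨s, hs'⟩ := exists_line_param hxy h
    have hgΓ : g ∈ poly.boundary ℝ := by
      obtain ⟨j, hj⟩ := memS.1 hg
      rw [← hj]; exact vertex_mem_boundary poly j
    have s0 : 0 < s := by
      rw [hs', orient_line, orient_self_mid] at g1
      by_contra hc
      push Not at hc
      nlinarith
    rw [hs', orient_line, hyline, orient_rotate]
    rcases lt_trichotomy s 1 with h' | h' | h'
    · exact absurd hgΓ (hs' ▸ hvis s s0.le h')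
    · rw [h', one_smul, add_sub_cancel] at hs'
      exact absurd hs' (hyne g hg)
    · nlinarith
  · exact l5 g hg h g2

/-- Every direction from an inside point is a nonnegative combination of directions to two
visible vertices. -/
lemma exists_visible_combination {poly : Polygon Plane n} (hs : IsSimple poly) {S : Finset Plane}
    (hS : Set.range poly.vertices = S) {x d : Plane} (hx : x ∈ inside poly)
    (hgen : Generic S x) (hd : d ≠ 0) :
    ∃ l ∈ S, ∃ r ∈ S, Visible (poly.boundary ℝ) x l ∧ Visible (poly.boundary ℝ) x r ∧
      ∃ α β : ℝ, 0 ≤ α ∧ 0 ≤ β ∧ d = α • (l - x) + β • (r - x) := by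
  obtain ⟨t, t0, hΓ, hvis⟩ := exists_first_hit hx hd
  obtain ⟨i, hi⟩ := mem_boundary.1 hΓ
  set y := x + t • d with hy
  have memS : ∀ {v}, v ∈ S ↔ v ∈ Set.range poly.vertices := by intro v; rw [hS]; simp
  have vertexCase : y ∈ S → ∃ l ∈ S, ∃ r ∈ S, Visible (poly.boundary ℝ) x l ∧
      Visible (poly.boundary ℝ) x r ∧
      ∃ α β : ℝ, 0 ≤ α ∧ 0 ≤ β ∧ d = α • (l - x) + β • (r - x) := by
    intro hyS
    refine ⟨y, hyS, y, hyS, hvis, hvis, t⁻¹, 0, by positivity, le_rfl, ?_⟩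
    rw [hy, add_sub_cancel_left, smul_smul, inv_mul_cancel₀ t0.ne']
    simp
  have main : ∀ p q : Plane, IsEdge poly i q p → y ∈ segment ℝ q p → 0 < orient x q p →
      ∃ l ∈ S, ∃ r ∈ S, Visible (poly.boundary ℝ) x l ∧ Visible (poly.boundary ℝ) x r ∧
      ∃ α β : ℝ, 0 ≤ α ∧ 0 ≤ β ∧ d = α • (l - x) + β • (r - x) := by
    intro p q hqp hyqp ho
    rw [segment_eq_image'] at hyqp
    obtain ⟨s, ⟨s0, s1⟩, hsy⟩ := hyqp
    simp only at hsy
    rcases s0.lt_or_eq with s0 | s0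
    · rcases s1.lt_or_eq with s1 | s1
      · obtain ⟨l, hl, r, hr, vl, vr, w, l1, r1⟩ := exists_window hs hS hx.1 hgen hqp s0 s1 ho
          (hsy ▸ hvis)
        -- Cramer's rule for `y - x` in terms of `l - x` and `r - x`, divided by `t`.
        refine ⟨l, hl, r, hr, vl, vr, orient x r y / (t * orient x r l),
          orient x y l / (t * orient x r l), ?_, ?_, ?_⟩
        · exact div_nonneg (by rw [← hsy]; exact r1.le) (mul_pos t0 w.view).le
        · exact div_nonneg (by rw [← hsy]; exact l1.le) (mul_pos t0 w.view).le
        · have hv := w.view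
          have e1 : orient x r l * t * d.1 = orient x r y * (l.1 - x.1) +
              orient x y l * (r.1 - x.1) := by
            simp only [orient, hy, Prod.fst_add, Prod.snd_add, Prod.smul_fst, Prod.smul_snd,
              smul_eq_mul]
            ring
          have e2 : orient x r l * t * d.2 = orient x r y * (l.2 - x.2) +
              orient x y l * (r.2 - x.2) := by
            simp only [orient, hy, Prod.fst_add, Prod.snd_add, Prod.smul_fst, Prod.smul_snd,
              smul_eq_mul]
            ring
          apply Prod.ext
          · simp only [Prod.fst_add, Prod.smul_fst, Prod.fst_sub, smul_eq_mul]
            field_simp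
            linarith
          · simp only [Prod.snd_add, Prod.smul_snd, Prod.snd_sub, smul_eq_mul]
            field_simp
            linarith
      · apply vertexCase
        rw [s1, one_smul, add_sub_cancel] at hsy
        exact memS.2 (hsy ▸ hqp.symm.left_mem)
    · apply vertexCase
      rw [← s0, zero_smul, add_zero] at hsy
      exact memS.2 (hsy ▸ hqp.left_mem)
  have hed : IsEdge poly i (poly i) (poly (finRotate n i)) := Or.inl ⟨rfl, rfl⟩
  have hne := hgen _ (memS.2 hed.left_mem) _ (memS.2 hed.symm.left_mem) (hed.ne hs)
  rcases lt_or_gt_of_ne hne with h | h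
  · exact main _ _ hed.symm (segment_symm ℝ (poly i) _ ▸ hi) (by rw [orient_swap']; linarith)
  · exact main _ _ hed hi h

/-- An inside point lies in the convex hull of the vertices that it sees. -/
lemma mem_convexHull_of_visible {poly : Polygon Plane n} (hs : IsSimple poly) {S : Finset Plane}
    (hS : Set.range poly.vertices = S) {x : Plane} (hx : x ∈ inside poly)
    (hgen : Generic S x) {B : Finset Plane}
    (hB : ∀ v ∈ S, Visible (poly.boundary ℝ) x v → v ∈ B) : x ∈ convexHull ℝ (B : Set Plane) := by
  by_contra hc
  obtain ⟨f, u, hu, hf⟩ := geometric_hahn_banach_point_closed (convex_convexHull ℝ (B : Set Plane))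
    (B.finite_toSet.isClosed_convexHull ℝ) hc
  have hpos : ∀ v ∈ S, Visible (poly.boundary ℝ) x v → 0 < f (v - x) := by
    intro v hv hvis
    have := hf v (subset_convexHull ℝ _ (hB v hv hvis))
    rw [map_sub]; linarith
  -- The functional is positive on the directions to visible vertices, hence nonnegative on all
  -- directions. This fails for the direction opposite to a visible vertex.
  have hnn : ∀ d : Plane, d ≠ 0 → 0 ≤ f d := by
    intro d hd
    obtain ⟨l, hl, r, hr, vl, vr, α, β, hα, hβ, rfl⟩ :=
      exists_visible_combination hs hS hx hgen hd
    rw [map_add, map_smul, map_smul, smul_eq_mul, smul_eq_mul]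
    have := mul_nonneg hα (hpos l hl vl).le
    have := mul_nonneg hβ (hpos r hr vr).le
    linarith
  obtain ⟨l, hl, r, hr, vl, -⟩ := exists_visible_combination hs hS hx hgen
    (show ((1 : ℝ), (0 : ℝ)) ≠ 0 by simp)
  have h1 := hpos l hl vl
  have hlx : -(l - x) ≠ 0 := by
    intro h
    rw [neg_eq_zero] at h
    rw [h, map_zero] at h1
    exact lt_irrefl _ h1
  have := hnn _ hlx
  rw [map_neg] at this
  linarith

/-- If no vertex hides a part of an edge from `x`, then `x` sees all vertices: turning around
`x`, each visible edge is followed by its successor. -/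
lemma all_visible_of_windows {poly : Polygon Plane n} (hs : IsSimple poly) {S : Finset Plane}
    (hS : Set.range poly.vertices = S) {x : Plane} (hx : x ∈ inside poly) (hgen : Generic S x)
    (hW : ∀ p q l r, Window S x p q l r → l ∈ S → r ∈ S → Visible (poly.boundary ℝ) x l →
      Visible (poly.boundary ℝ) x r → l = p ∧ r = q) :
    ∀ v ∈ S, Visible (poly.boundary ℝ) x v := by
  have memS : ∀ {v}, v ∈ S ↔ v ∈ Set.range poly.vertices := by intro v; rw [hS]; simp
  set E : Fin n → Prop := fun i => ∃ t : ℝ, 0 < t ∧ t < 1 ∧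
    Visible (poly.boundary ℝ) x (poly i + t • (poly (finRotate n i) - poly i)) with hE
  -- Since the window ends at `a` and `b` themselves, both ends are visible and every vertex in the
  -- angle between them is behind the edge. The sign σ makes this independent of the sense in which
  -- `x` sees the edge.
  have LH : ∀ i a b, IsEdge poly i a b → ∀ t : ℝ, 0 < t → t < 1 →
      Visible (poly.boundary ℝ) x (a + t • (b - a)) →
      Visible (poly.boundary ℝ) x a ∧ Visible (poly.boundary ℝ) x b ∧
      ∀ σ : ℝ, 0 < σ * orient x a b → ∀ g ∈ S, 0 < σ * orient x a g → 0 < σ * orient x g b →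
        σ * orient a b g < 0 := by
    intro i a b hab t t0 t1 hvis
    have hne := hgen _ (memS.2 hab.left_mem) _ (memS.2 hab.symm.left_mem) (hab.ne hs)
    rcases lt_or_gt_of_ne hne with h | h
    · have ho : 0 < orient x b a := by rw [orient_swap']; linarith
      obtain ⟨l, hl, r, hr, vl, vr, w, -⟩ := exists_window hs hS hx.1 hgen hab.symm
        (t := 1 - t) (by linarith) (by linarith) ho (by
          have : b + (1 - t) • (a - b) = a + t • (b - a) := by
            rw [sub_smul, one_smul, ← neg_sub b a, smul_neg]; abel
          rwa [this])
      obtain ⟨rfl, rfl⟩ := hW _ _ _ _ w hl hr vl vr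
      refine ⟨vl, vr, fun σ hσ g hg g1 g2 => ?_⟩
      have hσ0 : σ < 0 := by
        by_contra hc
        push Not at hc
        nlinarith
      have := w.clean g hg (by rw [orient_swap']; nlinarith) (by rw [orient_swap']; nlinarith)
      rw [orient_swap] at this
      nlinarith
    · obtain ⟨l, hl, r, hr, vl, vr, w, -⟩ := exists_window hs hS hx.1 hgen hab t0 t1 h hvis
      obtain ⟨rfl, rfl⟩ := hW _ _ _ _ w hl hr vl vr
      refine ⟨vr, vl, fun σ hσ g hg g1 g2 => ?_⟩
      have hσ0 : 0 < σ := by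
        by_contra hc
        push Not at hc
        nlinarith
      have := w.clean g hg (by nlinarith) (by nlinarith)
      nlinarith
  have hnext : ∀ i, E i → E (finRotate n i) := by
    rintro i ⟨t, t0, t1, hvis⟩
    set a := poly i with ha
    set b := poly (finRotate n i) with hb
    have hab : IsEdge poly i a b := Or.inl ⟨rfl, rfl⟩
    obtain ⟨-, vb, -⟩ := LH i a b hab t t0 t1 hvis
    have hbS : b ∈ S := memS.2 hab.symm.left_mem
    have hne := hgen _ (memS.2 hab.left_mem) _ hbS (hab.ne hs)
    obtain ⟨σ, hσ⟩ : ∃ σ : ℝ, 0 < σ * orient x a b := ⟨orient x a b, mul_self_pos.2 hne⟩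
    have ev : ∀ᶠ ε in 𝓝[>] (0 : ℝ), ∀ g ∈ S, 0 < σ * orient x b g →
        σ * orient x g (b + ε • (b - a)) < 0 := by
      rw [Finset.eventually_all]
      intro g _
      by_cases hg : 0 < σ * orient x b g
      · have hc : Continuous fun ε : ℝ => σ * orient x g (b + ε • (b - a)) := by
          unfold orient; fun_prop
        have h0 : σ * orient x g (b + (0 : ℝ) • (b - a)) < 0 := by
          rw [zero_smul, add_zero, orient_swap' x b g]; linarith
        filter_upwards [nhdsWithin_le_nhds (hc.continuousAt.eventually_lt continuousAt_const h0)]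
          with ε hε _
        exact hε
      · exact Eventually.of_forall fun ε h => absurd h hg
    -- The ray towards `b + ε (b - a)` passes just behind the end `b`; ε is so small that no vertex
    -- direction lies between the two rays.
    obtain ⟨ε, hε, hε0⟩ := (ev.and self_mem_nhdsWithin).exists
    have hε0 : 0 < ε := hε0
    set z := b + ε • (b - a) with hz
    have hbz : 0 < σ * orient x b z := by
      have : orient x b z = ε * orient x a b := by
        rw [hz]
        simp only [orient, Prod.fst_add, Prod.snd_add, Prod.smul_fst, Prod.smul_snd,
          Prod.fst_sub, Prod.snd_sub, smul_eq_mul]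
        ring
      rw [this]
      nlinarith
    have hzx : z - x ≠ 0 := by
      intro h
      rw [sub_eq_zero.1 h, orient_self_mid] at hbz
      simp at hbz
    obtain ⟨τ, τ0, hΓ, hv⟩ := exists_first_hit hx hzx
    set y := x + τ • (z - x) with hy
    have hgy : ∀ g, orient x g y = τ * orient x g z := by
      intro g
      rw [hy, orient_line, orient_self_mid]; ring
    have hyS : y ∉ S := by
      intro h
      have h1 := hε y h (by rw [hgy]; nlinarith)
      have h2 := hgy y
      rw [orient_self_right] at h2
      have h3 : orient x y z = 0 := by
        rcases mul_eq_zero.1 h2.symm with h | h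
        · linarith
        · exact h
      rw [h3] at h1
      simp at h1
    have hby : 0 < σ * orient x b y := by rw [hgy]; nlinarith
    obtain ⟨j, hj⟩ := mem_boundary.1 hΓ
    -- The edge hit by this ray must end at `b`: otherwise `b` is angularly between its ends, hence
    -- behind it, and the edge would cross the view to `b`.
    have key : ∀ c d, IsEdge poly j c d → ∀ s : ℝ, 0 < s → s < 1 → y = c + s • (d - c) →
        0 < σ * orient x c d → b = c ∨ b = d := by
      intro c d hcd s s0 s1 hys ho
      obtain ⟨vc, vd, hclean⟩ := LH j c d hcd s s0 s1 (hys ▸ hv)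
      have hcS : c ∈ S := memS.2 hcd.left_mem
      have hdS : d ∈ S := memS.2 hcd.symm.left_mem
      obtain ⟨e1, e2⟩ := orient_edge_point x c d s
      rw [← hys] at e1 e2
      have hyd : 0 < σ * orient x y d := by rw [e1]; nlinarith
      have hcy : 0 < σ * orient x c y := by rw [orient_swap', e2]; nlinarith
      by_contra hcon
      push Not at hcon
      have hσ0 : σ ≠ 0 := by rintro rfl; simp at ho
      have hcb : 0 < σ * orient x c b := by
        by_contra h
        have h1 : σ * orient x c b ≠ 0 :=
          mul_ne_zero hσ0 (hgen c hcS b hbS hcon.1.symm)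
        have h2 : 0 < σ * orient x b c := by
          rw [orient_swap']
          rcases lt_or_gt_of_ne h1 with h3 | h3
          · linarith
          · exact absurd h3 h
        have h3 := hε c hcS h2
        rw [hgy] at hcy
        nlinarith
      have hbd : 0 < σ * orient x b d := by
        have gp : (σ * orient x c b) * (σ * orient x y d) - (σ * orient x c y) * (σ * orient x b d)
            + (σ * orient x c d) * (σ * orient x b y) = 0 := by
          linear_combination σ ^ 2 * orient_plucker x c b y d
        by_contra h
        push Not at h
        nlinarith [mul_pos hcb hyd, mul_pos ho hby, mul_nonneg hcy.le (neg_nonneg.2 h)]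
      have hbeyond := hclean σ ho b hbS hcb hbd
      have hden : 0 < σ * orient x c d - σ * orient c d b := by linarith
      set u := σ * orient x c d / (σ * orient x c d - σ * orient c d b) with hu
      have u0 : 0 < u := div_pos ho hden
      have u1 : u < 1 := by rw [hu, div_lt_one hden]; linarith
      set w := x + u • (b - x) with hw
      have hwl : orient c d w = 0 := by
        rw [hw, orient_line, orient_rotate]
        have : σ * ((1 - u) * orient x c d + u * orient c d b) = 0 := by
          have : u * (σ * orient x c d - σ * orient c d b) = σ * orient x c d :=
            div_mul_cancel₀ _ hden.ne'
          linarith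
        exact (mul_eq_zero.1 this).resolve_left hσ0
      obtain ⟨v, hvw⟩ := exists_line_param (hcd.ne hs) hwl
      obtain ⟨e3, e4⟩ := orient_edge_point x c d v
      rw [← hvw] at e3 e4
      have hwd : orient x w d = u * orient x b d := by
        rw [hw]
        simp only [orient, Prod.fst_add, Prod.snd_add, Prod.smul_fst, Prod.smul_snd,
          Prod.fst_sub, Prod.snd_sub, smul_eq_mul]
        ring
      have hwc : orient x w c = -u * orient x c b := by
        rw [hw]
        simp only [orient, Prod.fst_add, Prod.snd_add, Prod.smul_fst, Prod.smul_snd,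
          Prod.fst_sub, Prod.snd_sub, smul_eq_mul]
        ring
      have v1 : v ≤ 1 := by
        by_contra h
        push Not at h
        have e5 : (1 - v) * (σ * orient x c d) = u * (σ * orient x b d) := by
          linear_combination σ * (hwd - e3)
        nlinarith [mul_pos u0 hbd, mul_pos (sub_pos.2 h) ho]
      have v0 : 0 ≤ v := by
        by_contra h
        push Not at h
        have e5 : v * (σ * orient x c d) = u * (σ * orient x c b) := by
          linear_combination σ * (e4 - hwc)
        nlinarith [mul_pos u0 hcb, mul_pos (neg_pos.2 h) ho]
      have hwseg : w ∈ segment ℝ c d := by rw [hvw]; exact line_param_mem_segment v0 v1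
      exact vb u u0.le u1 (hcd.subset_boundary hwseg)
    have hjed : IsEdge poly j (poly j) (poly (finRotate n j)) := Or.inl ⟨rfl, rfl⟩
    rw [segment_eq_image'] at hj
    obtain ⟨s, ⟨s0, s1⟩, hys⟩ := hj
    simp only at hys
    have s0 : 0 < s := by
      rcases s0.lt_or_eq with h | h
      · exact h
      · rw [← h, zero_smul, add_zero] at hys
        exact absurd (memS.2 (hys ▸ hjed.left_mem)) hyS
    have s1 : s < 1 := by
      rcases s1.lt_or_eq with h | h
      · exact h
      · rw [h, one_smul, add_sub_cancel] at hys
        exact absurd (memS.2 (hys ▸ hjed.symm.left_mem)) hyS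
    have hσ0 : σ ≠ 0 := by rintro rfl; simp at hσ
    have hjne : σ * orient x (poly j) (poly (finRotate n j)) ≠ 0 :=
      mul_ne_zero hσ0 (hgen _ (memS.2 hjed.left_mem) _ (memS.2 hjed.symm.left_mem) (hjed.ne hs))
    have hbj : b = poly j ∨ b = poly (finRotate n j) := by
      rcases lt_or_gt_of_ne hjne with h | h
      · refine (key _ _ hjed.symm (1 - s) (by linarith) (by linarith) ?_ ?_).symm
        · rw [← hys, sub_smul, one_smul, ← neg_sub (poly (finRotate n j)) (poly j), smul_neg]; abel
        · rw [orient_swap']; linarith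
      · exact key _ _ hjed s s0 s1 hys.symm h
    rcases hbj with h | h
    · have : finRotate n i = j := hs.injective h
      rw [this]
      exact ⟨s, s0, s1, by rw [hys]; exact hv⟩
    · have : finRotate n i = finRotate n j := hs.injective h
      have : i = j := (finRotate n).injective this
      exfalso
      subst this
      have := (orient_edge_point x a b s).1
      rw [hys] at this
      rw [orient_swap', this] at hby
      nlinarith [mul_pos (sub_pos.2 s1) hσ]
  have hstart : ∃ i, E i := by
    obtain ⟨i0, hi0⟩ : ∃ i : Fin n, True := ⟨⟨0, by have := hs.three_le; omega⟩, trivial⟩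
    set a := poly i0
    set b := poly (finRotate n i0)
    have hab : IsEdge poly i0 a b := Or.inl ⟨rfl, rfl⟩
    have haS := memS.2 hab.left_mem
    have hbS := memS.2 hab.symm.left_mem
    have hne := hgen a haS b hbS (hab.ne hs)
    -- For small ε the ray towards `a + ε (b - a)` avoids all vertices, so what it hits first is an
    -- interior point of some edge.
    obtain ⟨ε, hε, hε0⟩ : ∃ ε : ℝ, (∀ g ∈ S, g ≠ a → orient x g (a + ε • (b - a)) ≠ 0) ∧ 0 < ε := by
      have ev : ∀ᶠ ε in 𝓝[>] (0 : ℝ), ∀ g ∈ S, g ≠ a → orient x g (a + ε • (b - a)) ≠ 0 := by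
        rw [Finset.eventually_all]
        intro g hg
        by_cases hga : g = a
        · exact Eventually.of_forall fun ε h => absurd hga h
        · have hc : Continuous fun ε : ℝ => orient x g (a + ε • (b - a)) := by
            unfold orient; fun_prop
          have h0 : orient x g (a + (0 : ℝ) • (b - a)) ≠ 0 := by
            rw [zero_smul, add_zero]; exact hgen g hg a haS hga
          filter_upwards [nhdsWithin_le_nhds (hc.continuousAt.eventually_ne h0)] with ε hε _
          exact hε
      obtain ⟨ε, h1, h2⟩ := (ev.and self_mem_nhdsWithin).exists
      exact ⟨ε, h1, h2⟩
    set z := a + ε • (b - a) with hz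
    have haz : orient x a z = ε * orient x a b := by
      rw [orient_swap', (orient_edge_point x a b ε).2]; ring
    have hzx : z - x ≠ 0 := by
      intro h
      rw [sub_eq_zero.1 h, orient_self_mid] at haz
      exact mul_ne_zero hε0.ne' hne haz.symm
    obtain ⟨τ, τ0, hΓ, hv⟩ := exists_first_hit hx hzx
    have hyS : x + τ • (z - x) ∉ S := by
      intro h
      have h1 : orient x (x + τ • (z - x)) z = 0 := by
        rw [orient_line_left, orient_self_left, orient_self_right]; ring
      by_cases h2 : x + τ • (z - x) = a
      · rw [h2, haz] at h1
        exact mul_ne_zero hε0.ne' hne h1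
      · exact hε _ h h2 h1
    obtain ⟨j, hj⟩ := mem_boundary.1 hΓ
    have hjed : IsEdge poly j (poly j) (poly (finRotate n j)) := Or.inl ⟨rfl, rfl⟩
    rw [segment_eq_image'] at hj
    obtain ⟨s, ⟨s0, s1⟩, hys⟩ := hj
    simp only at hys
    refine ⟨j, s, ?_, ?_, by rw [hys]; exact hv⟩
    · rcases s0.lt_or_eq with h | h
      · exact h
      · rw [← h, zero_smul, add_zero] at hys
        exact absurd (memS.2 (hys ▸ hjed.left_mem)) hyS
    · rcases s1.lt_or_eq with h | h
      · exact h
      · rw [h, one_smul, add_sub_cancel] at hys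
        exact absurd (memS.2 (hys ▸ hjed.symm.left_mem)) hyS
  have hall : ∀ i, E i := by
    obtain ⟨m, rfl⟩ : ∃ m, n = m + 2 := ⟨n - 2, by have := hs.three_le; omega⟩
    obtain ⟨i0, h0⟩ := hstart
    intro i
    -- The rotation is a single cycle, so passing from edge to edge reaches all of them.
    obtain ⟨k, rfl⟩ := isCycle_finRotate.exists_pow_eq (hs.rotate_ne i0) (hs.rotate_ne i)
    induction k with
    | zero => simpa using h0
    | succ k ih =>
      rw [pow_succ', Equiv.Perm.mul_apply]
      exact hnext _ ih
  intro v hv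
  obtain ⟨i, rfl⟩ := memS.1 hv
  obtain ⟨t, t0, t1, hvis⟩ := hall i
  exact (LH i _ _ (Or.inl ⟨rfl, rfl⟩) t t0 t1 hvis).1

/-- A set of points that cannot hide edges need not contain guards. -/
theorem isUniversalGuardSet_sdiff {S B : Finset Plane} (hB : B ⊂ S)
    (hW : ∀ x p q l r, x ∈ convexHull ℝ (B : Set Plane) → Generic S x → Window S x p q l r →
      l ∈ B → r ∈ B → l = p ∧ r = q) : IsUniversalGuardSet S (S \ B) := by
  refine ⟨Finset.sdiff_subset, ?_⟩
  rintro _ ⟨poly, hs, hS, rfl⟩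
  apply guards_of_generic hs S
  intro x hx hgen
  by_contra hc
  push Not at hc
  have memS : ∀ {v}, v ∈ S ↔ v ∈ Set.range poly.vertices := by intro v; rw [hS]; simp
  have hvis : ∀ v ∈ S, Visible (poly.boundary ℝ) x v → v ∈ B := by
    intro v hv hvis
    by_contra hvB
    apply hc v (Finset.mem_sdiff.2 ⟨hv, hvB⟩)
    apply hvis.segment_subset hx
    obtain ⟨i, rfl⟩ := memS.1 hv
    exact vertex_mem_boundary poly i
  have hconv := mem_convexHull_of_visible hs hS hx hgen hvis
  have hall := all_visible_of_windows hs hS hx hgen fun p q l r w hl hr vl vr =>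
    hW x p q l r hconv hgen w (hvis l hl vl) (hvis r hr vr)
  exact hB.2 fun v hv => hvis v hv (hall v hv)

end

end UniversalGuards

namespace UniversalGuards

noncomputable section

/-! ### The outer shell needs no guards -/

lemma mem_interior_of_triangle {K : Set Plane} (hK : Convex ℝ K) {a b c z : Plane} (ha : a ∈ K)
    (hb : b ∈ K) (hc : c ∈ K) (h1 : 0 < orient a b z) (h2 : 0 < orient b c z)
    (h3 : 0 < orient c a z) : z ∈ interior K := by
  rw [mem_interior]
  refine ⟨{w | 0 < orient a b w} ∩ {w | 0 < orient b c w} ∩ {w | 0 < orient c a w}, ?_,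
    ((isOpen_lt continuous_const (continuous_orient a b)).inter
      (isOpen_lt continuous_const (continuous_orient b c))).inter
      (isOpen_lt continuous_const (continuous_orient c a)), ⟨⟨h1, h2⟩, h3⟩⟩
  rintro w ⟨⟨w1, w2⟩, w3⟩
  have w1 : 0 < orient a b w := w1
  have w2 : 0 < orient b c w := w2
  have w3 : 0 < orient c a w := w3
  set D := orient a b w + orient b c w + orient c a w with hD
  have hD0 : 0 < D := by positivity
  have hw : w = (orient b c w / D) • a + (orient c a w / D) • b + (orient a b w / D) • c := by
    have e : D = orient a b c := by simp only [hD, orient]; ring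
    apply Prod.ext
    · simp only [Prod.fst_add, Prod.smul_fst, smul_eq_mul]
      field_simp
      rw [e]; simp only [orient]; ring
    · simp only [Prod.snd_add, Prod.smul_snd, smul_eq_mul]
      field_simp
      rw [e]; simp only [orient]; ring
  rw [hw]
  have := hK.sum_mem (t := Finset.univ) (w := ![orient b c w / D, orient c a w / D,
    orient a b w / D]) (z := ![a, b, c]) (by
      intro i _; fin_cases i <;> simp <;> positivity) (by
      simp [Fin.sum_univ_three]; field_simp; rw [hD]; ring) (by
      intro i _; fin_cases i <;> simpa)
  simpa [Fin.sum_univ_three] using this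

lemma shell_subset (S : Finset Plane) : shell S ⊆ S := by
  classical
  intro s hs
  unfold shell at hs
  exact (Finset.mem_filter.1 hs).1

lemma mem_shell {S : Finset Plane} {s : Plane} :
    s ∈ shell S ↔ s ∈ S ∧ s ∉ interior (convexHull ℝ (S : Set Plane)) := by
  classical
  unfold shell
  rw [Finset.mem_filter, S.finite_toSet.isClosed_convexHull ℝ |>.frontier_eq]
  exact ⟨fun h => ⟨h.1, h.2.2⟩, fun h => ⟨h.1, subset_convexHull ℝ _ h.1, h.2⟩⟩

/-- If `l ≠ p`, then by the inequalities of the window and genericity `l` is strictly inside the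
triangle `x q p`, which lies in the hull of `S`; but shell points are not interior. The same holds
for `r`. -/
theorem isUniversalGuardSet_sdiff_shell {S : Finset Plane} (h : (S \ shell S).Nonempty) :
    IsUniversalGuardSet S (S \ shell S) := by
  have hsub := shell_subset S
  apply isUniversalGuardSet_sdiff
  · refine ⟨hsub, fun hc => ?_⟩
    rw [Finset.sdiff_eq_empty_iff_subset.2 hc] at h
    exact Finset.not_nonempty_empty h
  · intro x p q l r hx hgen w hl hr
    have hK := convex_convexHull ℝ (S : Set Plane)
    have hxK : x ∈ convexHull ℝ (S : Set Plane) := convexHull_mono (by exact_mod_cast hsub) hx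
    have hSK : ∀ s ∈ S, s ∈ convexHull ℝ (S : Set Plane) := fun s hs =>
      subset_convexHull ℝ _ hs
    have hfr : ∀ s ∈ shell S, s ∉ interior (convexHull ℝ (S : Set Plane)) := by
      intro s hs
      exact (mem_shell.1 hs).2
    constructor
    · by_contra hne
      apply hfr l hl
      apply mem_interior_of_triangle hK hxK (hSK q w.q_mem) (hSK p w.p_mem) w.left'
        (w.left_front hne)
      rw [← orient_rotate p x l]
      exact lt_of_le_of_ne w.left (Ne.symm (hgen l (hsub hl) p w.p_mem hne))
    · by_contra hne
      apply hfr r hr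
      apply mem_interior_of_triangle hK hxK (hSK q w.q_mem) (hSK p w.p_mem)
        (lt_of_le_of_ne w.right (Ne.symm (hgen q w.q_mem r (hsub hr) (Ne.symm hne))))
        (w.right_front hne)
      rw [← orient_rotate p x r]
      exact w.right'

/-! ### Convex chains -/

/-- The value at `z` of the linear functional with coefficients `u`. -/
def lin (u z : Plane) : ℝ := u.1 * z.1 + u.2 * z.2

/-- With `lin u` as abscissa, this compares the slopes of two lines through the common point `o`
without division. It and its mirror image below underlie most of the sign arguments about chains;
"above" means to the left of a line with increasing abscissa. -/
lemma lin_mul_orient_start (u o d b z : Plane) : (lin u d - lin u o) * orient o b z =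
    (lin u b - lin u o) * orient o d z - (lin u z - lin u o) * orient o d b := by
  simp only [orient, lin]; ring

lemma lin_mul_orient_end (u o d b z : Plane) : (lin u d - lin u o) * orient b o z =
    (lin u b - lin u o) * orient d o z - (lin u z - lin u o) * orient d o b := by
  simp only [orient, lin]; ring

/-- A chain `c 0, …, c N` of points, increasing in the direction `u`, and turning weakly to the
right, such that all points of `T` are weakly to the right of all its edges. -/
structure IsChain (u : Plane) (T : Finset Plane) (N : ℕ) (c : ℕ → Plane) : Prop where
  mem : ∀ i ≤ N, c i ∈ T
  lt : ∀ i < N, lin u (c i) < lin u (c (i + 1))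
  below : ∀ i < N, ∀ s ∈ T, orient (c i) (c (i + 1)) s ≤ 0

namespace IsChain

variable {u : Plane} {T : Finset Plane} {N : ℕ} {c : ℕ → Plane}

lemma lin_lt (h : IsChain u T N c) {a b : ℕ} (hab : a < b) (hb : b ≤ N) :
    lin u (c a) < lin u (c b) := by
  induction b, hab using Nat.le_induction with
  | base => exact h.lt a (by omega)
  | succ k hk ih => exact (ih (by omega)).trans (h.lt k (by omega))

lemma below_pred (h : IsChain u T N c) {b : ℕ} (h0 : 0 < b) (hb : b ≤ N) {s : Plane}
    (hs : s ∈ T) : orient (c (b - 1)) (c b) s ≤ 0 := by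
  have := h.below (b - 1) (by omega) s hs
  rwa [Nat.sub_add_cancel h0] at this

/-- To the right of `c b`, the lines through `c b` and earlier points are above the line of the
last edge. -/
lemma le_right (h : IsChain u T N c) {a b : ℕ} (hab : a < b) (hb : b ≤ N) {z : Plane}
    (hz : lin u (c b) ≤ lin u z) (hz' : orient (c (b - 1)) (c b) z ≤ 0) :
    orient (c a) (c b) z ≤ 0 := by
  have h1 := h.below_pred (by omega) hb (h.mem a (by omega))
  have h2 := h.lin_lt (show b - 1 < b by omega) hb
  have h3 := h.lin_lt hab hb
  have h4 := lin_mul_orient_end u (c b) (c (b - 1)) (c a) z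
  by_contra hc
  push Not at hc
  nlinarith [mul_nonneg (sub_nonneg.2 hz) (neg_nonneg.2 h1),
    mul_nonneg (sub_nonneg.2 h3.le) (neg_nonneg.2 hz'), mul_pos (sub_pos.2 h2) hc]

lemma triple (h : IsChain u T N c) {a j b : ℕ} (haj : a < j) (hjb : j < b) (hb : b ≤ N) :
    orient (c a) (c j) (c b) ≤ 0 :=
  h.le_right haj (by omega) (h.lin_lt hjb hb).le
    (h.below_pred (by omega) (by omega) (h.mem b hb))

/-- From `c a` on to the right the line of the first edge is weakly above the chord, and from `c b`
on to the left that of the last edge is; one of the two cases always applies. -/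
lemma pos_of_ends (h : IsChain u T N c) {a b : ℕ} (hab : a < b) (hb : b ≤ N) {w : Plane}
    (h1 : 0 < orient (c a) (c (a + 1)) w) (h2 : 0 < orient (c (b - 1)) (c b) w) :
    0 < orient (c a) (c b) w := by
  have hl := h.lin_lt hab hb
  by_contra hc
  push Not at hc
  rcases le_total (lin u (c a)) (lin u w) with hw | hw
  · have h3 := h.below a (by omega) _ (h.mem b hb)
    have h4 := h.lt a (by omega)
    have h5 := lin_mul_orient_start u (c a) (c (a + 1)) (c b) w
    nlinarith [mul_nonneg (sub_nonneg.2 hw) (neg_nonneg.2 h3), mul_pos (sub_pos.2 hl) h1,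
      mul_nonneg (sub_nonneg.2 h4.le) (neg_nonneg.2 hc)]
  · have h3 := h.below_pred (by omega) hb (h.mem a (by omega))
    have h4 := h.lin_lt (show b - 1 < b by omega) hb
    have h5 := lin_mul_orient_end u (c b) (c (b - 1)) (c a) w
    nlinarith [mul_nonneg (sub_nonneg.2 (hw.trans hl.le)) (neg_nonneg.2 h3),
      mul_pos (sub_pos.2 hl) h2, mul_nonneg (sub_nonneg.2 h4.le) (neg_nonneg.2 hc)]

/-- The line through `c j` and `c b` runs weakly above the chord from `c a` to the left of `c b`,
and weakly above the last edge to the right of it. `neg_left` is the mirror image. -/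
lemma neg_right (h : IsChain u T N c) {a j b : ℕ} (haj : a < j) (hjb : j < b) (hb : b ≤ N)
    {x : Plane} (h1 : orient (c a) (c b) x < 0) (h2 : orient (c (b - 1)) (c b) x < 0) :
    orient (c j) (c b) x < 0 := by
  have hl := h.lin_lt (haj.trans hjb) hb
  have hl' := h.lin_lt hjb hb
  by_contra hc
  push Not at hc
  rcases le_total (lin u x) (lin u (c b)) with hx | hx
  · have h3 := h.triple haj hjb hb
    rw [← neg_nonneg, ← orient_swap'] at h3
    have h5 := lin_mul_orient_end u (c b) (c a) (c j) x
    nlinarith [mul_nonneg (sub_nonneg.2 hx) h3, mul_pos (sub_pos.2 hl') (neg_pos.2 h1),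
      mul_nonneg (sub_nonneg.2 hl.le) hc]
  · have h3 := h.below_pred (by omega) hb (h.mem j (by omega))
    have h4 := h.lin_lt (show b - 1 < b by omega) hb
    have h5 := lin_mul_orient_end u (c b) (c (b - 1)) (c j) x
    nlinarith [mul_nonneg (sub_nonneg.2 hx) (neg_nonneg.2 h3),
      mul_pos (sub_pos.2 hl') (neg_pos.2 h2), mul_nonneg (sub_nonneg.2 h4.le) hc]

lemma neg_left (h : IsChain u T N c) {a j b : ℕ} (haj : a < j) (hjb : j < b) (hb : b ≤ N)
    {x : Plane} (h1 : orient (c a) (c b) x < 0) (h2 : orient (c a) (c (a + 1)) x < 0) :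
    orient (c a) (c j) x < 0 := by
  have hl := h.lin_lt (haj.trans hjb) hb
  have hl' := h.lin_lt haj (by omega)
  by_contra hc
  push Not at hc
  rcases le_total (lin u (c a)) (lin u x) with hx | hx
  · have h3 := h.triple haj hjb hb
    rw [← neg_nonneg, ← orient_swap'] at h3
    have h5 := lin_mul_orient_start u (c a) (c b) (c j) x
    nlinarith [mul_nonneg (sub_nonneg.2 hx) h3, mul_pos (sub_pos.2 hl') (neg_pos.2 h1),
      mul_nonneg (sub_nonneg.2 hl.le) hc]
  · have h3 := h.below a (by omega) _ (h.mem j (by omega))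
    have h4 := h.lt a (by omega)
    have h5 := lin_mul_orient_start u (c a) (c (a + 1)) (c j) x
    nlinarith [mul_nonneg (sub_nonneg.2 hx) (neg_nonneg.2 h3),
      mul_pos (sub_pos.2 hl') (neg_pos.2 h2), mul_nonneg (sub_nonneg.2 h4.le) hc]

end IsChain

/-! ### Chains that are seen entirely or not at all from each outer point -/

namespace Window

variable {S : Finset Plane} {x p q l r : Plane}

/-- If the edge bypasses `l` below a point `g` of the view, then `p` is on the outer side of the
line `l g`. -/
lemma orient_pos_left (w : Window S x p q l r) (hgen : Generic S x) (hl : l ∈ S) (hlp : l ≠ p)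
    {g : Plane} (hg : g ∈ S) (h1 : 0 < orient x r g) (h2 : 0 < orient x g l) :
    0 < orient l g p := by
  have a1 := w.clean g hg h1 h2
  have a2 := w.left_front hlp
  have a3 : 0 < orient x l p := lt_of_le_of_ne w.left (Ne.symm (hgen l hl p w.p_mem hlp))
  have a4 : 0 < orient x g p := by
    have gp := orient_plucker x r g l p
    by_contra hc
    push Not at hc
    nlinarith [mul_pos h1 a3, mul_pos w.right' h2, mul_nonneg w.view.le (neg_nonneg.2 hc)]
  have gp : orient x l p * orient q p g - orient x g p * orient q p l +
      orient x q p * orient l g p = 0 := by simp only [orient]; ring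
  by_contra hc
  push Not at hc
  nlinarith [mul_pos a3 (neg_pos.2 a1), mul_pos a4 a2, mul_nonneg w.edge.le (neg_nonneg.2 hc)]

lemma orient_pos_right (w : Window S x p q l r) (hgen : Generic S x) (hr : r ∈ S) (hrq : r ≠ q)
    {g : Plane} (hg : g ∈ S) (h1 : 0 < orient x r g) (h2 : 0 < orient x g l) :
    0 < orient g r q := by
  have a1 := w.clean g hg h1 h2
  have a2 := w.right_front hrq
  have a3 : 0 < orient x q r := lt_of_le_of_ne w.right
    (Ne.symm (hgen q w.q_mem r hr (Ne.symm hrq)))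
  have a4 : 0 < orient x q g := by
    have gp := orient_plucker x q r g l
    by_contra hc
    push Not at hc
    nlinarith [mul_pos a3 h2, mul_pos w.left' h1, mul_nonneg w.view.le (neg_nonneg.2 hc)]
  have gp : orient x q r * orient q p g - orient x q g * orient q p r +
      orient x q p * orient g r q = 0 := by simp only [orient]; ring
  by_contra hc
  push Not at hc
  nlinarith [mul_pos a3 (neg_pos.2 a1), mul_pos a4 a2, mul_nonneg w.edge.le (neg_nonneg.2 hc)]

lemma front_left (w : Window S x p q l r) : 0 ≤ orient q p l := by
  by_cases h : l = p
  · rw [h, orient_self_right]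
  · exact (w.left_front h).le

lemma front_right (w : Window S x p q l r) : 0 ≤ orient q p r := by
  by_cases h : r = q
  · rw [h, orient_self_mid]
  · exact (w.right_front h).le

end Window

/-- A point below the chord but weakly above the line from `l` cannot be weakly below the line
`d l`. -/
lemma chord_nonneg_left {x p l r d : Plane} (h1 : orient d l x < 0) (h2 : orient d l p ≤ 0)
    (h3 : 0 < orient r l x) (h4 : 0 ≤ orient x l p) (h5 : orient r d l ≤ 0) :
    0 ≤ orient r l p := by
  have gp : -orient r d l * orient x l p + orient d l x * orient r l p
      - orient d l p * orient r l x = 0 := by simp only [orient]; ring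
  by_contra hc
  push Not at hc
  nlinarith [mul_nonneg (neg_nonneg.2 h5) h4, mul_pos_of_neg_of_neg h1 hc,
    mul_nonneg (neg_nonneg.2 h2) h3.le]

lemma chord_nonneg_right {x q l r d : Plane} (h1 : orient r d x < 0) (h2 : orient r d q ≤ 0)
    (h3 : 0 < orient r l x) (h4 : 0 ≤ orient x q r) (h5 : orient r d l ≤ 0) :
    0 ≤ orient r l q := by
  have gp : -orient r d l * orient x q r + orient r d x * orient r l q
      - orient r d q * orient r l x = 0 := by simp only [orient]; ring
  by_contra hc
  push Not at hc
  nlinarith [mul_nonneg (neg_nonneg.2 h5) h4, mul_pos_of_neg_of_neg h1 hc,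
    mul_nonneg (neg_nonneg.2 h2) h3.le]

open scoped Classical in
/-- The points of even index of a chain of inner points such that no outer point sees only a
part of the chain need not contain guards. -/
theorem isUniversalGuardSet_sdiff_chain {S T : Finset Plane} (hTS : T ⊆ S) {m : ℕ} (hm : 0 < m)
    {u : Plane} {c : ℕ → Plane} (hc : IsChain u T (2 * m) c)
    (hout : ∀ w ∈ S, w ∉ T → (∀ i < 2 * m, 0 < orient (c i) (c (i + 1)) w) ∨
      ∀ i < 2 * m, orient (c i) (c (i + 1)) w ≤ 0) :
    IsUniversalGuardSet S (S \ (Finset.range (m + 1)).image fun i => c (2 * i)) := by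
  have hinj : ∀ i ≤ 2 * m, ∀ j ≤ 2 * m, c i = c j → i = j := by
    intro i hi j hj hij
    rcases lt_trichotomy i j with h | h | h
    · have := hc.lin_lt h hj
      rw [hij] at this
      exact absurd this (lt_irrefl _)
    · exact h
    · have := hc.lin_lt h hi
      rw [hij] at this
      exact absurd this (lt_irrefl _)
  have hBT : ((Finset.range (m + 1)).image fun i => c (2 * i)) ⊆ T := by
    intro b hb
    obtain ⟨i, hi, rfl⟩ := Finset.mem_image.1 hb
    rw [Finset.mem_range] at hi
    exact hc.mem _ (by omega)
  apply isUniversalGuardSet_sdiff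
  · refine ⟨hBT.trans hTS, fun h => ?_⟩
    obtain ⟨i, hi, he⟩ := Finset.mem_image.1 (h (hTS (hc.mem 1 (by omega))))
    rw [Finset.mem_range] at hi
    have := hinj _ (by omega) _ (by omega) he
    omega
  · intro x p q l r hx hgen w hl hr
    have hcS : ∀ i ≤ 2 * m, c i ∈ S := fun i hi => hTS (hc.mem i hi)
    -- The weak inequality holds on the hull of the unguarded points; genericity makes it strict.
    have hxb : ∀ i < 2 * m, orient (c i) (c (i + 1)) x < 0 := by
      intro i hi
      have hconv : Convex ℝ {z | orient (c i) (c (i + 1)) z ≤ 0} := by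
        intro y hy z hz a b ha hb hab
        have e : orient (c i) (c (i + 1)) (a • y + b • z) =
            a * orient (c i) (c (i + 1)) y + b * orient (c i) (c (i + 1)) z := by
          have hb' : b = 1 - a := by linarith
          rw [hb']
          simp only [orient, Prod.fst_add, Prod.snd_add, Prod.smul_fst, Prod.smul_snd,
            smul_eq_mul]
          ring
        have hy : orient (c i) (c (i + 1)) y ≤ 0 := hy
        have hz : orient (c i) (c (i + 1)) z ≤ 0 := hz
        change orient (c i) (c (i + 1)) (a • y + b • z) ≤ 0
        rw [e]
        nlinarith
      have hle : orient (c i) (c (i + 1)) x ≤ 0 :=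
        convexHull_min (fun s hs => hc.below i hi s (hBT hs)) hconv hx
      refine lt_of_le_of_ne hle ?_
      rw [← orient_rotate, ← orient_rotate]
      refine hgen _ (hcS i hi.le) _ (hcS (i + 1) hi) fun he => ?_
      have := hinj _ hi.le _ hi he
      omega
    have hpred : ∀ b, 0 < b → b ≤ 2 * m → orient (c (b - 1)) (c b) x < 0 := by
      intro b h0 hb
      have := hxb (b - 1) (by omega)
      rwa [Nat.sub_add_cancel h0] at this
    have hlS := hTS (hBT hl)
    have hrS := hTS (hBT hr)
    obtain ⟨i, hi, hil⟩ := Finset.mem_image.1 hl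
    obtain ⟨j, hj, hjr⟩ := Finset.mem_image.1 hr
    rw [Finset.mem_range] at hi hj
    have hview := w.view
    have hdich : ∀ z ∈ S, ∀ a b, a < b → b ≤ 2 * m →
        (∀ s, a ≤ s → s < b → 0 < orient (c s) (c (s + 1)) z) ∨
          ∀ s, a ≤ s → s < b → orient (c s) (c (s + 1)) z ≤ 0 := by
      intro z hz a b hab hb
      by_cases hzT : z ∈ T
      · exact Or.inr fun s _ hs => hc.below s (by omega) z hzT
      · rcases hout z hz hzT with h | h
        · exact Or.inl fun s _ hs => h s (by omega)
        · exact Or.inr fun s _ hs => h s (by omega)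
    rcases lt_trichotomy i j with hij | hij | hij
    · -- the view is across a chord seen from below
      set a := 2 * i with ha
      set b := 2 * j with hb
      have hchord : orient (c a) (c b) x < 0 := by
        rw [hil, hjr, orient_rotate, orient_swap']; linarith
      have clean : ∀ s, a < s → s < b → 0 < orient x r (c s) ∧ 0 < orient x (c s) l := by
        intro s hs1 hs2
        have n1 := hc.neg_left hs1 hs2 (by omega) hchord (hxb a (by omega))
        have n2 := hc.neg_right hs1 hs2 (by omega) hchord (hpred b (by omega) (by omega))
        rw [hil] at n1
        rw [hjr] at n2
        constructor
        · rw [← orient_rotate, orient_swap]; linarith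
        · rw [← orient_rotate, orient_swap]; linarith
      have hT : ∀ s, a < s → s < b → orient l (c s) r ≤ 0 := by
        intro s hs1 hs2
        have := hc.triple hs1 hs2 (by omega)
        rwa [hil, hjr] at this
      -- Under these inequalities `c s` is a convex combination of `l`, `r` and `z`. None of these
      -- is behind the edge `q p`, but `c s` is.
      have bary : ∀ z s, a < s → s < b → 0 < orient l (c s) z → 0 < orient (c s) r z →
          orient q p z = 0 → False := by
        intro z s hs1 hs2 k1 k2 hz
        obtain ⟨v1, v2⟩ := clean s hs1 hs2
        have k3 := w.clean (c s) (hcS s (by omega)) v1 v2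
        have k4 := hT s hs1 hs2
        have e : (orient l (c s) z + orient (c s) r z - orient l (c s) r) * orient q p (c s) =
            orient (c s) r z * orient q p l + orient l (c s) z * orient q p r
              - orient l (c s) r * orient q p z := by simp only [orient]; ring
        rw [hz, mul_zero, sub_zero] at e
        nlinarith [mul_nonneg k2.le w.front_left, mul_nonneg k1.le w.front_right]
      constructor
      · by_contra hlp
        -- Both ends of the chord have even index, so the vertex after `l` is not `r` but lies
        -- strictly between. The end `p` is outside of the edge from `l` to it, hence outside of all
        -- edges of the block.
        obtain ⟨v1, v2⟩ := clean (a + 1) (by omega) (by omega)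
        have k1 := w.orient_pos_left hgen hlS hlp (hcS (a + 1) (by omega)) v1 v2
        rcases hdich p w.p_mem a b (by omega) (by omega) with h | h
        · have k2 := hc.pos_of_ends (show a + 1 < b by omega) (by omega)
            (h (a + 1) (by omega) (by omega)) (by
              have := h (b - 1) (by omega) (by omega)
              rwa [Nat.sub_add_cancel (by omega)] at this)
          rw [hjr] at k2
          exact bary p (a + 1) (by omega) (by omega) k1 k2 (orient_self_right _ _)
        · have := h a le_rfl (by omega)
          rw [hil] at this
          linarith
      · by_contra hrq
        obtain ⟨v1, v2⟩ := clean (b - 1) (by omega) (by omega)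
        have k1 := w.orient_pos_right hgen hrS hrq (hcS (b - 1) (by omega)) v1 v2
        rcases hdich q w.q_mem a b (by omega) (by omega) with h | h
        · have k2 := hc.pos_of_ends (show a < b - 1 by omega) (by omega)
            (h a (by omega) (by omega)) (by
              have := h (b - 1 - 1) (by omega) (by omega)
              rwa [Nat.sub_add_cancel (by omega)] at this)
          rw [hil] at k2
          exact bary q (b - 1) (by omega) (by omega) k2 k1 (orient_self_mid _ _)
        · have := h (b - 1) (by omega) (by omega)
          rw [Nat.sub_add_cancel (by omega), hjr] at this
          linarith
    · exfalso
      rw [← hil, ← hjr, hij, orient_self_right] at hview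
      exact lt_irrefl _ hview
    · -- the view is across a chord seen from above
      set a := 2 * j with ha
      set b := 2 * i with hb
      have hchord : 0 < orient r l x := by rwa [orient_rotate]
      -- Here `x` is between the chord and the chain. An end that is outside of the block is above
      -- the chord, and one that is not is trapped between the view through `l` and the last edge.
      have hp : 0 ≤ orient r l p := by
        rcases hdich p w.p_mem a b (by omega) (by omega) with h | h
        · have := hc.pos_of_ends (show a < b by omega) (by omega) (h a le_rfl (by omega)) (by
            have := h (b - 1) (by omega) (by omega)
            rwa [Nat.sub_add_cancel (by omega)] at this)
          rw [hil, hjr] at this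
          exact this.le
        · have h1 := hpred b (by omega) (by omega)
          have h2 := h (b - 1) (by omega) (by omega)
          rw [Nat.sub_add_cancel (by omega)] at h2
          have h3 := hc.triple (show a < b - 1 by omega) (show b - 1 < b by omega) (by omega)
          rw [hil] at h1 h2 h3
          rw [hjr] at h3
          exact chord_nonneg_left h1 h2 hchord w.left h3
      have hq : 0 ≤ orient r l q := by
        rcases hdich q w.q_mem a b (by omega) (by omega) with h | h
        · have := hc.pos_of_ends (show a < b by omega) (by omega) (h a le_rfl (by omega)) (by
            have := h (b - 1) (by omega) (by omega)
            rwa [Nat.sub_add_cancel (by omega)] at this)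
          rw [hil, hjr] at this
          exact this.le
        · have h1 := hxb a (by omega)
          have h2 := h a le_rfl (by omega)
          have h3 := hc.triple (show a < a + 1 by omega) (show a + 1 < b by omega) (by omega)
          rw [hjr] at h1 h2 h3
          rw [hil] at h3
          exact chord_nonneg_right h1 h2 hchord w.right h3
      constructor
      · by_contra hlp
        -- Up to a positive factor `l` is the combination of `x`, `q`, `p` with these nonnegative
        -- weights. The three points are weakly above the chord, and `x`, which has positive weight,
        -- strictly, but `l` is on the chord.
        have e : orient q p l * orient r l x + orient x l p * orient r l q +
            orient x q l * orient r l p = 0 := by simp only [orient]; ring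
        nlinarith [mul_pos (w.left_front hlp) hchord, mul_nonneg w.left hq,
          mul_nonneg w.left'.le hp]
      · by_contra hrq
        have e : orient q p r * orient r l x + orient x r p * orient r l q +
            orient x q r * orient r l p = 0 := by simp only [orient]; ring
        nlinarith [mul_pos (w.right_front hrq) hchord, mul_nonneg w.right'.le hq,
          mul_nonneg w.right hp]

end

end UniversalGuards

namespace UniversalGuards

noncomputable section

/-! ### Searching for a suitable part of a chain -/

lemma lin_neg (u z : Plane) : lin (-u) z = -lin u z := by
  simp only [lin, Prod.fst_neg, Prod.snd_neg]; ring

/-- The change from one edge of a chain to the next. -/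
lemma orient_next (u a b c w : Plane) :
    orient a b w * (lin u c - lin u b) - orient b c w * (lin u b - lin u a) =
      orient a b c * (lin u w - lin u b) := by
  simp only [orient, lin]; ring

/-- Test on the part of length `E` of a chain that starts at `st`: the point `w` is outside of its
first and its last edge, or of none of them and of the chord. -/
def Passes (c : ℕ → Plane) (st E : ℕ) (w : Plane) : Prop :=
  (0 < orient (c st) (c (st + 1)) w ∧ 0 < orient (c (st + E - 1)) (c (st + E)) w) ∨
    (¬ 0 < orient (c st) (c (st + 1)) w ∧ ¬ 0 < orient (c (st + E - 1)) (c (st + E)) w ∧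
      ¬ 0 < orient (c st) (c (st + E)) w)

/-- The point `w` sees the edge before the vertex `i`, but not the edge after it. -/
def Leaves (c : ℕ → Plane) (w : Plane) (i : ℕ) : Prop :=
  0 < orient (c (i - 1)) (c i) w ∧ orient (c i) (c (i + 1)) w ≤ 0

/-- The point `w` sees the edge after the vertex `i`, but not the edge before it. -/
def Enters (c : ℕ → Plane) (w : Plane) (i : ℕ) : Prop :=
  orient (c (i - 1)) (c i) w ≤ 0 ∧ 0 < orient (c i) (c (i + 1)) w

/-- On the line of constant `lin u` through `w` there are a point of `a b` weakly below and a point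
of `c d` weakly above `w`; the weights combine these two points in inverse proportion to their
distances from `w`. -/
lemma mem_convexHull_of_between {T : Finset Plane} {u a b c d w : Plane} (ha : a ∈ T) (hb : b ∈ T)
    (hc : c ∈ T) (hd : d ∈ T) (h1 : lin u a ≤ lin u w) (h2 : lin u w ≤ lin u b)
    (h3 : lin u c ≤ lin u w) (h4 : lin u w ≤ lin u d) (hab : lin u a < lin u b)
    (hcd : lin u c < lin u d) (h5 : 0 ≤ orient a b w) (h6 : orient c d w ≤ 0)
    (h7 : 0 < orient a b w ∨ orient c d w < 0) :
    w ∈ convexHull ℝ (T : Set Plane) := by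
  set H1 := orient a b w with hH1
  set H2 := -orient c d w with hH2
  have H2nn : 0 ≤ H2 := by rw [hH2]; linarith
  set D := (lin u b - lin u a) * H2 + (lin u d - lin u c) * H1 with hD
  have hDpos : 0 < D := by
    have a1 := mul_nonneg (sub_nonneg.2 hab.le) H2nn
    have a2 := mul_nonneg (sub_nonneg.2 hcd.le) h5
    rcases h7 with h | h
    · have := mul_pos (sub_pos.2 hcd) h
      linarith
    · have := mul_pos (sub_pos.2 hab) (show 0 < H2 by rw [hH2]; linarith)
      linarith
  set α := H2 * (lin u b - lin u w) / D with hα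
  set β := H2 * (lin u w - lin u a) / D with hβ
  set γ := H1 * (lin u d - lin u w) / D with hγ
  set δ := H1 * (lin u w - lin u c) / D with hδ
  have α0 : 0 ≤ α := div_nonneg (mul_nonneg H2nn (by linarith)) hDpos.le
  have β0 : 0 ≤ β := div_nonneg (mul_nonneg H2nn (by linarith)) hDpos.le
  have γ0 : 0 ≤ γ := div_nonneg (mul_nonneg h5 (by linarith)) hDpos.le
  have δ0 : 0 ≤ δ := div_nonneg (mul_nonneg h5 (by linarith)) hDpos.le
  have hsum : α + β + γ + δ = 1 := by
    rw [hα, hβ, hγ, hδ, ← add_div, ← add_div, ← add_div, div_eq_one_iff_eq hDpos.ne', hD]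
    ring
  have hw : w = α • a + β • b + γ • c + δ • d := by
    have e1 : D * w.1 = H2 * (lin u b - lin u w) * a.1 + H2 * (lin u w - lin u a) * b.1 +
        H1 * (lin u d - lin u w) * c.1 + H1 * (lin u w - lin u c) * d.1 := by
      simp only [hD, hH1, hH2, orient, lin]; ring
    have e2 : D * w.2 = H2 * (lin u b - lin u w) * a.2 + H2 * (lin u w - lin u a) * b.2 +
        H1 * (lin u d - lin u w) * c.2 + H1 * (lin u w - lin u c) * d.2 := by
      simp only [hD, hH1, hH2, orient, lin]; ring
    have hD' := hDpos.ne'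
    apply Prod.ext
    · simp only [Prod.fst_add, Prod.smul_fst, smul_eq_mul, hα, hβ, hγ, hδ]
      rw [eq_comm, ← mul_right_inj' hD', e1]
      field_simp
    · simp only [Prod.snd_add, Prod.smul_snd, smul_eq_mul, hα, hβ, hγ, hδ]
      rw [eq_comm, ← mul_right_inj' hD', e2]
      field_simp
  rw [hw]
  have hsub := subset_convexHull ℝ (T : Set Plane)
  have := (convex_convexHull ℝ (T : Set Plane)).sum_mem (t := Finset.univ) (w := ![α, β, γ, δ])
    (z := ![a, b, c, d]) (by intro i _; fin_cases i <;> simpa)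
    (by simpa [Fin.sum_univ_four] using hsum)
    (by intro i _; fin_cases i <;> simp <;> apply hsub <;> assumption)
  simpa [Fin.sum_univ_four] using this

namespace IsChain

variable {u : Plane} {T : Finset Plane} {N : ℕ} {c : ℕ → Plane}

/-- To the left of a vertex of a right-turning chain the line of the next edge is weakly above that
of the previous one, so a point below one edge line stays below the later ones. `nonpos_of_right` is
the mirror image. -/
lemma nonpos_of_left (h : IsChain u T N c) {i j : ℕ} (hij : i ≤ j) (hj : j < N) {w : Plane}
    (hw : lin u w ≤ lin u (c (i + 1))) (hi : orient (c i) (c (i + 1)) w ≤ 0) :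
    orient (c j) (c (j + 1)) w ≤ 0 := by
  induction j, hij using Nat.le_induction with
  | base => exact hi
  | succ k hk ih =>
    have ih := ih (by omega)
    have h1 := h.lt k (by omega)
    have h2 := h.lt (k + 1) (by omega)
    have h3 := h.below k (by omega) _ (h.mem (k + 2) (by omega))
    have h4 : lin u w ≤ lin u (c (k + 1)) := by
      rcases hk.lt_or_eq with h' | h'
      · exact hw.trans (h.lin_lt (by omega) (by omega)).le
      · rwa [← h']
    have h5 := orient_next u (c k) (c (k + 1)) (c (k + 2)) w
    by_contra hc
    push Not at hc
    nlinarith [mul_pos hc (sub_pos.2 h1), mul_nonneg (neg_nonneg.2 ih) (sub_nonneg.2 h2.le),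
      mul_nonneg (neg_nonneg.2 h3) (sub_nonneg.2 h4)]

lemma nonpos_of_right (h : IsChain u T N c) {i j : ℕ} (hij : i ≤ j) (hj : j < N) {w : Plane}
    (hw : lin u (c j) ≤ lin u w) (hi : orient (c j) (c (j + 1)) w ≤ 0) :
    orient (c i) (c (i + 1)) w ≤ 0 := by
  induction hij using Nat.decreasingInduction with
  | self => exact hi
  | of_succ k hk ih =>
    have h1 := h.lt k (by omega)
    have h2 := h.lt (k + 1) (by omega)
    have h3 := h.below k (by omega) _ (h.mem (k + 2) (by omega))
    have h4 : lin u (c (k + 1)) ≤ lin u w := by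
      rcases (show k + 1 ≤ j from hk).lt_or_eq with h' | h'
      · exact (h.lin_lt h' (by omega)).le.trans hw
      · rwa [h']
    have h5 := orient_next u (c k) (c (k + 1)) (c (k + 2)) w
    by_contra hc
    push Not at hc
    nlinarith [mul_pos hc (sub_pos.2 h2), mul_nonneg (neg_nonneg.2 ih) (sub_nonneg.2 h1.le),
      mul_nonneg (neg_nonneg.2 h3) (sub_nonneg.2 h4)]

/-- A point that passes the test sees all edges of the part or none of them. -/
lemma all_or_none_of_passes (h : IsChain u T N c) {st E : ℕ} (hE : 0 < E) (hN : st + E ≤ N)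
    {w : Plane} (hw : Passes c st E w) :
    (∀ i, st ≤ i → i < st + E → 0 < orient (c i) (c (i + 1)) w) ∨
      ∀ i, st ≤ i → i < st + E → orient (c i) (c (i + 1)) w ≤ 0 := by
  have hlast : st + E - 1 + 1 = st + E := by omega
  rcases hw with ⟨h0, h1⟩ | ⟨h0, h1, h2⟩
  · left
    intro i hi hi'
    by_contra hc
    push Not at hc
    rcases le_total (lin u w) (lin u (c (i + 1))) with hl | hl
    · have := h.nonpos_of_left (show i ≤ st + E - 1 by omega) (by omega) hl hc
      rw [hlast] at this
      linarith
    · have := h.nonpos_of_right hi (by omega) ((h.lt i (by omega)).le.trans hl) hc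
      linarith
  · right
    push Not at h0 h1 h2
    intro i hi hi'
    by_contra hc
    push Not at hc
    rcases le_total (lin u w) (lin u (c st)) with hl | hl
    · have := h.nonpos_of_left hi (by omega) (hl.trans (h.lt st (by omega)).le) h0
      linarith
    rcases le_total (lin u (c (st + E))) (lin u w) with hl' | hl'
    · have := h.nonpos_of_right (show i ≤ st + E - 1 by omega) (by omega)
        ((h.lin_lt (show st + E - 1 < st + E by omega) hN).le.trans hl') (by rwa [hlast])
      linarith
    · have e : orient (c i) (c (i + 1)) w * (lin u (c (st + E)) - lin u (c st)) =
          orient (c i) (c (i + 1)) (c st) * (lin u (c (st + E)) - lin u w) +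
          orient (c i) (c (i + 1)) (c (st + E)) * (lin u w - lin u (c st)) +
          orient (c st) (c (st + E)) w * (lin u (c (i + 1)) - lin u (c i)) := by
        simp only [orient, lin]; ring
      have a1 := h.below i (by omega) _ (h.mem st (by omega))
      have a2 := h.below i (by omega) _ (h.mem (st + E) (by omega))
      have a3 := h.lin_lt (show st < st + E by omega) hN
      have a4 := h.lt i (by omega)
      nlinarith [mul_pos hc (sub_pos.2 a3), mul_nonneg (neg_nonneg.2 a1) (sub_nonneg.2 hl'),
        mul_nonneg (neg_nonneg.2 a2) (sub_nonneg.2 hl),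
        mul_nonneg (neg_nonneg.2 h2) (sub_nonneg.2 a4.le)]

lemma exists_leaves {w : Plane} {a b : ℕ} (hab : a ≤ b)
    (h1 : 0 < orient (c a) (c (a + 1)) w) (h2 : orient (c b) (c (b + 1)) w ≤ 0) :
    ∃ i, a < i ∧ i ≤ b ∧ Leaves c w i := by
  induction b, hab using Nat.le_induction with
  | base => linarith
  | succ k hk ih =>
    by_cases h : orient (c k) (c (k + 1)) w ≤ 0
    · obtain ⟨i, h3, h4, h5⟩ := ih h
      exact ⟨i, h3, by omega, h5⟩
    · exact ⟨k + 1, by omega, le_rfl, by simpa using h, h2⟩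

lemma exists_enters {w : Plane} {a b : ℕ} (hab : a ≤ b)
    (h1 : orient (c a) (c (a + 1)) w ≤ 0) (h2 : 0 < orient (c b) (c (b + 1)) w) :
    ∃ i, a < i ∧ i ≤ b ∧ Enters c w i := by
  induction b, hab using Nat.le_induction with
  | base => linarith
  | succ k hk ih =>
    by_cases h : 0 < orient (c k) (c (k + 1)) w
    · obtain ⟨i, h3, h4, h5⟩ := ih h
      exact ⟨i, h3, by omega, h5⟩
    · exact ⟨k + 1, by omega, le_rfl, by simpa using h, h2⟩

/-- A point outside the convex hull that fails the test has a tangent inside of the part. -/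
lemma leaves_or_enters (h : IsChain u T N c) {st E : ℕ} (hE : 0 < E) (hN : st + E ≤ N)
    {w : Plane} (hT : w ∉ convexHull ℝ (T : Set Plane)) (hw : ¬ Passes c st E w) :
    (∃ i, st < i ∧ i < st + E ∧ Leaves c w i) ∨ ∃ i, st < i ∧ i < st + E ∧ Enters c w i := by
  have hlast : st + E - 1 + 1 = st + E := by omega
  by_cases h0 : 0 < orient (c st) (c (st + 1)) w
  · by_cases h1 : 0 < orient (c (st + E - 1)) (c (st + E)) w
    · exact absurd (Or.inl ⟨h0, h1⟩) hw
    · obtain ⟨i, h2, h3, h4⟩ := exists_leaves (c := c) (w := w) (show st ≤ st + E - 1 by omega) h0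
        (by rw [hlast]; exact not_lt.1 h1)
      exact Or.inl ⟨i, h2, by omega, h4⟩
  · by_cases h1 : 0 < orient (c (st + E - 1)) (c (st + E)) w
    · obtain ⟨i, h2, h3, h4⟩ := exists_enters (c := c) (w := w) (show st ≤ st + E - 1 by omega)
        (not_lt.1 h0) (by rwa [hlast])
      exact Or.inr ⟨i, h2, by omega, h4⟩
    · have h2 : 0 < orient (c st) (c (st + E)) w := by
        by_contra hc
        exact hw (Or.inr ⟨h0, h1, hc⟩)
      push Not at h0 h1
      by_cases hex : ∃ i, st ≤ i ∧ i < st + E ∧ 0 < orient (c i) (c (i + 1)) w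
      · obtain ⟨i, i1, i2, i3⟩ := hex
        obtain ⟨j, h3, h4, h5⟩ := exists_leaves (c := c) (w := w)
          (show i ≤ st + E - 1 by omega) i3 (by rwa [hlast])
        exact Or.inl ⟨j, by omega, by omega, h5⟩
      -- The point is above the chord but outside of no edge, so it would lie between the chord and
      -- the chain, inside the hull.
      · exfalso
        push Not at hex
        apply hT
        have hch := h.lin_lt (show st < st + E by omega) hN
        have hl : lin u (c st) < lin u w := by
          by_contra hcon
          push Not at hcon
          have a1 := h.below st (by omega) _ (h.mem (st + E) hN)
          have a2 := lin_mul_orient_start u (c st) (c (st + 1)) (c (st + E)) w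
          have a3 := h.lt st (by omega)
          nlinarith [mul_pos (sub_pos.2 a3) h2, mul_nonneg (sub_nonneg.2 hch.le) (neg_nonneg.2 h0),
            mul_nonneg (sub_nonneg.2 hcon) (neg_nonneg.2 a1)]
        have hl' : lin u w < lin u (c (st + E)) := by
          by_contra hcon
          push Not at hcon
          have a1 := h.below_pred (show 0 < st + E by omega) hN (h.mem st (by omega))
          have a2 := lin_mul_orient_end u (c (st + E)) (c (st + E - 1)) (c st) w
          have a3 := h.lin_lt (show st + E - 1 < st + E by omega) hN
          nlinarith [mul_pos (sub_pos.2 a3) h2, mul_nonneg (sub_nonneg.2 hch.le) (neg_nonneg.2 h1),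
            mul_nonneg (sub_nonneg.2 hcon) (neg_nonneg.2 a1)]
        -- The induction locates the edge of the chain whose range of abscissas contains `w`.
        have key : ∀ k, k ≤ E → lin u w ≤ lin u (c (st + k)) →
            w ∈ convexHull ℝ (T : Set Plane) := by
          intro k
          induction k with
          | zero => intro _ hk; rw [add_zero] at hk; linarith
          | succ k ih =>
            intro hk hwk
            by_cases hlow : lin u w ≤ lin u (c (st + k))
            · exact ih (by omega) hlow
            · push Not at hlow
              exact mem_convexHull_of_between (u := u) (h.mem st (by omega))
                (h.mem (st + E) hN) (h.mem (st + k) (by omega)) (h.mem (st + k + 1) (by omega))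
                hl.le hl'.le hlow.le hwk hch (h.lt _ (by omega)) h2.le
                (hex (st + k) (by omega) (by omega)) (Or.inl h2)
        exact key E le_rfl hl'.le

/-- From `c i` on to the right the previous edge line is weakly above the next one, so a point above
the former would be above the latter as well. -/
lemma lin_lt_of_leaves (h : IsChain u T N c) {w : Plane} {i : ℕ} (h0 : 0 < i) (hi : i < N)
    (hw : Leaves c w i) : lin u w < lin u (c i) := by
  have h1 := h.lin_lt (show i - 1 < i by omega) hi.le
  have h2 := h.lt i hi
  have h3 := h.below_pred h0 hi.le (h.mem (i + 1) hi)
  have h4 := orient_next u (c (i - 1)) (c i) (c (i + 1)) w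
  by_contra hc
  push Not at hc
  nlinarith [mul_pos hw.1 (sub_pos.2 h2), mul_nonneg (neg_nonneg.2 hw.2) (sub_nonneg.2 h1.le),
    mul_nonneg (neg_nonneg.2 h3) (sub_nonneg.2 hc)]

lemma lin_lt_of_enters (h : IsChain u T N c) {w : Plane} {i : ℕ} (h0 : 0 < i) (hi : i < N)
    (hw : Enters c w i) : lin u (c i) < lin u w := by
  have h1 := h.lin_lt (show i - 1 < i by omega) hi.le
  have h2 := h.lt i hi
  have h3 := h.below_pred h0 hi.le (h.mem (i + 1) hi)
  have h4 := orient_next u (c (i - 1)) (c i) (c (i + 1)) w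
  by_contra hc
  push Not at hc
  nlinarith [mul_pos hw.2 (sub_pos.2 h1), mul_nonneg (neg_nonneg.2 hw.1) (sub_nonneg.2 h2.le),
    mul_nonneg (neg_nonneg.2 h3) (sub_nonneg.2 hc)]

/-- After the point has left the chain at `c i`, which is to its right, it remains below all later
edges. -/
lemma leaves_unique (h : IsChain u T N c) {w : Plane} {i j : ℕ} (hi0 : 0 < i) (hi : i < N)
    (hj0 : 0 < j) (hj : j < N) (hwi : Leaves c w i) (hwj : Leaves c w j) : i = j := by
  wlog hij : i < j generalizing i j
  · rcases (not_lt.1 hij).lt_or_eq with h' | h'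
    · exact (this hj0 hj hi0 hi hwj hwi h').symm
    · exact h'.symm
  exfalso
  have h1 := h.lin_lt_of_leaves hi0 hi hwi
  have h2 := h.nonpos_of_left (show i ≤ j - 1 by omega) (by omega)
    (h1.le.trans (h.lt i hi).le) hwi.2
  rw [Nat.sub_add_cancel hj0] at h2
  exact absurd hwj.1 (not_lt.2 h2)

lemma enters_unique (h : IsChain u T N c) {w : Plane} {i j : ℕ} (hi0 : 0 < i) (hi : i < N)
    (hj0 : 0 < j) (hj : j < N) (hwi : Enters c w i) (hwj : Enters c w j) : i = j := by
  wlog hij : i < j generalizing i j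
  · rcases (not_lt.1 hij).lt_or_eq with h' | h'
    · exact (this hj0 hj hi0 hi hwj hwi h').symm
    · exact h'.symm
  exfalso
  have h1 := h.lin_lt_of_enters hj0 hj hwj
  have h2 := h.nonpos_of_right (show i ≤ j - 1 by omega) (by omega)
    ((h.lin_lt (show j - 1 < j by omega) hj.le).le.trans h1.le)
    (by rw [Nat.sub_add_cancel hj0]; exact hwj.1)
  exact absurd hwi.2 (not_lt.2 h2)

/-- The line from `w` to `c i` supports `T`: to the right of `c i` by comparison with the next edge,
to the left with the previous one. So `Leaves` and `Enters` are the two kinds of tangents from `w`,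
with `T` on the right and on the left. -/
lemma side_of_leaves (h : IsChain u T N c) {w : Plane} {i : ℕ} (h0 : 0 < i) (hi : i < N)
    (hw : Leaves c w i) {s : Plane} (hs : s ∈ T) : orient w (c i) s ≤ 0 := by
  have hl := h.lin_lt_of_leaves h0 hi hw
  by_contra hc
  push Not at hc
  rcases le_total (lin u (c i)) (lin u s) with h' | h'
  · have h1 := h.below i hi s hs
    have h2 := h.lt i hi
    have h3 := lin_mul_orient_end u (c i) (c (i + 1)) w s
    rw [orient_swap (c i) (c (i + 1)) s, orient_swap (c i) (c (i + 1)) w] at h3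
    nlinarith [mul_pos (sub_pos.2 h2) hc, mul_nonneg (sub_nonneg.2 hl.le) (neg_nonneg.2 h1),
      mul_nonneg (sub_nonneg.2 h') (neg_nonneg.2 hw.2)]
  · have h1 := h.below_pred h0 hi.le hs
    have h2 := h.lin_lt (show i - 1 < i by omega) hi.le
    have h3 := lin_mul_orient_end u (c i) (c (i - 1)) w s
    nlinarith [mul_pos (sub_pos.2 h2) hc, mul_nonneg (sub_nonneg.2 hl.le) (neg_nonneg.2 h1),
      mul_nonneg (sub_nonneg.2 h') hw.1.le]

lemma side_of_enters (h : IsChain u T N c) {w : Plane} {i : ℕ} (h0 : 0 < i) (hi : i < N)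
    (hw : Enters c w i) {s : Plane} (hs : s ∈ T) : 0 ≤ orient w (c i) s := by
  have hl := h.lin_lt_of_enters h0 hi hw
  by_contra hc
  push Not at hc
  rcases le_total (lin u (c i)) (lin u s) with h' | h'
  · have h1 := h.below i hi s hs
    have h2 := h.lt i hi
    have h3 := lin_mul_orient_end u (c i) (c (i + 1)) w s
    rw [orient_swap (c i) (c (i + 1)) s, orient_swap (c i) (c (i + 1)) w] at h3
    nlinarith [mul_pos (sub_pos.2 h2) (neg_pos.2 hc),
      mul_nonneg (sub_nonneg.2 hl.le) (neg_nonneg.2 h1),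
      mul_nonneg (sub_nonneg.2 h') hw.2.le]
  · have h1 := h.below_pred h0 hi.le hs
    have h2 := h.lin_lt (show i - 1 < i by omega) hi.le
    have h3 := lin_mul_orient_end u (c i) (c (i - 1)) w s
    nlinarith [mul_pos (sub_pos.2 h2) (neg_pos.2 hc),
      mul_nonneg (sub_nonneg.2 hl.le) (neg_nonneg.2 h1),
      mul_nonneg (sub_nonneg.2 h') (neg_nonneg.2 hw.1)]

variable {M : ℕ} {d : ℕ → Plane}

lemma mem_hull_of_tangents (hc : IsChain u T N c) (hd : IsChain (-u) T M d) {w : Plane} {i j : ℕ}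
    (hi : i ≤ N) (hj : j ≤ M) (h0 : orient w (c i) (d j) = 0)
    (h1 : (lin u w < lin u (c i) ∧ lin (-u) w < lin (-u) (d j)) ∨
      (lin u (c i) < lin u w ∧ lin (-u) (d j) < lin (-u) w)) :
    w ∈ convexHull ℝ (T : Set Plane) := by
  have hci := hc.mem i hi
  have hdj := hd.mem j hj
  rw [lin_neg, lin_neg] at h1
  have hseg : w ∈ segment ℝ (d j) (c i) := by
    have hne : d j ≠ c i := by
      intro he
      rw [he] at h1
      rcases h1 with h | h <;> linarith
    have e : orient (d j) (c i) w = 0 := by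
      rw [orient_swap, ← h0, ← orient_rotate w]
      simp only [orient] at h0 ⊢
      linarith
    obtain ⟨t, ht⟩ := exists_line_param hne e
    have hlin : lin u w = lin u (d j) + t * (lin u (c i) - lin u (d j)) := by
      rw [ht]
      simp only [lin, Prod.fst_add, Prod.snd_add, Prod.smul_fst, Prod.smul_snd, Prod.fst_sub,
        Prod.snd_sub, smul_eq_mul]
      ring
    rw [ht]
    apply line_param_mem_segment
    · by_contra hcon
      push Not at hcon
      rcases h1 with h | h <;> nlinarith
    · by_contra hcon
      push Not at hcon
      rcases h1 with h | h <;> nlinarith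
  exact (convex_convexHull ℝ _).segment_subset (subset_convexHull ℝ _ hdj)
    (subset_convexHull ℝ _ hci) hseg

/-- Two tangents with `T` on the same side make `w` and both contact points collinear. As the chains
run in opposite directions, `w` would lie between the contact points and hence in the hull. -/
lemma not_leaves_both (hc : IsChain u T N c) (hd : IsChain (-u) T M d) {w : Plane}
    (hT : w ∉ convexHull ℝ (T : Set Plane)) {i j : ℕ} (hi0 : 0 < i) (hi : i < N)
    (hj0 : 0 < j) (hj : j < M) (hwi : Leaves c w i) (hwj : Leaves d w j) : False := by
  have h1 := hc.side_of_leaves hi0 hi hwi (hd.mem j hj.le)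
  have h2 := hd.side_of_leaves hj0 hj hwj (hc.mem i hi.le)
  rw [orient_swap'] at h2
  exact hT (hc.mem_hull_of_tangents hd hi.le hj.le (by linarith)
    (Or.inl ⟨hc.lin_lt_of_leaves hi0 hi hwi, hd.lin_lt_of_leaves hj0 hj hwj⟩))

lemma not_enters_both (hc : IsChain u T N c) (hd : IsChain (-u) T M d) {w : Plane}
    (hT : w ∉ convexHull ℝ (T : Set Plane)) {i j : ℕ} (hi0 : 0 < i) (hi : i < N)
    (hj0 : 0 < j) (hj : j < M) (hwi : Enters c w i) (hwj : Enters d w j) : False := by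
  have h1 := hc.side_of_enters hi0 hi hwi (hd.mem j hj.le)
  have h2 := hd.side_of_enters hj0 hj hwj (hc.mem i hi.le)
  rw [orient_swap'] at h2
  exact hT (hc.mem_hull_of_tangents hd hi.le hj.le (by linarith)
    (Or.inr ⟨hc.lin_lt_of_enters hi0 hi hwi, hd.lin_lt_of_enters hj0 hj hwj⟩))

/-- Each outer point has only two tangents, so the number of parts of length `E` which are not
passed by all outer points is at most twice the number of these points. -/
theorem blocks_le (hc : IsChain u T N c) (hd : IsChain (-u) T M d) {W : Finset Plane}
    (hW : ∀ w ∈ W, w ∉ convexHull ℝ (T : Set Plane)) {E : ℕ} (hE : 0 < E)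
    (h1 : ∀ b, b * E + E ≤ N → ∃ w ∈ W, ¬ Passes c (b * E) E w)
    (h2 : ∀ b, b * E + E ≤ M → ∃ w ∈ W, ¬ Passes d (b * E) E w) :
    N / E + M / E ≤ 2 * W.card := by
  classical
  -- Every spoiled block is charged to an outer point and a kind of tangent, `true` standing for
  -- `Leaves`.
  have sel : ∀ {v : Plane} {L : ℕ} {e : ℕ → Plane}, IsChain v T L e →
      (∀ b, b * E + E ≤ L → ∃ w ∈ W, ¬ Passes e (b * E) E w) →
      ∃ f : ℕ → Plane × Bool, ∀ b < L / E, (f b).1 ∈ W ∧ ∃ i, b * E < i ∧ i < b * E + E ∧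
        b * E + E ≤ L ∧ ((f b).2 = true → Leaves e (f b).1 i) ∧
        ((f b).2 = false → Enters e (f b).1 i) := by
    intro v L e he hb
    have : ∀ b, ∃ x : Plane × Bool, b < L / E → x.1 ∈ W ∧ ∃ i, b * E < i ∧ i < b * E + E ∧
        b * E + E ≤ L ∧ (x.2 = true → Leaves e x.1 i) ∧ (x.2 = false → Enters e x.1 i) := by
      intro b
      by_cases hbL : b < L / E
      · have hle : b * E + E ≤ L := by
          have := (Nat.le_div_iff_mul_le hE).1 (Nat.succ_le_of_lt hbL)
          rwa [Nat.succ_mul] at this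
        obtain ⟨w, hw, hp⟩ := hb b hle
        rcases he.leaves_or_enters hE hle (hW w hw) hp with ⟨i, i1, i2, i3⟩ | ⟨i, i1, i2, i3⟩
        · exact ⟨(w, true), fun _ => ⟨hw, i, i1, i2, hle, fun _ => i3, by simp⟩⟩
        · exact ⟨(w, false), fun _ => ⟨hw, i, i1, i2, hle, by simp, fun _ => i3⟩⟩
      · exact ⟨default, fun h => absurd h hbL⟩
    choose f hf using this
    exact ⟨f, hf⟩
  obtain ⟨f, hf⟩ := sel hc h1
  obtain ⟨g, hg⟩ := sel hd h2
  -- The charge is injective: each kind of tangent has only one contact vertex on the chain, and a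
  -- vertex is strictly inside at most one block.
  have same : ∀ {v : Plane} {L : ℕ} {e : ℕ → Plane}, IsChain v T L e → ∀ {f : ℕ → Plane × Bool},
      (∀ b < L / E, (f b).1 ∈ W ∧ ∃ i, b * E < i ∧ i < b * E + E ∧
        b * E + E ≤ L ∧ ((f b).2 = true → Leaves e (f b).1 i) ∧
        ((f b).2 = false → Enters e (f b).1 i)) →
      ∀ a < L / E, ∀ b < L / E, f a = f b → a = b := by
    intro v L e he f hf a ha b hb hab
    obtain ⟨-, i, i1, i2, i3, i4, i5⟩ := hf a ha
    obtain ⟨-, j, j1, j2, j3, j4, j5⟩ := hf b hb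
    have hij : i = j := by
      cases hx : (f a).2 with
      | true =>
        exact he.leaves_unique (by omega) (by omega) (by omega) (by omega) (i4 hx)
          (hab ▸ j4 (hab ▸ hx))
      | false =>
        exact he.enters_unique (by omega) (by omega) (by omega) (by omega) (i5 hx)
          (hab ▸ j5 (hab ▸ hx))
    subst hij
    rcases lt_trichotomy a b with h | h | h
    · have : (a + 1) * E ≤ b * E := Nat.mul_le_mul_right _ h
      rw [Nat.succ_mul] at this
      omega
    · exact h
    · have : (b + 1) * E ≤ a * E := Nat.mul_le_mul_right _ h
      rw [Nat.succ_mul] at this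
      omega
  have hdis : ∀ a < N / E, ∀ b < M / E, f a ≠ g b := by
    intro a ha b hb hab
    obtain ⟨hw, i, i1, i2, i3, i4, i5⟩ := hf a ha
    obtain ⟨-, j, j1, j2, j3, j4, j5⟩ := hg b hb
    cases hx : (f a).2 with
    | true =>
      exact hc.not_leaves_both hd (hW _ hw) (by omega) (by omega) (by omega) (by omega) (i4 hx)
        (hab ▸ j4 (hab ▸ hx))
    | false =>
      exact hc.not_enters_both hd (hW _ hw) (by omega) (by omega) (by omega) (by omega) (i5 hx)
        (hab ▸ j5 (hab ▸ hx))
  have c1 : ((Finset.range (N / E)).image f).card = N / E := by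
    rw [Finset.card_image_of_injOn, Finset.card_range]
    intro a ha b hb hab
    exact same hc hf a (Finset.mem_range.1 ha) b (Finset.mem_range.1 hb) hab
  have c2 : ((Finset.range (M / E)).image g).card = M / E := by
    rw [Finset.card_image_of_injOn, Finset.card_range]
    intro a ha b hb hab
    exact same hd hg a (Finset.mem_range.1 ha) b (Finset.mem_range.1 hb) hab
  have hdisj : Disjoint ((Finset.range (N / E)).image f) ((Finset.range (M / E)).image g) := by
    rw [Finset.disjoint_left]
    intro x hx hx'
    obtain ⟨a, ha, rfl⟩ := Finset.mem_image.1 hx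
    obtain ⟨b, hb, he⟩ := Finset.mem_image.1 hx'
    exact hdis a (Finset.mem_range.1 ha) b (Finset.mem_range.1 hb) he.symm
  have hsub : (Finset.range (N / E)).image f ∪ (Finset.range (M / E)).image g ⊆
      W ×ˢ (Finset.univ : Finset Bool) := by
    intro x hx
    rw [Finset.mem_product]
    refine ⟨?_, Finset.mem_univ _⟩
    rcases Finset.mem_union.1 hx with hx | hx
    · obtain ⟨a, ha, rfl⟩ := Finset.mem_image.1 hx
      exact (hf a (Finset.mem_range.1 ha)).1
    · obtain ⟨a, ha, rfl⟩ := Finset.mem_image.1 hx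
      exact (hg a (Finset.mem_range.1 ha)).1
  have := Finset.card_le_card hsub
  rw [Finset.card_union_of_disjoint hdisj, c1, c2, Finset.card_product, Finset.card_univ,
    Fintype.card_bool] at this
  omega

end IsChain

end

end UniversalGuards

namespace UniversalGuards

noncomputable section

open Filter Topology

/-! ### The scan for the convex chain of a sorted sequence -/

/-- Invariant of the scan of a sequence `Q` of `m` points, which is increasing in direction `u`:
`i` points have been read, and the stack `c` has length `len`. -/
structure ScanInv (u : Plane) (Q : ℕ → Plane) (m i len : ℕ) (c : ℕ → Plane) : Prop where
  i_le : i ≤ m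
  pos : 0 < i → 0 < len
  len_le : len ≤ i
  mem : ∀ j < len, ∃ k < i, c j = Q k
  lt : ∀ j, j + 1 < len → lin u (c j) < lin u (c (j + 1))
  below : ∀ j, j + 1 < len → ∀ k < i, orient (c j) (c (j + 1)) (Q k) ≤ 0
  first : 0 < len → c 0 = Q 0
  hidden : i < m → ∀ k < i, lin u (c (len - 1)) < lin u (Q k) →
    0 ≤ orient (c (len - 1)) (Q k) (Q i)
  popped : ∀ k < i, (∃ j < len, c j = Q k) ∨
    ∃ a b, a < k ∧ k < b ∧ b < m ∧ 0 < orient (Q a) (Q k) (Q b)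
  last : i = m → c (len - 1) = Q (m - 1)

namespace ScanInv

variable {u : Plane} {Q : ℕ → Plane} {m i len : ℕ} {c : ℕ → Plane}

lemma init (hm : 0 < m) : ScanInv u Q m 0 0 c where
  i_le := by omega
  pos := by omega
  len_le := le_rfl
  mem := by omega
  lt := by omega
  below := by omega
  first := by omega
  hidden := by omega
  popped := by omega
  last := by omega

open scoped Classical in
lemma isChain (h : ScanInv u Q m i len c) (hi : 0 < i) :
    IsChain u ((Finset.range i).image Q) (len - 1) c where
  mem j hj := by
    obtain ⟨k, hk, he⟩ := h.mem j (by have := h.pos hi; omega)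
    exact Finset.mem_image.2 ⟨k, Finset.mem_range.2 hk, he.symm⟩
  lt j hj := h.lt j (by omega)
  below j hj s hs := by
    obtain ⟨k, hk, rfl⟩ := Finset.mem_image.1 hs
    exact h.below j (by omega) k (Finset.mem_range.1 hk)

/-- For the new edge, read points to the right of the old top are covered by the invariant `hidden`,
and those to its left by the failed test for a left turn. For the older edges, the new point is
below the last one by the same test, hence below all by `nonpos_of_right`. -/
lemma push (h : ScanInv u Q m i len c)
    (hQ : ∀ a b, a < b → b < m → lin u (Q a) < lin u (Q b)) (him : i < m)
    (htest : 2 ≤ len → orient (c (len - 2)) (c (len - 1)) (Q i) ≤ 0) {c' : ℕ → Plane}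
    (hc' : ∀ j < len, c' j = c j) (hc'' : c' len = Q i) : ScanInv u Q m (i + 1) (len + 1) c' := by
  classical
  have hlt : ∀ j < len, lin u (c j) < lin u (Q i) := by
    intro j hj
    obtain ⟨k, hk, he⟩ := h.mem j hj
    rw [he]
    exact hQ k i hk him
  constructor
  · exact him
  · omega
  · have := h.len_le; omega
  · intro j hj
    rcases (Nat.lt_succ_iff.1 hj).lt_or_eq with h' | rfl
    · obtain ⟨k, hk, he⟩ := h.mem j h'
      exact ⟨k, by omega, by rw [hc' j h', he]⟩
    · exact ⟨i, by omega, hc''⟩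
  · intro j hj
    rcases (show j + 1 ≤ len by omega).lt_or_eq with h' | h'
    · rw [hc' _ h', hc' j (by omega)]
      exact h.lt j h'
    · rw [h', hc'', hc' j (by omega)]
      exact hlt j (by omega)
  · intro j hj k hk
    rcases (show j + 1 ≤ len by omega).lt_or_eq with h' | h'
    · rw [hc' _ h', hc' j (by omega)]
      rcases (Nat.lt_succ_iff.1 hk).lt_or_eq with hk | rfl
      · exact h.below j h' k hk
      · have hi : 0 < k := by have := h.len_le; omega
        have t := htest (by omega)
        have e : len - 2 + 1 = len - 1 := by omega
        exact (h.isChain hi).nonpos_of_right (show j ≤ len - 2 by omega) (by omega)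
          (hlt _ (by omega)).le (by rwa [e])
    · rw [h', hc'', hc' j (by omega)]
      rcases (Nat.lt_succ_iff.1 hk).lt_or_eq with hk | rfl
      · have ej : j = len - 1 := by omega
        rcases lt_or_ge (lin u (c j)) (lin u (Q k)) with hl | hl
        · have := h.hidden him k hk (by rwa [← ej])
          rw [orient_swap', ej]
          linarith
        · by_cases h1 : len = 1
          · have e0 : j = 0 := by omega
            have hf := h.first (by omega)
            rw [e0, hf] at hl ⊢
            have hk0 : k = 0 := by
              by_contra hne
              have := hQ 0 k (by omega) (by omega)
              linarith
            rw [hk0, orient_self_mid]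
          · have t := htest (by omega)
            have b1 := h.below (len - 2) (by omega) k hk
            have e : len - 2 + 1 = len - 1 := by omega
            rw [e] at b1
            have b2 := h.lt (len - 2) (by omega)
            rw [e] at b2
            rw [← ej] at t b1 b2
            have b3 := hlt j (by omega)
            have b4 := orient_next u (c (len - 2)) (c j) (Q i) (Q k)
            by_contra hcon
            push Not at hcon
            nlinarith [mul_pos hcon (sub_pos.2 b2),
              mul_nonneg (neg_nonneg.2 b1) (sub_nonneg.2 b3.le),
              mul_nonneg (neg_nonneg.2 t) (sub_nonneg.2 hl)]
      · rw [orient_self_right]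
  · intro _
    by_cases h0 : len = 0
    · have := h.pos
      have hi0 : i = 0 := by omega
      rw [h0] at hc''
      rw [hc'', hi0]
    · rw [hc' 0 (by omega)]
      exact h.first (by omega)
  · intro him' k hk hl
    rw [Nat.add_sub_cancel, hc''] at hl
    exfalso
    rcases (Nat.lt_succ_iff.1 hk).lt_or_eq with h' | rfl
    · exact absurd (hQ k i h' him) (not_lt.2 hl.le)
    · exact lt_irrefl _ hl
  · intro k hk
    rcases (Nat.lt_succ_iff.1 hk).lt_or_eq with h' | rfl
    · rcases h.popped k h' with ⟨j, hj, he⟩ | h2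
      · exact Or.inl ⟨j, by omega, by rw [hc' j hj, he]⟩
      · exact Or.inr h2
    · exact Or.inl ⟨len, by omega, hc''⟩
  · intro he
    rw [Nat.add_sub_cancel, hc'', ← he, Nat.add_sub_cancel]

/-- The removed vertex is strictly below the chord from its predecessor to `Q i`, which is the
witness that `popped` records. The points behind the new top are below that chord because they are
below the removed edge. -/
lemma pop (h : ScanInv u Q m i len c)
    (hQ : ∀ a b, a < b → b < m → lin u (Q a) < lin u (Q b)) (him : i < m) (hlen : 2 ≤ len)
    (htest : 0 < orient (c (len - 2)) (c (len - 1)) (Q i)) : ScanInv u Q m i (len - 1) c := by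
  have e : len - 2 + 1 = len - 1 := by omega
  have hlt := h.lt (len - 2) (by omega)
  rw [e] at hlt
  have mono : ∀ a < m, ∀ b < m, lin u (Q a) < lin u (Q b) → a < b := by
    intro a ha b hb hab
    by_contra hcon
    rcases (not_lt.1 hcon).lt_or_eq with h' | h'
    · exact absurd (hQ b a h' ha) (not_lt.2 hab.le)
    · rw [h'] at hab; exact lt_irrefl _ hab
  constructor
  · exact h.i_le
  · omega
  · have := h.len_le; omega
  · exact fun j hj => h.mem j (by omega)
  · exact fun j hj => h.lt j (by omega)
  · exact fun j hj => h.below j (by omega)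
  · exact fun _ => h.first (by omega)
  · intro _ k hk hl
    rw [show len - 1 - 1 = len - 2 by omega] at hl ⊢
    have b1 := h.below (len - 2) (by omega) k hk
    rw [e] at b1
    have b2 := hQ k i hk him
    have b3 := lin_mul_orient_start u (c (len - 2)) (c (len - 1)) (Q k) (Q i)
    by_contra hcon
    push Not at hcon
    nlinarith [mul_pos (sub_pos.2 hlt) (neg_pos.2 hcon), mul_pos (sub_pos.2 hl) htest,
      mul_nonneg (sub_nonneg.2 (hl.trans b2).le) (neg_nonneg.2 b1)]
  · intro k hk
    rcases h.popped k hk with ⟨j, hj, he⟩ | h2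
    · by_cases hj' : j = len - 1
      · right
        obtain ⟨a, ha, hea⟩ := h.mem (len - 2) (by omega)
        rw [hj'] at he
        rw [hea, he] at htest hlt
        exact ⟨a, i, mono a (by omega) k (by omega) hlt, hk, him, htest⟩
      · exact Or.inl ⟨j, by omega, he⟩
    · exact Or.inr h2
  · omega

end ScanInv

/-- The result of the scan: a convex chain through all points that are not strictly to the right
of a chord. -/
structure IsScan (u : Plane) (Q : ℕ → Plane) (m len : ℕ) (c : ℕ → Plane) : Prop where
  pos : 0 < len
  len_le : len ≤ m
  mem : ∀ j < len, ∃ k < m, c j = Q k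
  lt : ∀ j, j + 1 < len → lin u (c j) < lin u (c (j + 1))
  below : ∀ j, j + 1 < len → ∀ k < m, orient (c j) (c (j + 1)) (Q k) ≤ 0
  first : c 0 = Q 0
  last : c (len - 1) = Q (m - 1)
  popped : ∀ k < m, (∃ j < len, c j = Q k) ∨
    ∃ a b, a < k ∧ k < b ∧ b < m ∧ 0 < orient (Q a) (Q k) (Q b)

lemma ScanInv.isScan {u : Plane} {Q : ℕ → Plane} {m len : ℕ} {c : ℕ → Plane}
    (h : ScanInv u Q m m len c) (hm : 0 < m) : IsScan u Q m len c :=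
  ⟨h.pos hm, h.len_le, h.mem, h.lt, h.below, h.first (h.pos hm), h.last rfl, h.popped⟩

lemma IsScan.isChain {u : Plane} {Q : ℕ → Plane} {m len : ℕ} {c : ℕ → Plane}
    (h : IsScan u Q m len c) {T : Finset Plane} (hT : ∀ s, s ∈ T ↔ ∃ k < m, Q k = s) :
    IsChain u T (len - 1) c where
  mem j hj := by
    obtain ⟨k, hk, he⟩ := h.mem j (by have := h.pos; omega)
    exact (hT _).2 ⟨k, hk, he.symm⟩
  lt j hj := h.lt j (by omega)
  below j hj s hs := by
    obtain ⟨k, hk, rfl⟩ := (hT s).1 hs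
    exact h.below j (by omega) k hk

lemma not_mem_interior_of_nonpos {T : Finset Plane} {a b z : Plane} (hab : a ≠ b)
    (hT : ∀ s ∈ T, orient a b s ≤ 0) (hz : orient a b z = 0) :
    z ∉ interior (convexHull ℝ (T : Set Plane)) := by
  intro hint
  have hconv : Convex ℝ {z | orient a b z ≤ 0} := by
    intro x hx y hy s t hs ht hst
    have e : orient a b (s • x + t • y) = s * orient a b x + t * orient a b y := by
      have hb' : t = 1 - s := by linarith
      rw [hb']
      simp only [orient, Prod.fst_add, Prod.snd_add, Prod.smul_fst, Prod.smul_snd, smul_eq_mul]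
      ring
    have hx : orient a b x ≤ 0 := hx
    have hy : orient a b y ≤ 0 := hy
    change orient a b (s • x + t • y) ≤ 0
    rw [e]
    nlinarith
  have hsub : convexHull ℝ (T : Set Plane) ⊆ {z | orient a b z ≤ 0} :=
    convexHull_min (fun s hs => hT s hs) hconv
  have hnhds := mem_interior_iff_mem_nhds.1 hint
  have hc : Continuous fun ε : ℝ => z + ε • normal a b := by fun_prop
  have ht : Tendsto (fun ε : ℝ => z + ε • normal a b) (𝓝[>] 0) (𝓝 z) := by
    have := hc.tendsto 0
    rw [zero_smul, add_zero] at this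
    exact this.mono_left nhdsWithin_le_nhds
  obtain ⟨ε, h1, h2⟩ := ((ht.eventually_mem hnhds).and self_mem_nhdsWithin).exists
  have h1 : orient a b (z + ε • normal a b) ≤ 0 := hsub h1
  have h2 : 0 < ε := h2
  rw [orient_add_normal, hz] at h1
  nlinarith [sq_add_sq_pos_of_ne hab]

/-- Being strictly between two chords is an open condition, and it puts a point into the hull. -/
lemma mem_interior_of_hidden {T : Finset Plane} {u a b c d z : Plane} (ha : a ∈ T) (hb : b ∈ T)
    (hc : c ∈ T) (hd : d ∈ T) (h1 : lin u a < lin u z) (h2 : lin u z < lin u b)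
    (h3 : lin u c < lin u z) (h4 : lin u z < lin u d) (h5 : 0 < orient a z b)
    (h6 : 0 < orient d z c) : z ∈ interior (convexHull ℝ (T : Set Plane)) := by
  rw [mem_interior_iff_mem_nhds]
  have hl : Continuous fun w : Plane => lin u w := by unfold lin; fun_prop
  have e1 : orient c d z = orient d z c := (orient_rotate c d z).symm
  have e2 : orient a b z = - orient a z b := orient_swap' _ _ _
  filter_upwards [hl.continuousAt.eventually_lt continuousAt_const h2,
    hl.continuousAt.eventually_lt continuousAt_const h4,
    continuousAt_const.eventually_lt hl.continuousAt h1,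
    continuousAt_const.eventually_lt hl.continuousAt h3,
    continuousAt_const.eventually_lt (continuous_orient c d).continuousAt (e1 ▸ h6),
    (continuous_orient a b).continuousAt.eventually_lt continuousAt_const
      (show orient a b z < 0 by linarith)] with w w1 w2 w3 w4 w5 w6
  exact mem_convexHull_of_between (u := u) hc hd ha hb w4.le w2.le w3.le w1.le (w4.trans w2)
    (w3.trans w1) w5.le w6.le (Or.inl w5)

/-- The points found by the scans in both directions are those not in the interior of the convex
hull. -/
lemma scan_mem_iff {u : Plane} {Q : ℕ → Plane} {m lc ld : ℕ} {c d : ℕ → Plane} (hm : 2 ≤ m)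
    (hQ : ∀ a b, a < b → b < m → lin u (Q a) < lin u (Q b))
    (hc : IsScan u Q m lc c) (hd : IsScan (-u) (fun k => Q (m - 1 - k)) m ld d)
    {T : Finset Plane} (hT : ∀ s, s ∈ T ↔ ∃ k < m, Q k = s) {k : ℕ} (hk : k < m) :
    ((∃ j < lc, c j = Q k) ∨ ∃ j < ld, d j = Q k) ↔
      Q k ∉ interior (convexHull ℝ (T : Set Plane)) := by
  have hne : Q 0 ≠ Q (m - 1) := by
    intro he
    have := hQ 0 (m - 1) (by omega) (by omega)
    rw [he] at this
    exact lt_irrefl _ this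
  have edge : ∀ {v : Plane} {N : ℕ} {e : ℕ → Plane}, IsChain v T N e → 0 < N → ∀ j ≤ N,
      e j ∉ interior (convexHull ℝ (T : Set Plane)) := by
    intro v N e he hN j hj
    rcases hj.lt_or_eq with h | h
    · refine not_mem_interior_of_nonpos (a := e j) (b := e (j + 1)) (fun hh => ?_) (he.below j h)
        (orient_self_mid _ _)
      have := he.lt j h
      rw [hh] at this
      exact lt_irrefl _ this
    · have e1 : j - 1 + 1 = j := by omega
      have hb := he.below (j - 1) (by omega)
      rw [e1] at hb
      refine not_mem_interior_of_nonpos (a := e (j - 1)) (b := e j) (fun hh => ?_) hb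
        (orient_self_right _ _)
      have := he.lt (j - 1) (by omega)
      rw [e1, hh] at this
      exact lt_irrefl _ this
  constructor
  · rintro (⟨j, hj, he⟩ | ⟨j, hj, he⟩)
    · rw [← he]
      refine edge (hc.isChain hT) ?_ j (by omega)
      have h1 := hc.first
      have h2 := hc.last
      have h3 := hc.pos
      by_contra hcon
      have : lc = 1 := by omega
      rw [this, Nat.sub_self, h1] at h2
      exact hne h2
    · rw [← he]
      have hT' : ∀ s, s ∈ T ↔ ∃ k < m, Q (m - 1 - k) = s := by
        intro s
        rw [hT]
        constructor
        · rintro ⟨k, hk, rfl⟩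
          exact ⟨m - 1 - k, by omega, by congr 1; omega⟩
        · rintro ⟨k, hk, rfl⟩
          exact ⟨m - 1 - k, by omega, rfl⟩
      refine edge (hd.isChain hT') ?_ j (by omega)
      have h1 := hd.first
      have h2 := hd.last
      have h3 := hd.pos
      by_contra hcon
      have : ld = 1 := by omega
      rw [this, Nat.sub_self, h1] at h2
      simp only [Nat.sub_zero, Nat.sub_self] at h2
      exact hne h2.symm
  · intro hint
    by_contra hcon
    push Not at hcon
    apply hint
    -- A point on neither chain was discarded in both scans: it is strictly below one chord and
    -- strictly above another.
    rcases hc.popped k hk with ⟨j, hj, he⟩ | ⟨a, b, h1, h2, h3, h4⟩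
    · exact absurd he (hcon.1 j hj)
    rcases hd.popped (m - 1 - k) (by omega) with ⟨j, hj, he⟩ | ⟨a', b', g1, g2, g3, g4⟩
    · rw [show m - 1 - (m - 1 - k) = k by omega] at he
      exact absurd he (hcon.2 j hj)
    · rw [show m - 1 - (m - 1 - k) = k by omega] at g4
      exact mem_interior_of_hidden (u := u) ((hT _).2 ⟨a, by omega, rfl⟩)
        ((hT _).2 ⟨b, by omega, rfl⟩) ((hT _).2 ⟨m - 1 - b', by omega, rfl⟩)
        ((hT _).2 ⟨m - 1 - a', by omega, rfl⟩) (hQ a k h1 hk) (hQ k b h2 h3)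
        (hQ _ _ (by omega) hk) (hQ _ _ (by omega) (by omega)) h4 g4

/-! ### Lexicographic order -/

/-- The strict lexicographic order of the plane. -/
def LexLt (a b : Plane) : Prop := a.1 < b.1 ∨ (a.1 = b.1 ∧ a.2 < b.2)

lemma lexLt_of_not {a b : Plane} (hab : a ≠ b) (h : ¬ LexLt b a) : LexLt a b := by
  unfold LexLt at *
  push Not at h
  rcases h.1.lt_or_eq with h1 | h1
  · exact Or.inl h1
  · refine Or.inr ⟨h1, lt_of_le_of_ne (h.2 h1.symm) fun h2 => hab (Prod.ext h1 h2)⟩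

/-- On a finite set the lexicographic order is given by a linear functional. -/
lemma exists_lin_of_lex (S : Finset Plane) :
    ∃ u : Plane, ∀ a ∈ S, ∀ b ∈ S, LexLt a b → lin u a < lin u b := by
  -- The functional is `x + ε y` with ε small for the finite set. It occurs only in the analysis;
  -- the program compares coordinates.
  have : ∀ᶠ ε in 𝓝[>] (0 : ℝ), ∀ a ∈ S, ∀ b ∈ S, LexLt a b → lin (1, ε) a < lin (1, ε) b := by
    rw [Finset.eventually_all]
    intro a _
    rw [Finset.eventually_all]
    intro b _
    by_cases h : a.1 < b.1
    · have hc : ∀ z : Plane, Continuous fun ε : ℝ => lin (1, ε) z := by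
        intro z; unfold lin; fun_prop
      have h0 : lin (1, (0 : ℝ)) a < lin (1, (0 : ℝ)) b := by simpa [lin] using h
      filter_upwards [nhdsWithin_le_nhds
        ((hc a).continuousAt.eventually_lt (hc b).continuousAt h0)] with ε hε _
      exact hε
    · filter_upwards [self_mem_nhdsWithin] with ε hε hab
      have hε : 0 < ε := hε
      rcases hab with h1 | ⟨h1, h2⟩
      · exact absurd h1 h
      · simp only [lin, h1]
        nlinarith
  obtain ⟨ε, hε⟩ := this.exists
  exact ⟨_, hε⟩

/-! ### Point sets on two shells -/

/-- The inner points lie in the interior of the hull of `S`, which is convex, so their own hull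
stays in that interior. -/
lemma not_mem_convexHull_of_shell {S : Finset Plane} {w : Plane} (hw : w ∈ shell S) :
    w ∉ convexHull ℝ ((S \ shell S : Finset Plane) : Set Plane) := by
  intro h
  apply (mem_shell.1 hw).2
  refine convexHull_min ?_ (convex_convexHull ℝ (S : Set Plane)).interior h
  intro s hs
  rw [Finset.mem_coe, Finset.mem_sdiff] at hs
  by_contra hc
  exact hs.2 (mem_shell.2 ⟨hs.1, hc⟩)

lemma LiesOnShells.two {S : Finset Plane} (h : LiesOnShells 2 S) :
    (S \ shell S).Nonempty ∧
      ∀ s ∈ S \ shell S, s ∉ interior (convexHull ℝ ((S \ shell S : Finset Plane) : Set Plane)) := by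
  obtain ⟨-, h1, h2⟩ := h
  refine ⟨h1, fun s hs => ?_⟩
  have h2 : (S \ shell S) \ shell (S \ shell S) = ∅ := h2
  rw [Finset.sdiff_eq_empty_iff_subset] at h2
  exact (mem_shell.1 (h2 hs)).2

/-- A point of `S` at which a nonzero orientation functional is maximal belongs to the shell. -/
lemma exists_shell_max {S : Finset Plane} (hS : S.Nonempty) {a b : Plane} (hab : a ≠ b) :
    ∃ s ∈ shell S, ∀ t ∈ S, orient a b t ≤ orient a b s := by
  obtain ⟨s, hs, hmax⟩ := S.exists_max_image (orient a b) hS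
  refine ⟨s, mem_shell.2 ⟨hs, ?_⟩, hmax⟩
  have e : ∀ t, orient s (s + (b - a)) t = orient a b t - orient a b s := by
    intro t
    simp only [orient, Prod.fst_add, Prod.snd_add, Prod.fst_sub, Prod.snd_sub]
    ring
  refine not_mem_interior_of_nonpos (a := s) (b := s + (b - a)) ?_ ?_ (orient_self_mid _ _)
  · intro h
    exact hab (sub_eq_zero.1 (left_eq_add.1 h)).symm
  · intro t ht
    rw [e]
    linarith [hmax t ht]

/-- The shell is not contained in a line: the extreme values of the functional that vanishes on the
line are attained on the shell, so all of `S` would lie on the line and no point of it would be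
interior. -/
lemma three_le_card_shell {S : Finset Plane} (h : (S \ shell S).Nonempty) :
    3 ≤ (shell S).card := by
  obtain ⟨z, hz⟩ := h
  rw [Finset.mem_sdiff] at hz
  have hzi : z ∈ interior (convexHull ℝ (S : Set Plane)) := by
    by_contra hc
    exact hz.2 (mem_shell.2 ⟨hz.1, hc⟩)
  have hS : S.Nonempty := ⟨z, hz.1⟩
  have key : ∀ a b : Plane, a ≠ b → ∃ s ∈ shell S, orient a b s ≠ orient a b a := by
    intro a b hab
    by_contra hc
    push Not at hc
    obtain ⟨s, hs, hmax⟩ := exists_shell_max hS hab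
    have h0 : ∀ t ∈ S, orient a b t ≤ 0 := by
      intro t ht
      have := hmax t ht
      rwa [hc s hs, orient_self_mid] at this
    obtain ⟨s', hs', hmax'⟩ := exists_shell_max hS hab.symm
    have h1 : ∀ t ∈ S, orient b a t ≤ 0 := by
      intro t ht
      have := hmax' t ht
      rw [orient_swap a b s', hc s' hs', orient_self_mid, neg_zero] at this
      exact this
    refine not_mem_interior_of_nonpos hab h0 ?_ hzi
    have a1 := h0 z hz.1
    have a2 := h1 z hz.1
    rw [orient_swap] at a2
    linarith
  obtain ⟨a, ha, -⟩ := exists_shell_max hS (show ((0 : ℝ), (0 : ℝ)) ≠ (1, 0) by simp)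
  have haa : a ≠ a + (1, 0) := by
    intro h
    have := congrArg Prod.fst h
    simp at this
  obtain ⟨b, hb, hba⟩ := key a _ haa
  have hab : a ≠ b := by rintro rfl; exact hba rfl
  obtain ⟨c, hc, hca⟩ := key a b hab
  have hac : a ≠ c := by rintro rfl; exact hca rfl
  have hbc : b ≠ c := by
    rintro rfl
    rw [orient_self_right, orient_self_mid] at hca
    exact hca rfl
  have hsub : ({a, b, c} : Finset Plane) ⊆ shell S := by
    intro x hx
    simp only [Finset.mem_insert, Finset.mem_singleton] at hx
    rcases hx with rfl | rfl | rfl <;> assumption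
  calc 3 = ({a, b, c} : Finset Plane).card := by
        rw [Finset.card_insert_of_notMem (by simp [hab, hac]),
          Finset.card_insert_of_notMem (by simp [hbc]), Finset.card_singleton]
    _ ≤ _ := Finset.card_le_card hsub

lemma IsChain.shift {u : Plane} {T : Finset Plane} {N : ℕ} {c : ℕ → Plane}
    (h : IsChain u T N c) {st E : ℕ} (hN : st + E ≤ N) :
    IsChain u T E fun i => c (st + i) where
  mem i hi := h.mem _ (by omega)
  lt i hi := h.lt (st + i) (by omega)
  below i hi := h.below (st + i) (by omega)

open scoped Classical in
/-- The guard set that results from a part of a chain of the inner shell which all points of the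
outer shell pass. -/
theorem guards_of_passing {S : Finset Plane} {u : Plane} {N st m : ℕ} {c : ℕ → Plane}
    (hc : IsChain u (S \ shell S) N c) (hm : 0 < m) (hN : st + 2 * m ≤ N)
    (hpass : ∀ w ∈ shell S, Passes c st (2 * m) w) :
    IsUniversalGuardSet S (S \ (Finset.range (m + 1)).image fun i => c (st + 2 * i)) ∧
      ((Finset.range (m + 1)).image fun i => c (st + 2 * i)).card = m + 1 := by
  constructor
  · refine isUniversalGuardSet_sdiff_chain Finset.sdiff_subset hm (hc.shift hN) ?_
    intro w hw hwT
    have hws : w ∈ shell S := by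
      by_contra h
      exact hwT (Finset.mem_sdiff.2 ⟨hw, h⟩)
    rcases hc.all_or_none_of_passes (by omega) hN (hpass w hws) with h | h
    · exact Or.inl fun i hi => h (st + i) (by omega) (by omega)
    · exact Or.inr fun i hi => h (st + i) (by omega) (by omega)
  · rw [Finset.card_image_of_injOn, Finset.card_range]
    intro i hi j hj hij
    have hi := Finset.mem_range.1 hi
    have hj := Finset.mem_range.1 hj
    simp only at hij
    rcases lt_trichotomy i j with h | h | h
    · have := hc.lin_lt (show st + 2 * i < st + 2 * j by omega) (by omega)
      rw [hij] at this
      exact absurd this (lt_irrefl _)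
    · exact h
    · have := hc.lin_lt (show st + 2 * j < st + 2 * i by omega) (by omega)
      rw [hij] at this
      exact absurd this (lt_irrefl _)

/-- One of the parts of length `2 * m` is passed by all outer points. -/
theorem exists_passing {S : Finset Plane} (hS : LiesOnShells 2 S) {u : Plane} {Nc Nd m : ℕ}
    {c d : ℕ → Plane} (hc : IsChain u (S \ shell S) Nc c) (hd : IsChain (-u) (S \ shell S) Nd d)
    (hcard : (S \ shell S).card ≤ Nc + Nd + 2) (hm : 6 * (m * m) < S.card)
    (h1 : (shell S).card ≤ m)
    (h2 : ∀ b, b * (2 * m) + 2 * m ≤ Nc → ∃ w ∈ shell S, ¬ Passes c (b * (2 * m)) (2 * m) w)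
    (h3 : ∀ b, b * (2 * m) + 2 * m ≤ Nd → ∃ w ∈ shell S, ¬ Passes d (b * (2 * m)) (2 * m) w) :
    False := by
  have h3m := three_le_card_shell hS.two.1
  have hE : 0 < 2 * m := by omega
  have hb := hc.blocks_le hd (fun w hw => not_mem_convexHull_of_shell hw) hE h2 h3
  have hs : (S \ shell S).card + (shell S).card = S.card :=
    Finset.card_sdiff_add_card_eq_card (shell_subset S)
  have e1 : Nc < (2 * m) * (Nc / (2 * m)) + 2 * m := Nat.lt_mul_div_succ Nc hE |>.trans_eq (by ring)
  have e2 : Nd < (2 * m) * (Nd / (2 * m)) + 2 * m := Nat.lt_mul_div_succ Nd hE |>.trans_eq (by ring)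
  have e3 : (2 * m) * (Nc / (2 * m) + Nd / (2 * m)) ≤ (2 * m) * (2 * m) :=
    Nat.mul_le_mul_left _ (by omega)
  have hm3 : 3 ≤ m := h3m.trans h1
  -- If all blocks fail, there are at most 2m of them. The two incomplete remainders add at most 4m
  -- - 2 edges, so the inner points number at most 4m² + 4m and all points at most 4m² + 5m, which
  -- is below 6m² for m ≥ 3.
  nlinarith

end

end UniversalGuards

/-! ### Programs of the real RAM -/

namespace RealRAM

noncomputable section

/-- Started in `s`, the program `P` halts within `c` time units in a state satisfying `Q`. -/
def Runs (P : Program) (s : State) (c : ℕ) (Q : State → Prop) : Prop :=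
  ∃ s' t, Exec P s s' t ∧ t ≤ c ∧ Q s'

/-- Whether the program assigns to the natural-number array `a`. -/
def Program.writes : Program → ℕ → Bool
  | .skip, _ => false
  | .setNat b _ _, a => a == b
  | .setReal _ _ _, _ => false
  | .seq p q, a => p.writes a || q.writes a
  | .ite _ p q, a => p.writes a || q.writes a
  | .while _ p, a => p.writes a

/-- Whether the program assigns to no real array. -/
def Program.keepsReal : Program → Bool
  | .setReal _ _ _ => false
  | .seq p q => p.keepsReal && q.keepsReal
  | .ite _ p q => p.keepsReal && q.keepsReal
  | .while _ p => p.keepsReal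
  | _ => true

/-- The parts of the memory that `P` cannot change agree in `s` and `s'`. -/
def Frame (P : Program) (s s' : State) : Prop :=
  (P.keepsReal = true → s'.real = s.real) ∧ ∀ a, P.writes a = false → s'.nat a = s.nat a

lemma Frame.refl (P : Program) (s : State) : Frame P s s := ⟨fun _ => rfl, fun _ _ => rfl⟩

lemma Frame.trans {P : Program} {s s' s'' : State} (h : Frame P s s') (h' : Frame P s' s'') :
    Frame P s s'' :=
  ⟨fun hP => (h'.1 hP).trans (h.1 hP), fun a ha => (h'.2 a ha).trans (h.2 a ha)⟩

/-- As `writes` and `keepsReal` are computable, the later claims that a program leaves some array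
alone reduce to `rfl`. -/
lemma Exec.frame {P : Program} {s s' : State} {t : ℕ} (h : Exec P s s' t) : Frame P s s' := by
  induction h with
  | skip s => exact Frame.refl _ _
  | setNat s a i e =>
    refine ⟨fun _ => rfl, fun b hb => ?_⟩
    have : b ≠ a := by simpa [Program.writes] using hb
    simp [State.updateNat, Function.update_of_ne this]
  | setReal s a i e => exact ⟨fun h => by simp [Program.keepsReal] at h, fun _ _ => rfl⟩
  | seq _ _ h1 h2 =>
    refine ⟨fun h => ?_, fun a ha => ?_⟩
    · simp only [Program.keepsReal, Bool.and_eq_true] at h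
      exact (h2.1 h.2).trans (h1.1 h.1)
    · simp only [Program.writes, Bool.or_eq_false_iff] at ha
      exact (h2.2 a ha.2).trans (h1.2 a ha.1)
  | iteTrue _ _ h1 =>
    refine ⟨fun h => ?_, fun a ha => ?_⟩
    · simp only [Program.keepsReal, Bool.and_eq_true] at h
      exact h1.1 h.1
    · simp only [Program.writes, Bool.or_eq_false_iff] at ha
      exact h1.2 a ha.1
  | iteFalse _ _ h1 =>
    refine ⟨fun h => ?_, fun a ha => ?_⟩
    · simp only [Program.keepsReal, Bool.and_eq_true] at h
      exact h1.1 h.2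
    · simp only [Program.writes, Bool.or_eq_false_iff] at ha
      exact h1.2 a ha.2
  | whileFalse _ => exact Frame.refl _ _
  | whileTrue _ _ _ h1 h2 =>
    exact ⟨fun h => (h2.1 h).trans (h1.1 h), fun a ha => (h2.2 a ha).trans (h1.2 a ha)⟩

lemma Runs.mono {P : Program} {s : State} {c c' : ℕ} {Q Q' : State → Prop} (h : Runs P s c Q)
    (hc : c ≤ c') (hQ : ∀ s', Frame P s s' → Q s' → Q' s') : Runs P s c' Q' := by
  obtain ⟨s', t, he, ht, hq⟩ := h
  exact ⟨s', t, he, ht.trans hc, hQ s' he.frame hq⟩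

lemma Runs.le {P : Program} {s : State} {c c' : ℕ} {Q : State → Prop} (h : Runs P s c Q)
    (hc : c ≤ c') : Runs P s c' Q :=
  h.mono hc fun _ _ h => h

lemma Runs.seq {p q : Program} {s : State} {c c' : ℕ} {Q Q' : State → Prop} (h : Runs p s c Q)
    (h' : ∀ s', Frame p s s' → Q s' → Runs q s' c' Q') : Runs (.seq p q) s (c + c') Q' := by
  obtain ⟨s', t, he, ht, hq⟩ := h
  obtain ⟨s'', t', he', ht', hq'⟩ := h' s' he.frame hq
  exact ⟨s'', t + t', he.seq he', by omega, hq'⟩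

lemma Runs.ite {b : Test} {p q : Program} {s : State} {c : ℕ} {Q : State → Prop}
    (hp : b.Holds s → Runs p s c Q) (hq : ¬b.Holds s → Runs q s c Q) :
    Runs (.ite b p q) s (b.cost + c + 1) Q := by
  by_cases hb : b.Holds s
  · obtain ⟨s', t, he, ht, h⟩ := hp hb
    exact ⟨s', _, .iteTrue hb he, by omega, h⟩
  · obtain ⟨s', t, he, ht, h⟩ := hq hb
    exact ⟨s', _, .iteFalse hb he, by omega, h⟩

/-- A loop with the invariant `I k`, whose index `k` decreases in each round. -/
lemma Runs.while {b : Test} {p : Program} {c : ℕ} (I : ℕ → State → Prop) {s : State} {k : ℕ}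
    (hI : I k s)
    (step : ∀ k s', Frame p s s' → I k s' → b.Holds s' →
      Runs p s' c fun s'' => ∃ k' < k, I k' s'') :
    Runs (.while b p) s ((k + 1) * (c + b.cost + 1)) fun s' => (∃ k', I k' s') ∧ ¬b.Holds s' := by
  suffices H : ∀ k s', Frame p s s' → I k s' →
      Runs (.while b p) s' ((k + 1) * (c + b.cost + 1))
        fun s' => (∃ k', I k' s') ∧ ¬b.Holds s' from H k s (Frame.refl _ _) hI
  intro k
  induction k using Nat.strong_induction_on with
  | _ k ih =>
    intro s' hf hs'
    by_cases hb : b.Holds s'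
    · obtain ⟨s₁, t₁, he₁, ht₁, k', hk', hI'⟩ := step k s' hf hs' hb
      obtain ⟨s₂, t₂, he₂, ht₂, hQ⟩ := ih k' hk' s₁ (hf.trans he₁.frame) hI'
      refine ⟨s₂, _, .whileTrue hb he₁ he₂, ?_, hQ⟩
      have : (k' + 1) * (c + b.cost + 1) ≤ k * (c + b.cost + 1) := Nat.mul_le_mul_right _ hk'
      rw [Nat.add_mul k]
      omega
    · refine ⟨s', _, .whileFalse hb, ?_, ⟨k, hs'⟩, hb⟩
      rw [Nat.add_mul k]
      omega

/-! ### Straight-line programs -/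

/-- Whether the program contains no loop. -/
def Program.loopFree : Program → Bool
  | .seq p q => p.loopFree && q.loopFree
  | .ite _ p q => p.loopFree && q.loopFree
  | .while _ _ => false
  | _ => true

open scoped Classical in
/-- The effect of a program without loops. -/
def Program.run : Program → State → State
  | .skip, s => s
  | .setNat a i e, s => s.updateNat a (i.eval s) (e.eval s)
  | .setReal a i e, s => s.updateReal a (i.eval s) (e.eval s)
  | .seq p q, s => q.run (p.run s)
  | .ite b p q, s => if b.Holds s then p.run s else q.run s
  | .while _ _, s => s

/-- An upper bound for the running time of a program without loops. -/
def Program.bound : Program → ℕ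
  | .skip => 1
  | .setNat _ i e => i.cost + e.cost + 1
  | .setReal _ i e => i.cost + e.cost + 1
  | .seq p q => p.bound + q.bound
  | .ite b p q => b.cost + (p.bound + q.bound) + 1
  | .while _ _ => 0

/-- Reduces code without loops to a calculation with `Program.run`; only loops need invariants. -/
lemma Runs.of_loopFree {P : Program} (hP : P.loopFree = true) {s : State} {Q : State → Prop}
    (hQ : Q (P.run s)) : Runs P s P.bound Q := by
  suffices H : ∃ t, Exec P s (P.run s) t ∧ t ≤ P.bound by
    obtain ⟨t, he, ht⟩ := H
    exact ⟨_, t, he, ht, hQ⟩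
  clear hQ
  induction P generalizing s with
  | skip => exact ⟨_, .skip s, le_rfl⟩
  | setNat a i e => exact ⟨_, .setNat s a i e, le_rfl⟩
  | setReal a i e => exact ⟨_, .setReal s a i e, le_rfl⟩
  | seq p q hp hq =>
    simp only [Program.loopFree, Bool.and_eq_true] at hP
    obtain ⟨t, h, ht⟩ := hp (s := s) hP.1
    obtain ⟨t', h', ht'⟩ := hq (s := p.run s) hP.2
    exact ⟨_, h.seq h', by simp only [Program.bound]; omega⟩
  | ite b p q hp hq =>
    simp only [Program.loopFree, Bool.and_eq_true] at hP
    by_cases hb : b.Holds s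
    · obtain ⟨t, h, ht⟩ := hp (s := s) hP.1
      exact ⟨_, by simpa [Program.run, hb] using Exec.iteTrue hb h,
        by simp only [Program.bound]; omega⟩
    · obtain ⟨t, h, ht⟩ := hq (s := s) hP.2
      exact ⟨_, by simpa [Program.run, hb] using Exec.iteFalse hb h,
        by simp only [Program.bound]; omega⟩
  | _ => simp [Program.loopFree] at hP

@[simp] lemma State.updateNat_nat (s : State) (a i k b j : ℕ) :
    (s.updateNat a i k).nat b j = if b = a ∧ j = i then k else s.nat b j := by
  by_cases hb : b = a
  · subst hb
    simp [State.updateNat, Function.update_apply]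
  · simp [State.updateNat, hb]

lemma State.updateNat_nat_of_ne (s : State) (a i k : ℕ) {b : ℕ} (h : b ≠ a) :
    (s.updateNat a i k).nat b = s.nat b := by
  funext j
  simp [h]

/-- The scalar variable `a`. -/
abbrev var (a : ℕ) : NatExp := .get a (.lit 0)

/-- Assignment to the scalar variable `a`. -/
abbrev assign (a : ℕ) (e : NatExp) : Program := .setNat a (.lit 0) e

/-- Disjunction of tests. -/
abbrev Test.or (b c : Test) : Test := .not (.and (.not b) (.not c))

/-- Fill the array `a` with the first `var l` values of the expression `e` of `var 7`. -/
def fill (a l : ℕ) (e : NatExp) : Program :=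
  .seq (assign 7 (.lit 0)) (.while (.natLt (var 7) (var l))
    (.seq (.setNat a (var 7) e) (assign 7 (.add (var 7) (.lit 1)))))

lemma runs_fill {a l : ℕ} {e : NatExp} {s : State} {f : ℕ → ℕ} {L : ℕ} (hL : s.nat l 0 = L)
    (hal : a ≠ 7 ∧ l ≠ 7 ∧ a ≠ l)
    (he : ∀ s' : State, s'.real = s.real → (∀ b, b ≠ a → b ≠ 7 → s'.nat b = s.nat b) →
      e.eval s' = f (s'.nat 7 0)) :
    Runs (fill a l e) s ((L + 1) * (e.cost + 20)) fun s' =>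
      ∀ j, s'.nat a j = if j < L then f j else s.nat a j := by
  subst hL
  obtain ⟨ha, hl, hal⟩ := hal
  unfold fill
  refine ((Runs.of_loopFree (Q := fun s' => s'.real = s.real ∧ s'.nat 7 0 = 0 ∧
    ∀ b, b ≠ 7 → s'.nat b = s.nat b) rfl ?_).seq fun s₁ _ h₁ =>
    Runs.while (c := (Program.seq (.setNat a (var 7) e)
      (assign 7 (.add (var 7) (.lit 1)))).bound) (fun k s' => s'.nat 7 0 + k = s.nat l 0 ∧
      ∀ j, s'.nat a j = if j < s'.nat 7 0 then f j else s.nat a j) (k := s.nat l 0)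
      ?_ ?_).mono ?_ ?_
  · refine ⟨rfl, by simp [Program.run, NatExp.eval], fun b hb => ?_⟩
    funext j
    simp [Program.run, hb]
  · simp [h₁.2.1, h₁.2.2 a ha]
  · intro k s' hf hI hb
    have hl' : s'.nat l 0 = s.nat l 0 := by
      rw [hf.2 l (by simp [Program.writes, hl, hal.symm]), h₁.2.2 l hl]
    simp only [Test.Holds, NatExp.eval, hl'] at hb
    refine Runs.of_loopFree rfl ⟨k - 1, by omega, ?_⟩
    have hev : e.eval s' = f (s'.nat 7 0) := by
      refine he s' ((hf.1 (by simp [Program.keepsReal])).trans h₁.1) ?_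
      intro b hb1 hb2
      rw [hf.2 b (by simp [Program.writes, hb1, hb2]), h₁.2.2 b hb2]
    have ha' : (7 : ℕ) ≠ a := ha.symm
    simp only [Program.run, NatExp.eval, State.updateNat_nat, hev, ha', false_and, if_false,
      true_and, and_self, if_true, ha]
    refine ⟨by omega, fun j => ?_⟩
    rw [hI.2 j]
    by_cases h1 : j = s'.nat 7 0
    · simp [h1]
    · simp only [h1, if_false]
      congr 1
      simp only [eq_iff_iff]
      omega
  · simp only [Program.bound, NatExp.cost, Test.cost]
    nlinarith
  · rintro s' hf ⟨⟨k, h1, h2⟩, hb⟩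
    have hl' : s'.nat l 0 = s.nat l 0 :=
      congrFun (hf.2 l (by simp [Program.writes, hl, hal.symm])) 0
    simp only [Test.Holds, NatExp.eval, hl'] at hb
    intro j
    rw [h2 j, show s'.nat 7 0 = s.nat l 0 by omega]

/-- Assign `v` to the cells of the array `a` given by the first `var l` values of the
expression `e` of `var 7`. -/
def scatter (a l : ℕ) (e : NatExp) (v : ℕ) : Program :=
  .seq (assign 7 (.lit 0)) (.while (.natLt (var 7) (var l))
    (.seq (.setNat a e (.lit v)) (assign 7 (.add (var 7) (.lit 1)))))

lemma runs_scatter {a l v : ℕ} {e : NatExp} {s : State} {f : ℕ → ℕ} {L : ℕ} (hL : s.nat l 0 = L)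
    (hal : a ≠ 7 ∧ l ≠ 7 ∧ a ≠ l)
    (he : ∀ s' : State, (∀ b, b ≠ a → b ≠ 7 → s'.nat b = s.nat b) →
      e.eval s' = f (s'.nat 7 0)) :
    Runs (scatter a l e v) s ((L + 1) * (e.cost + 20)) fun s' =>
      (∀ k < L, s'.nat a (f k) = v) ∧
      ∀ j, (∀ k < L, f k ≠ j) → s'.nat a j = s.nat a j := by
  subst hL
  obtain ⟨ha, hl, hal⟩ := hal
  unfold scatter
  refine ((Runs.of_loopFree (Q := fun s' => s'.nat 7 0 = 0 ∧
    ∀ b, b ≠ 7 → s'.nat b = s.nat b) rfl ?_).seq fun s₁ _ h₁ =>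
    Runs.while (c := (Program.seq (.setNat a e (.lit v))
      (assign 7 (.add (var 7) (.lit 1)))).bound) (fun k s' => s'.nat 7 0 + k = s.nat l 0 ∧
      (∀ k < s'.nat 7 0, s'.nat a (f k) = v) ∧
      ∀ j, (∀ k < s'.nat 7 0, f k ≠ j) → s'.nat a j = s.nat a j) (k := s.nat l 0)
      ?_ ?_).mono ?_ ?_
  · refine ⟨by simp [Program.run, NatExp.eval], fun b hb => ?_⟩
    funext j
    simp [Program.run, hb]
  · simp [h₁.1, h₁.2 a ha]
  · intro k s' hf hI hb
    have hl' : s'.nat l 0 = s.nat l 0 := by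
      rw [hf.2 l (by simp [Program.writes, hl, hal.symm]), h₁.2 l hl]
    simp only [Test.Holds, NatExp.eval, hl'] at hb
    refine Runs.of_loopFree rfl ⟨k - 1, by omega, ?_⟩
    have hev : e.eval s' = f (s'.nat 7 0) := by
      refine he s' ?_
      intro b hb1 hb2
      rw [hf.2 b (by simp [Program.writes, hb1, hb2]), h₁.2 b hb2]
    have ha' : (7 : ℕ) ≠ a := ha.symm
    simp only [Program.run, NatExp.eval, State.updateNat_nat, hev, ha', false_and, if_false,
      true_and, and_self, if_true, ha]
    refine ⟨by omega, fun k hk => ?_, fun j hj => ?_⟩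
    · rcases Nat.lt_succ_iff_lt_or_eq.1 hk with h | rfl
      · rw [hI.2.1 k h]
        simp
      · simp
    · rw [if_neg fun h => hj _ (Nat.lt_succ_self _) h.symm,
        hI.2.2 j fun k hk => hj k (by omega)]
  · simp only [Program.bound, NatExp.cost, Test.cost]
    nlinarith
  · rintro s' hf ⟨⟨k, h1, h2⟩, hb⟩
    have hl' : s'.nat l 0 = s.nat l 0 :=
      congrFun (hf.2 l (by simp [Program.writes, hl, hal.symm])) 0
    simp only [Test.Holds, NatExp.eval, hl'] at hb
    rw [show s'.nat 7 0 = s.nat l 0 by omega] at h2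
    exact h2

end

end RealRAM

/-! ### Merging -/

namespace UniversalGuards

noncomputable section

/-- Each aligned block of length `w` of the first `N` entries of `A` is sorted for `r`. -/
def SortedBlocks (r : ℕ → ℕ → Prop) (w N : ℕ) (A : ℕ → ℕ) : Prop :=
  ∀ b x y, w * b ≤ x → x < y → y < w * b + w → y < N → ¬r (A y) (A x)

/-- The state of merging the blocks of length `w` of `A` in pairs into `T`: the merged part has
length `k`, the current pair starts at `lo`, and its next entries are at `i` and `j`. -/
structure MergeInv (r : ℕ → ℕ → Prop) (w N : ℕ) (A T : ℕ → ℕ) (lo i j k : ℕ) : Prop where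
  aligned : ∃ b, lo = (w + w) * b
  lo_le : lo + (w + w) ≤ N
  le_i : lo ≤ i
  i_le : i ≤ lo + w
  le_j : lo + w ≤ j
  j_le : j ≤ lo + (w + w)
  count : k + lo + w = i + j
  sorted : SortedBlocks r (w + w) k T
  le_left : ∀ x, lo ≤ x → x < k → ∀ y, i ≤ y → y < lo + w → ¬r (A y) (T x)
  le_right : ∀ x, lo ≤ x → x < k → ∀ y, j ≤ y → y < lo + (w + w) → ¬r (A y) (T x)
  left_mem : ∀ y < i, ∃ x < k, T x = A y
  right_mem : ∀ y, lo + w ≤ y → y < j → ∃ x < k, T x = A y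

lemma block_unique {v b c k : ℕ} (h1 : v * b ≤ k) (h2 : k < v * b + v) (h3 : v * c ≤ k)
    (h4 : k < v * c + v) : b = c := by
  have hb : b < c + 1 := Nat.lt_of_mul_lt_mul_left (a := v) (by rw [Nat.mul_add]; omega)
  have hc : c < b + 1 := Nat.lt_of_mul_lt_mul_left (a := v) (by rw [Nat.mul_add]; omega)
  omega

variable {r : ℕ → ℕ → Prop} {w N lo i j k : ℕ} {A T T' : ℕ → ℕ}

lemma MergeInv.init (hN : w + w ≤ N) : MergeInv r w N A T 0 0 w 0 where
  aligned := ⟨0, by simp⟩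
  lo_le := by omega
  le_i := le_rfl
  i_le := by omega
  le_j := by omega
  j_le := by omega
  count := by omega
  sorted := fun b x y _ _ _ h => by omega
  le_left := fun x _ h => by omega
  le_right := fun x _ h => by omega
  left_mem := fun y h => by omega
  right_mem := fun y h h' => by omega

/-- The pair just completed becomes part of the sorted output. As `N` is a multiple of the pair
length, a complete pair follows. -/
lemma MergeInv.reset (h : MergeInv r w N A T lo i j k) (hk : ¬k < lo + (w + w)) (hN : k < N)
    (hB : ∃ B, N = (w + w) * B) : MergeInv r w N A T k k (k + w) k := by
  obtain ⟨b, hb⟩ := h.aligned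
  obtain ⟨B, rfl⟩ := hB
  have h1 := h.i_le
  have h2 := h.j_le
  have h3 := h.count
  have hk' : k = (w + w) * (b + 1) := by rw [Nat.mul_add]; omega
  refine ⟨⟨_, hk'⟩, ?_, le_rfl, by omega, le_rfl, by omega, by omega, h.sorted,
    fun x _ h => by omega, fun x _ h => by omega, fun y hy => ?_, fun y h h' => by omega⟩
  · have : b + 1 < B := Nat.lt_of_mul_lt_mul_left (hk' ▸ hN)
    have := Nat.mul_le_mul_left (w + w) this
    rw [Nat.mul_succ] at this
    omega
  · by_cases hy' : y < lo + w
    · exact h.left_mem y (by omega)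
    · exact h.right_mem y (by omega) (by omega)

/-- The new entry does not precede the entries of the current pair that are already merged, and no
remaining entry precedes it: on the left because the block is sorted, on the right because its next
entry does not, and non-precedence is transitive. -/
lemma MergeInv.takeLeft (h : MergeInv r w N A T lo i j k)
    (ht : ∀ a b c, ¬r b a → ¬r c b → ¬r c a) (hA : SortedBlocks r w N A)
    (hi : i < lo + w) (hij : ¬(j < lo + (w + w) ∧ r (A j) (A i)))
    (hT : ∀ x < k, T' x = T x) (hTk : T' k = A i) :
    MergeInv r w N A T' lo (i + 1) j (k + 1) := by
  obtain ⟨b, hb⟩ := h.aligned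
  have hc := h.count
  have hj := h.le_j
  have hli := h.le_i
  have hjl := h.j_le
  have hN := h.lo_le
  -- The pair with number `b` consists of the blocks with numbers 2b and 2b + 1.
  have hs1 : ∀ y, i < y → y < lo + w → ¬r (A y) (A i) := fun y h1 h2 =>
    hA (2 * b) i y (by rw [hb] at hli; linarith) h1 (by rw [hb] at h2; linarith) (by omega)
  have hs2 : ∀ y, j < y → y < lo + (w + w) → ¬r (A y) (A j) := fun y h1 h2 =>
    hA (2 * b + 1) j y (by rw [hb] at hj; linarith) h1 (by rw [hb] at h2; linarith) (by omega)
  refine ⟨⟨b, hb⟩, hN, by omega, by omega, hj, hjl, by omega, ?_, ?_, ?_, ?_, ?_⟩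
  · intro c x y h1 h2 h3 h4
    rcases Nat.lt_succ_iff_lt_or_eq.1 h4 with h4 | rfl
    · rw [hT y h4, hT x (h2.trans h4)]
      exact h.sorted c x y h1 h2 h3 h4
    -- The only aligned double block that contains the position being filled is the current pair.
    · have := block_unique (k := y) (h1.trans h2.le) h3 (by rw [← hb]; omega)
        (by rw [← hb]; omega)
      subst this
      rw [hTk, hT x h2]
      exact h.le_left x (by omega) h2 i le_rfl hi
  · intro x h1 h2 y h3 h4
    rcases Nat.lt_succ_iff_lt_or_eq.1 h2 with h2 | rfl
    · rw [hT x h2]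
      exact h.le_left x h1 h2 y (by omega) h4
    · rw [hTk]
      exact hs1 y h3 h4
  · intro x h1 h2 y h3 h4
    rcases Nat.lt_succ_iff_lt_or_eq.1 h2 with h2 | rfl
    · rw [hT x h2]
      exact h.le_right x h1 h2 y h3 h4
    · rw [hTk]
      have hji : ¬r (A j) (A i) := fun h' => hij ⟨by omega, h'⟩
      rcases h3.eq_or_lt with rfl | h3
      · exact hji
      · exact ht _ _ _ hji (hs2 y h3 h4)
  · intro y hy
    rcases Nat.lt_succ_iff_lt_or_eq.1 hy with hy | rfl
    · obtain ⟨x, hx, he⟩ := h.left_mem y hy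
      exact ⟨x, by omega, (hT x hx).trans he⟩
    · exact ⟨k, by omega, hTk⟩
  · intro y hy hy'
    obtain ⟨x, hx, he⟩ := h.right_mem y hy hy'
    exact ⟨x, by omega, (hT x hx).trans he⟩

lemma MergeInv.takeRight (h : MergeInv r w N A T lo i j k)
    (ht : ∀ a b c, ¬r b a → ¬r c b → ¬r c a) (ha : ∀ a b, r a b → ¬r b a)
    (hA : SortedBlocks r w N A) (hk : k < lo + (w + w))
    (hij : ¬(i < lo + w ∧ ¬(j < lo + (w + w) ∧ r (A j) (A i))))
    (hT : ∀ x < k, T' x = T x) (hTk : T' k = A j) :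
    MergeInv r w N A T' lo i (j + 1) (k + 1) := by
  obtain ⟨b, hb⟩ := h.aligned
  have hc := h.count
  have hj := h.le_j
  have hli := h.le_i
  have hil := h.i_le
  have hN := h.lo_le
  have hs1 : ∀ y, i < y → y < lo + w → ¬r (A y) (A i) := fun y h1 h2 =>
    hA (2 * b) i y (by rw [hb] at hli; linarith) h1 (by rw [hb] at h2; linarith) (by omega)
  have hs2 : ∀ y, j < y → y < lo + (w + w) → ¬r (A y) (A j) := fun y h1 h2 =>
    hA (2 * b + 1) j y (by rw [hb] at hj; linarith) h1 (by rw [hb] at h2; linarith) (by omega)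
  have hjl : j < lo + (w + w) := by
    by_cases hi : i < lo + w
    · exact (not_not.1 fun h' => hij ⟨hi, h'⟩).1
    · omega
  refine ⟨⟨b, hb⟩, hN, by omega, by omega, by omega, hjl, by omega, ?_, ?_, ?_, ?_, ?_⟩
  · intro c x y h1 h2 h3 h4
    rcases Nat.lt_succ_iff_lt_or_eq.1 h4 with h4 | rfl
    · rw [hT y h4, hT x (h2.trans h4)]
      exact h.sorted c x y h1 h2 h3 h4
    · have := block_unique (k := y) (h1.trans h2.le) h3 (by rw [← hb]; omega)
        (by rw [← hb]; omega)
      subst this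
      rw [hTk, hT x h2]
      exact h.le_right x (by omega) h2 j le_rfl hjl
  · intro x h1 h2 y h3 h4
    rcases Nat.lt_succ_iff_lt_or_eq.1 h2 with h2 | rfl
    · rw [hT x h2]
      exact h.le_left x h1 h2 y h3 h4
    · rw [hTk]
      have hji : ¬r (A i) (A j) :=
        ha _ _ (not_not.1 fun h' => hij ⟨by omega, fun h'' => h' h''.2⟩)
      rcases h3.eq_or_lt with rfl | h3
      · exact hji
      · exact ht _ _ _ hji (hs1 y h3 h4)
  · intro x h1 h2 y h3 h4
    rcases Nat.lt_succ_iff_lt_or_eq.1 h2 with h2 | rfl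
    · rw [hT x h2]
      exact h.le_right x h1 h2 y (by omega) h4
    · rw [hTk]
      exact hs2 y h3 h4
  · intro y hy
    obtain ⟨x, hx, he⟩ := h.left_mem y hy
    exact ⟨x, by omega, (hT x hx).trans he⟩
  · intro y hy hy'
    rcases Nat.lt_succ_iff_lt_or_eq.1 hy' with hy' | rfl
    · obtain ⟨x, hx, he⟩ := h.right_mem y hy hy'
      exact ⟨x, by omega, (hT x hx).trans he⟩
    · exact ⟨k, by omega, hTk⟩

lemma MergeInv.surj (h : MergeInv r w N A T lo i j N) : ∀ y < N, ∃ x < N, T x = A y := by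
  have h1 := h.i_le
  have h2 := h.j_le
  have h3 := h.count
  have h4 := h.lo_le
  intro y hy
  by_cases hy' : y < i
  · exact h.left_mem y hy'
  · exact h.right_mem y (by omega) (by omega)

/-- A sorted permutation of the first `N` natural numbers, for an order for which those below
`n` precede the others, begins with a sorted permutation of the first `n`. -/
lemma SortedBlocks.prefix {n : ℕ} (h : SortedBlocks r N N A) (hs : ∀ v < N, ∃ x < N, A x = v)
    (hnN : n ≤ N) (hr : ∀ a b, a < n → n ≤ b → r a b) :
    (∀ v < n, ∃ x < n, A x = v) ∧ (∀ x < n, A x < n) ∧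
      ∀ x y, x < y → y < n → A x ≠ A y ∧ ¬r (A y) (A x) := by
  choose f hf hAf using hs
  have hlt : ∀ x < n, A x < n := by
    intro x hx
    by_contra hAx
    -- If an entry before position `n` were at least `n`, all `n` smaller values would have to stand
    -- before it.
    have : (Finset.univ : Finset (Fin n)).card ≤ (Finset.range x).card := by
      refine Finset.card_le_card_of_injOn (fun v => f v.1 (by omega)) ?_ ?_
      · intro v _
        simp only [Finset.coe_range, Set.mem_Iio]
        by_contra hxv
        have hv := hAf v.1 (by omega)
        rcases (not_lt.1 hxv).eq_or_lt with he | hl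
        · rw [← he] at hv
          omega
        · refine h 0 x _ (by omega) hl (by have := hf v.1 (by omega); omega) (hf _ _) ?_
          rw [hv]
          exact hr _ _ v.2 (by omega)
      · intro v _ v' _ he
        have h1 := hAf v.1 (by omega)
        rw [show f v.1 _ = f v'.1 _ from he, hAf] at h1
        exact Fin.ext h1.symm
    simp at this
    omega
  have hsurj : Function.Surjective fun x : Fin N => (if h : A x < N then ⟨A x, h⟩ else x : Fin N) := by
    intro v
    refine ⟨⟨f v v.2, hf v v.2⟩, ?_⟩
    simp [hAf]
  have hinj := Finite.injective_iff_surjective.2 hsurj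
  have hne : ∀ x y, x < y → y < n → A x ≠ A y := by
    intro x y hxy hy he
    have := @hinj ⟨x, by omega⟩ ⟨y, by omega⟩ (by
      have := hlt x (by omega)
      have := hlt y hy
      simp only
      rw [dif_pos (by omega), dif_pos (by omega)]
      exact Fin.ext he)
    simp at this
    omega
  refine ⟨fun v hv => ?_, hlt, fun x y hxy hy => ⟨hne x y hxy hy,
    h 0 x y (by omega) hxy (by omega) (by omega)⟩⟩
  have hsurj' : Function.Surjective fun x : Fin n => (⟨A x, hlt x x.2⟩ : Fin n) := by
    refine Finite.injective_iff_surjective.1 fun x y he => ?_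
    have he' : A x = A y := congrArg Fin.val he
    rcases lt_trichotomy x.1 y.1 with h1 | h1 | h1
    · exact absurd he' (hne _ _ h1 y.2)
    · exact Fin.ext h1
    · exact absurd he'.symm (hne _ _ h1 x.2)
  obtain ⟨x, hx⟩ := hsurj' ⟨v, hv⟩
  exact ⟨x, x.2, congrArg Fin.val hx⟩

end

end UniversalGuards

/-! ### Sorting on the real RAM -/

namespace RealRAM

noncomputable section

open UniversalGuards

/-- The point with index `a`. -/
def pt (s : State) (a : ℕ) : Plane := (s.real 0 a, s.real 1 a)

lemma pt_congr {s s' : State} (h : s'.real = s.real) : pt s' = pt s := by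
  funext a
  simp [pt, h]

/-- Lexicographic comparison of two points. -/
def lexTest (x y : NatExp) : Test :=
  .or (.realLt (.get 0 x) (.get 0 y))
    (.and (.not (.realLt (.get 0 y) (.get 0 x))) (.realLt (.get 1 x) (.get 1 y)))

lemma holds_lexTest {x y : NatExp} {s : State} :
    (lexTest x y).Holds s ↔ LexLt (pt s (x.eval s)) (pt s (y.eval s)) := by
  simp only [lexTest, Test.Holds, RealExp.eval, LexLt, pt]
  rcases lt_trichotomy (s.real 0 (x.eval s)) (s.real 0 (y.eval s)) with h | h | h
  · simp [h]
  · simp [h]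
  · simp [h, h.not_gt, h.ne']

lemma lexLt_iff {a b : Plane} : LexLt a b ↔ toLex a < toLex b := by
  rw [Prod.Lex.toLex_lt_toLex, LexLt]

/-- The lexicographic order of the points with index below `n`, which precede all other
indices. -/
def Precedes (s : State) (n a b : ℕ) : Prop := a < n ∧ (b < n → LexLt (pt s a) (pt s b))

/-- Sorting uses the negated relation as its weak order, since the padding indices are pairwise
incomparable. -/
lemma Precedes.not_trans {s : State} {n : ℕ} (a b c : ℕ) (h : ¬Precedes s n b a)
    (h' : ¬Precedes s n c b) : ¬Precedes s n c a := by
  simp only [Precedes, lexLt_iff, not_and, Classical.not_imp, not_lt] at *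
  intro hc
  obtain ⟨hb, h1⟩ := h' hc
  obtain ⟨ha, h2⟩ := h hb
  exact ⟨ha, h2.trans h1⟩

lemma Precedes.asymm {s : State} {n : ℕ} (a b : ℕ) (h : Precedes s n a b) :
    ¬Precedes s n b a := by
  simp only [Precedes, lexLt_iff] at *
  exact fun h' => lt_asymm (h.2 h'.1) (h'.2 h.1)

/-- The test of `Precedes`. -/
def precedesTest (x y : NatExp) : Test :=
  .and (.natLt x (var 0)) (.not (.and (.natLt y (var 0)) (.not (lexTest x y))))

lemma holds_precedesTest {x y : NatExp} {s : State} :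
    (precedesTest x y).Holds s ↔ Precedes s (s.nat 0 0) (x.eval s) (y.eval s) := by
  simp [precedesTest, Test.Holds, Precedes, holds_lexTest, NatExp.eval]

/-- Compute a power of two that is at least `var 0`. -/
def pad : Program :=
  .seq (assign 2 (.lit 1)) (.while (.natLt (var 2) (var 0)) (assign 2 (.add (var 2) (var 2))))

lemma runs_pad {s : State} :
    Runs pad s ((s.nat 0 0 + 1) * 30) fun s' => ∃ R, s'.nat 2 0 = 2 ^ R ∧ s.nat 0 0 ≤ 2 ^ R ∧
      (R = 0 ∨ 2 ^ (R - 1) < s.nat 0 0) := by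
  refine ((Runs.of_loopFree (Q := fun s' => s'.nat 2 0 = 1 ∧ s'.nat 0 = s.nat 0) rfl ?_).seq
    fun s₁ _ h₁ => Runs.while (fun k s' => (∃ R, s'.nat 2 0 = 2 ^ R ∧
      (R = 0 ∨ 2 ^ (R - 1) < s.nat 0 0)) ∧ s.nat 0 0 - s'.nat 2 0 = k) (k := s.nat 0 0 - 1)
      ?_ fun k s' hf hI hb => Runs.of_loopFree rfl ?_).mono ?_ ?_
  · refine ⟨by simp [Program.run, NatExp.eval], ?_⟩
    funext j
    simp [Program.run]
  · exact ⟨⟨0, by simp [h₁.1]⟩, by rw [h₁.1]⟩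
  · obtain ⟨⟨R, hR, hR'⟩, rfl⟩ := hI
    have h0 : s'.nat 0 = s.nat 0 := (hf.2 0 rfl).trans h₁.2
    simp only [Test.Holds, NatExp.eval, h0] at hb
    have hpos : 0 < 2 ^ R := by positivity
    simp only [Program.run, NatExp.eval, State.updateNat_nat, and_self, if_true]
    exact ⟨_, by omega, ⟨R + 1, by rw [hR, pow_succ]; ring, .inr (by simpa [← hR] using hb)⟩, rfl⟩
  · simp only [Program.bound, NatExp.cost, Test.cost]
    have := Nat.mul_le_mul_right 30 (show s.nat 0 0 - 1 + 1 ≤ s.nat 0 0 + 1 by omega)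
    omega
  · rintro s' hf ⟨⟨k, ⟨R, hR, hR'⟩, -⟩, hb⟩
    have h0 : s'.nat 0 = s.nat 0 := hf.2 0 rfl
    simp only [Test.Holds, NatExp.eval, h0] at hb
    exact ⟨R, hR, by omega, hR'⟩

/-- Begin with the next pair of blocks if the current one is exhausted. -/
def mergeReset : Program :=
  .ite (.natLt (var 7) (.add (var 4) (.add (var 3) (var 3)))) .skip
    (.seq (assign 4 (var 7)) (.seq (assign 5 (var 7)) (assign 6 (.add (var 7) (var 3)))))

/-- Append the smaller one of the next entries of the two blocks. -/
def mergeTake : Program :=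
  .seq (.ite (.and (.natLt (var 5) (.add (var 4) (var 3)))
      (.not (.and (.natLt (var 6) (.add (var 4) (.add (var 3) (var 3))))
        (precedesTest (.get 8 (var 6)) (.get 8 (var 5))))))
    (.seq (.setNat 9 (var 7) (.get 8 (var 5))) (assign 5 (.add (var 5) (.lit 1))))
    (.seq (.setNat 9 (var 7) (.get 8 (var 6))) (assign 6 (.add (var 6) (.lit 1)))))
  (assign 7 (.add (var 7) (.lit 1)))

/-- The time to append one entry. -/
def mergeCost : ℕ := mergeReset.bound + mergeTake.bound

/-- Merge the blocks of length `var 3` of the array `8` in pairs. -/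
def mergePass : Program :=
  .seq (.seq (assign 4 (.lit 0)) (.seq (assign 5 (.lit 0)) (.seq (assign 6 (var 3))
    (assign 7 (.lit 0)))))
  (.seq (.while (.natLt (var 7) (var 2)) (.seq mergeReset mergeTake)) (fill 8 2 (.get 9 (var 7))))

lemma runs_mergePass {s : State} {n N w : ℕ} (hn : s.nat 0 0 = n) (hN : s.nat 2 0 = N)
    (hw : s.nat 3 0 = w) (hN0 : 0 < N) (hB : ∃ B, N = (w + w) * B)
    (hA : SortedBlocks (Precedes s n) w N (s.nat 8)) :
    Runs mergePass s ((N + 1) * (mergeCost + 60)) fun s' =>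
      SortedBlocks (Precedes s n) (w + w) N (s'.nat 8) ∧
      ∀ y < N, ∃ x < N, s'.nat 8 x = s.nat 8 y := by
  have hww : w + w ≤ N := by
    obtain ⟨B, rfl⟩ := hB
    exact Nat.le_mul_of_pos_right _ (Nat.pos_of_mul_pos_left hN0)
  refine Runs.le (Runs.seq (Runs.of_loopFree (Q := fun s' => s'.nat 4 0 = 0 ∧ s'.nat 5 0 = 0 ∧
    s'.nat 6 0 = w ∧ s'.nat 7 0 = 0) rfl ?_) fun s₁ hf₁ h₁ => Runs.seq (Runs.while
      (c := mergeCost) (fun k s' => s'.nat 7 0 + k = N ∧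
      MergeInv (Precedes s n) w N (s.nat 8) (s'.nat 9) (s'.nat 4 0) (s'.nat 5 0) (s'.nat 6 0)
        (s'.nat 7 0)) (k := N) ?_ ?_) fun s₂ hf₂ h₂ =>
      Runs.mono (runs_fill (f := s₂.nat 9) (L := N) ?_ ?_ ?_) le_rfl ?_) ?_
  · simp [Program.run, NatExp.eval, hw]
  · obtain ⟨h4, h5, h6, h7⟩ := h₁
    rw [h4, h5, h6, h7]
    exact ⟨by omega, MergeInv.init hww⟩
  · intro k s' hf hI hb
    have h8 : s'.nat 8 = s.nat 8 := (hf.2 8 rfl).trans (hf₁.2 8 rfl)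
    have h2 : s'.nat 2 = s.nat 2 := (hf.2 2 rfl).trans (hf₁.2 2 rfl)
    have h3 : s'.nat 3 = s.nat 3 := (hf.2 3 rfl).trans (hf₁.2 3 rfl)
    have h0 : s'.nat 0 = s.nat 0 := (hf.2 0 rfl).trans (hf₁.2 0 rfl)
    have hr : s'.real = s.real := (hf.1 rfl).trans (hf₁.1 rfl)
    simp only [Test.Holds, NatExp.eval, h2, hN] at hb
    refine (Runs.of_loopFree (P := mergeReset) (Q := fun t => t.nat 7 0 = s'.nat 7 0 ∧
      t.nat 7 0 < t.nat 4 0 + (w + w) ∧ MergeInv (Precedes s n) w N (s.nat 8) (t.nat 9)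
        (t.nat 4 0) (t.nat 5 0) (t.nat 6 0) (t.nat 7 0)) rfl ?_).seq fun t hft ht =>
      Runs.of_loopFree (P := mergeTake) rfl ?_
    · by_cases hc : s'.nat 7 0 < s'.nat 4 0 + (w + w)
      · simp only [mergeReset, Program.run, Test.Holds, NatExp.eval, h3, hw, hc, if_true]
        exact ⟨trivial, trivial, hI.2⟩
      · have := hI.2.reset hc hb hB
        have : 0 < w := by obtain ⟨B, rfl⟩ := hB; by_contra h; simp_all
        simp [mergeReset, Program.run, Test.Holds, NatExp.eval, h3, hw, hc]
        exact ⟨this, by assumption⟩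
    · have h8' : t.nat 8 = s.nat 8 := (hft.2 8 rfl).trans h8
      have h2' : t.nat 2 = s.nat 2 := (hft.2 2 rfl).trans h2
      have h3' : t.nat 3 = s.nat 3 := (hft.2 3 rfl).trans h3
      have h0' : t.nat 0 = s.nat 0 := (hft.2 0 rfl).trans h0
      have hr' : t.real = s.real := (hft.1 rfl).trans hr
      obtain ⟨e7, hk, hM⟩ := ht
      have hpre : ∀ a b, Precedes t n a b ↔ Precedes s n a b := fun a b => by
        simp [Precedes, pt_congr hr']
      refine ⟨k - 1, by omega, ?_⟩
      by_cases hc : t.nat 5 0 < t.nat 4 0 + w ∧ ¬(t.nat 6 0 < t.nat 4 0 + (w + w) ∧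
        Precedes s n (s.nat 8 (t.nat 6 0)) (s.nat 8 (t.nat 5 0)))
      · have hi := hM.takeLeft Precedes.not_trans hA hc.1 hc.2
          (T' := Function.update (t.nat 9) (t.nat 7 0) (s.nat 8 (t.nat 5 0)))
          (fun x hx => Function.update_of_ne hx.ne _ _) (Function.update_self ..)
        have e9 : Function.update (t.nat 9) (t.nat 7 0) (s.nat 8 (t.nat 5 0)) =
          fun j => if j = t.nat 7 0 then s.nat 8 (t.nat 5 0) else t.nat 9 j := by
          funext j; simp [Function.update_apply]
        rw [e9] at hi
        have hc' : (Test.and (.natLt (var 5) (.add (var 4) (var 3)))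
          (.not (.and (.natLt (var 6) (.add (var 4) (.add (var 3) (var 3))))
          (precedesTest (.get 8 (var 6)) (.get 8 (var 5)))))).Holds t := by
          simpa only [Test.Holds, holds_precedesTest, NatExp.eval, h3', hw, h0', hn, hpre, h8']
            using hc
        simp only [mergeTake, Program.run, if_pos hc']
        refine ⟨?_, ?_⟩
        · simp [NatExp.eval]; omega
        · convert hi using 1 <;> [funext j; skip; skip; skip; skip] <;> simp [NatExp.eval, h8']
      · have hi := hM.takeRight Precedes.not_trans Precedes.asymm hA hk hc
          (T' := Function.update (t.nat 9) (t.nat 7 0) (s.nat 8 (t.nat 6 0)))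
          (fun x hx => Function.update_of_ne hx.ne _ _) (Function.update_self ..)
        have e9 : Function.update (t.nat 9) (t.nat 7 0) (s.nat 8 (t.nat 6 0)) =
          fun j => if j = t.nat 7 0 then s.nat 8 (t.nat 6 0) else t.nat 9 j := by
          funext j; simp [Function.update_apply]
        rw [e9] at hi
        have hc' : ¬(Test.and (.natLt (var 5) (.add (var 4) (var 3)))
          (.not (.and (.natLt (var 6) (.add (var 4) (.add (var 3) (var 3))))
          (precedesTest (.get 8 (var 6)) (.get 8 (var 5)))))).Holds t := by
          simpa only [Test.Holds, holds_precedesTest, NatExp.eval, h3', hw, h0', hn, hpre, h8']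
            using hc
        simp only [mergeTake, Program.run, if_neg hc']
        refine ⟨?_, ?_⟩
        · simp [NatExp.eval]; omega
        · convert hi using 1 <;> [funext j; skip; skip; skip; skip] <;> simp [NatExp.eval, h8']
  · rw [hf₂.2 2 rfl, hf₁.2 2 rfl, hN]
  · decide
  · intro s' _ h
    simp [NatExp.eval, h 9 (by decide) (by decide)]
  · intro s' hf h
    obtain ⟨⟨k, hk, hM⟩, hb⟩ := h₂
    simp only [Test.Holds, NatExp.eval, hf₂.2 2 rfl, hf₁.2 2 rfl, hN] at hb
    rw [show s₂.nat 7 0 = N by omega] at hM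
    refine ⟨fun b x y h1 h2 h3 h4 => ?_, fun y hy => ?_⟩
    · rw [h, h, if_pos h4, if_pos (h2.trans h4)]
      exact hM.sorted b x y h1 h2 h3 h4
    · obtain ⟨x, hx, he⟩ := hM.surj y hy
      exact ⟨x, hx, by rw [h, if_pos hx, he]⟩
  · simp only [Program.bound, NatExp.cost, Test.cost]
    nlinarith

/-- Sort the indices below `var 0` by their points, into the array `8`. -/
def sort : Program :=
  .seq pad (.seq (fill 8 2 (var 7)) (.seq (assign 3 (.lit 1))
    (.while (.natLt (var 3) (var 2)) (.seq mergePass (assign 3 (.add (var 3) (var 3)))))))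

/-- The first `n` entries of `A` are the numbers below `n`, sorted by their points. -/
structure IsSorted (s : State) (n : ℕ) (A : ℕ → ℕ) : Prop where
  surj : ∀ v < n, ∃ x < n, A x = v
  lt : ∀ x < n, A x < n
  lex : ∀ x y, x < y → y < n → LexLt (pt s (A x)) (pt s (A y))

/-- The padded length is at most 2n, so there are at most `Nat.log 2 n + 1` passes of linear cost.
Padding by indices without points comes last in the order and makes all blocks complete. -/
lemma runs_sort {s : State} {n : ℕ} (hn : s.nat 0 0 = n) (hn0 : 0 < n)
    (hp : ∀ a < n, ∀ b < n, pt s a = pt s b → a = b) :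
    Runs sort s ((2 * mergeCost + 300) *
      ((n + 1) * (Nat.log 2 n + 2))) fun s' => IsSorted s n (s'.nat 8) := by
  refine Runs.le (Runs.seq runs_pad fun s₁ hf₁ h₁ => Runs.seq (c := (2 * n + 1) * 30)
    (Q := fun s' => s'.nat 8 = fun j => if j < s₁.nat 2 0 then j else s₁.nat 8 j)
    (Runs.le (Runs.mono (runs_fill (f := fun j => j) (L := s₁.nat 2 0) ?_ ?_ ?_) le_rfl ?_) ?_)
    fun s₂ hf₂ h₂ => Runs.seq (Runs.of_loopFree (Q := fun s' => s'.nat 3 0 = 1) rfl ?_)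
      fun s₃ hf₃ h₃ => Runs.mono (Runs.while
      (c := (2 * n + 1) * (mergeCost + 60) + 10) (fun k s' =>
        ∃ r, s'.nat 3 0 = 2 ^ r ∧ r + k = Nat.log 2 n + 1 ∧ 2 ^ r ≤ s₁.nat 2 0 ∧
        SortedBlocks (Precedes s n) (2 ^ r) (s₁.nat 2 0) (s'.nat 8) ∧
        ∀ v < s₁.nat 2 0, ∃ x < s₁.nat 2 0, s'.nat 8 x = v) (k := Nat.log 2 n + 1)
      ?_ ?_) le_rfl ?_) ?_
  · rfl
  · decide
  · intro s' _ _
    rfl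
  · intro s' _ h
    exact funext h
  · obtain ⟨R, h1, h2, h3⟩ := h₁
    have hN : s₁.nat 2 0 ≤ 2 * n := by
      rcases h3 with rfl | h3
      · rw [h1, pow_zero]; omega
      · rcases R with _ | R
        · rw [h1, pow_zero]; omega
        · rw [h1, pow_succ]
          simp only [Nat.add_sub_cancel, hn] at h3
          omega
    simp only [NatExp.cost]
    have := Nat.mul_le_mul_right 22 (show s₁.nat 2 0 + 1 ≤ 2 * n + 1 by omega)
    omega
  · simp [Program.run, NatExp.eval]
  · obtain ⟨R, h1, h2, h3⟩ := h₁
    have h8 : s₃.nat 8 = fun j => if j < s₁.nat 2 0 then j else s₁.nat 8 j :=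
      (hf₃.2 8 rfl).trans h₂
    refine ⟨0, h₃, by omega, by rw [h1]; exact Nat.one_le_two_pow, ?_, ?_⟩
    · intro b x y h1 h2 h3
      simp only [pow_zero] at h1 h3
      omega
    · intro v hv
      exact ⟨v, hv, by rw [h8]; simp [hv]⟩
  · rintro k s' hf ⟨r, e3, hrk, hrN, hS, hs⟩ hb
    obtain ⟨R, h1, h2, h3⟩ := h₁
    have e2 : s'.nat 2 0 = s₁.nat 2 0 := by rw [hf.2 2 rfl, hf₃.2 2 rfl, hf₂.2 2 rfl]
    have e0 : s'.nat 0 0 = n := by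
      rw [hf.2 0 rfl, hf₃.2 0 rfl, hf₂.2 0 rfl, hf₁.2 0 rfl, hn]
    have er : s'.real = s.real :=
      (hf.1 rfl).trans ((hf₃.1 rfl).trans ((hf₂.1 rfl).trans (hf₁.1 rfl)))
    have hpre : Precedes s' n = Precedes s n := by
      funext a b
      simp [Precedes, pt_congr er]
    simp only [Test.Holds, NatExp.eval, e2, e3, h1] at hb
    have hrR : r < R := (Nat.pow_lt_pow_iff_right (by norm_num)).1 hb
    have hN : s₁.nat 2 0 ≤ 2 * n ∧ R ≤ Nat.log 2 n + 1 := by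
      rcases h3 with rfl | h3
      · omega
      · rcases R with _ | R
        · omega
        · simp only [Nat.add_sub_cancel, hn] at h3
          have := (Nat.le_log_iff_pow_le (by norm_num) hn0.ne').2 h3.le
          rw [h1, pow_succ]
          omega
    have hsplit : s₁.nat 2 0 = (2 ^ r + 2 ^ r) * 2 ^ (R - (r + 1)) := by
      rw [h1, ← mul_two, ← pow_succ, ← pow_add]
      congr 1
      omega
    have hpos : 0 < s₁.nat 2 0 := by rw [h1]; positivity
    refine Runs.le (Runs.seq (runs_mergePass e0 e2 e3 hpos ⟨_, hsplit⟩ (by rwa [hpre]))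
      fun t hft ht => Runs.of_loopFree rfl ⟨k - 1, by omega, r + 1, ?_, by omega, ?_, ?_, ?_⟩) ?_
    · simp [Program.run, NatExp.eval, hft.2 3 rfl, e3, pow_succ, mul_two]
    · rw [h1]
      exact Nat.pow_le_pow_right (by norm_num) hrR
    · rw [Program.run, State.updateNat_nat_of_ne _ _ _ _ (by decide), pow_succ, mul_two, ← hpre]
      exact ht.1
    · intro v hv
      obtain ⟨y, hy, rfl⟩ := hs v hv
      obtain ⟨x, hx, he⟩ := ht.2 y hy
      exact ⟨x, hx, by simpa [Program.run] using he⟩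
    · have := Nat.mul_le_mul_right (mergeCost + 60)
        (show s₁.nat 2 0 + 1 ≤ 2 * n + 1 by omega)
      simp only [Program.bound, NatExp.cost]
      omega
  · rintro s' hf ⟨⟨k, r, e3, -, hrN, hS, hs⟩, hb⟩
    obtain ⟨R, h1, h2, h3⟩ := h₁
    have e2 : s'.nat 2 0 = s₁.nat 2 0 := by rw [hf.2 2 rfl, hf₃.2 2 rfl, hf₂.2 2 rfl]
    simp only [Test.Holds, NatExp.eval, e2, e3, not_lt] at hb
    rw [le_antisymm hrN hb] at hS
    obtain ⟨g1, g2, g3⟩ := hS.prefix hs (by rw [h1]; omega) fun a b ha hb =>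
      ⟨ha, fun h => by omega⟩
    refine ⟨g1, g2, fun x y hxy hy => ?_⟩
    obtain ⟨g4, g5⟩ := g3 x y hxy hy
    refine lexLt_of_not (fun he => g4 (hp _ (g2 x (by omega)) _ (g2 y hy) he)) fun h => g5 ?_
    exact ⟨g2 y hy, fun _ => h⟩
  · rw [hn]
    simp only [Program.bound, NatExp.cost, Test.cost]
    generalize mergeCost = a
    generalize Nat.log 2 n = l
    have h1 : (n + 1) * 2 ≤ (n + 1) * (l + 2) := Nat.mul_le_mul_left _ (by omega)
    have h2 : (2 * n + 1) * (l + 2) ≤ 2 * ((n + 1) * (l + 2)) := by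
      rw [← mul_assoc]; exact Nat.mul_le_mul_right _ (by omega)
    have h3 : l + 2 ≤ (n + 1) * (l + 2) := Nat.le_mul_of_pos_left _ (by omega)
    generalize (n + 1) * (l + 2) = p at *
    have h4 := Nat.mul_le_mul_right (a + 60) h2
    generalize hq : (2 * n + 1) * (l + 2) = q at *
    have h5 : (l + 1 + 1) * ((2 * n + 1) * (a + 60) + 10 + (1 + 1 + (1 + 1) + 1) + 1) =
        q * (a + 60) + (l + 2) * 16 := by
      rw [← hq]; ring
    rw [h5]
    have h6 : 2 * p * (a + 60) = 2 * a * p + 120 * p := by ring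
    have h7 : (2 * a + 300) * p = 2 * a * p + 300 * p := by ring
    omega

end

end RealRAM

/-! ### Scanning on the real RAM -/

namespace UniversalGuards

lemma IsScan.congr {u : Plane} {Q Q' : ℕ → Plane} {m len : ℕ} {c c' : ℕ → Plane}
    (h : IsScan u Q m len c) (hQ : ∀ k < m, Q' k = Q k) (hc : ∀ j < len, c' j = c j) :
    IsScan u Q' m len c' where
  pos := h.pos
  len_le := h.len_le
  mem j hj := by
    obtain ⟨k, hk, he⟩ := h.mem j hj
    exact ⟨k, hk, by rw [hc j hj, he, hQ k hk]⟩
  lt j hj := by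
    rw [hc _ hj, hc _ (by omega)]
    exact h.lt j hj
  below j hj k hk := by
    rw [hc _ hj, hc _ (by omega), hQ k hk]
    exact h.below j hj k hk
  first := by rw [hc 0 h.pos, hQ 0 (h.pos.trans_le h.len_le), h.first]
  last := by
    have := h.pos
    have := h.len_le
    rw [hc _ (by omega), hQ _ (by omega), h.last]
  popped k hk := by
    rw [hQ k hk]
    rcases h.popped k hk with ⟨j, hj, he⟩ | ⟨a, b, h1, h2, h3, h4⟩
    · exact .inl ⟨j, hj, by rw [hc j hj, he]⟩
    · exact .inr ⟨a, b, h1, h2, h3, by rwa [hQ a (by omega), hQ b h3]⟩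

end UniversalGuards

namespace RealRAM

noncomputable section

open UniversalGuards

/-- Test whether the points with indices `x`, `y`, `z` form a left turn. -/
def leftTest (x y z : NatExp) : Test :=
  .realLt (.lit 0) (.sub
    (.mul (.sub (.get 0 y) (.get 0 x)) (.sub (.get 1 z) (.get 1 x)))
    (.mul (.sub (.get 1 y) (.get 1 x)) (.sub (.get 0 z) (.get 0 x))))

lemma holds_leftTest {x y z : NatExp} {s : State} :
    (leftTest x y z).Holds s ↔
      0 < orient (pt s (x.eval s)) (pt s (y.eval s)) (pt s (z.eval s)) := by
  simp [leftTest, Test.Holds, RealExp.eval, pt, orient]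

/-- Whether the last entry of the stack `12` has to be removed. -/
def popTest : Test :=
  .and (.natLt (.lit 1) (var 13)) (leftTest (.get 12 (.sub (var 13) (.lit 2)))
    (.get 12 (.sub (var 13) (.lit 1))) (.get 11 (var 5)))

/-- Remove the last entry of the stack `12`, or append the next entry of the array `11`. -/
def scanStep : Program :=
  .ite popTest (assign 13 (.sub (var 13) (.lit 1)))
    (.seq (.setNat 12 (var 13) (.get 11 (var 5)))
      (.seq (assign 13 (.add (var 13) (.lit 1))) (assign 5 (.add (var 5) (.lit 1)))))

/-- Compute the chain of the points with indices in the array `11`, of length `var 10`, in the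
array `12`, of length `var 13`. -/
def scan : Program :=
  .seq (.seq (assign 5 (.lit 0)) (assign 13 (.lit 0)))
    (.while (.natLt (var 5) (var 10)) scanStep)

/-- The loop is measured by twice the number of unread points plus the height of the stack, which a
push and a pop each lower by one; hence linear time. -/
lemma runs_scan {s : State} {m : ℕ} {u : Plane} (hm : s.nat 10 0 = m) (hm0 : 0 < m)
    (hQ : ∀ a b, a < b → b < m → lin u (pt s (s.nat 11 a)) < lin u (pt s (s.nat 11 b))) :
    Runs scan s ((m + 1) * (2 * scanStep.bound + 20)) fun s' =>
      IsScan u (fun k => pt s (s.nat 11 k)) m (s'.nat 13 0) (fun j => pt s (s'.nat 12 j)) ∧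
      ∀ j < s'.nat 13 0, ∃ k < m, s'.nat 12 j = s.nat 11 k := by
  refine Runs.le (Runs.seq (Runs.of_loopFree (Q := fun s' => s'.nat 5 0 = 0 ∧ s'.nat 13 0 = 0)
    rfl ?_) fun s₁ hf₁ h₁ => Runs.mono (Runs.while (c := scanStep.bound) (fun k s' =>
      k = 2 * (m - s'.nat 5 0) + s'.nat 13 0 ∧
      ScanInv u (fun k => pt s (s.nat 11 k)) m (s'.nat 5 0) (s'.nat 13 0)
        (fun j => pt s (s'.nat 12 j)) ∧
      ∀ j < s'.nat 13 0, ∃ k < m, s'.nat 12 j = s.nat 11 k) (k := 2 * m) ?_ ?_) le_rfl ?_) ?_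
  · simp [Program.run, NatExp.eval]
  · rw [h₁.1, h₁.2]
    exact ⟨by omega, ScanInv.init hm0, by omega⟩
  · rintro k s' hf ⟨hk, hI, hidx⟩ hb
    have e10 : s'.nat 10 0 = m := by rw [hf.2 10 rfl, hf₁.2 10 rfl, hm]
    have e11 : s'.nat 11 = s.nat 11 := (hf.2 11 rfl).trans (hf₁.2 11 rfl)
    have er : pt s' = pt s := pt_congr ((hf.1 rfl).trans (hf₁.1 rfl))
    simp only [Test.Holds, NatExp.eval, e10] at hb
    refine Runs.of_loopFree rfl ?_
    have htest : popTest.Holds s' ↔ 1 < s'.nat 13 0 ∧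
        0 < orient (pt s (s'.nat 12 (s'.nat 13 0 - 2))) (pt s (s'.nat 12 (s'.nat 13 0 - 1)))
          (pt s (s.nat 11 (s'.nat 5 0))) := by
      simp only [popTest, Test.Holds, holds_leftTest, NatExp.eval, e11, er]
    by_cases hc : popTest.Holds s'
    · rw [scanStep, Program.run, if_pos hc]
      rw [htest] at hc
      refine ⟨k - 1, by omega, ?_⟩
      have := hI.pop hQ hb hc.1 hc.2
      simp only [Program.run, NatExp.eval]
      simp only [State.updateNat_nat, Nat.reduceEqDiff, false_and, if_false, and_self, if_true]
      exact ⟨by omega, this, fun j hj => hidx j (by omega)⟩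
    · rw [scanStep, Program.run, if_neg hc]
      rw [htest] at hc
      refine ⟨k - 1, by omega, ?_⟩
      have := hI.push hQ hb (fun h => not_lt.1 fun h' => hc ⟨by omega, h'⟩)
        (c' := fun j => pt s (if j = s'.nat 13 0 then s.nat 11 (s'.nat 5 0) else s'.nat 12 j))
        (fun j hj => by simp [hj.ne]) (by simp)
      simp only [Program.run, NatExp.eval, State.updateNat_nat, e11]
      simp only [Nat.reduceEqDiff, false_and, if_false, and_self, if_true,
        true_and]
      refine ⟨by omega, this, fun j hj => ?_⟩
      by_cases hj' : j = s'.nat 13 0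
      · exact ⟨_, hb, by simp [hj']⟩
      · simpa [hj'] using hidx j (by omega)
  · rintro s' hf ⟨⟨k, hk, hI, hidx⟩, hb⟩
    have e10 : s'.nat 10 0 = m := by rw [hf.2 10 rfl, hf₁.2 10 rfl, hm]
    simp only [Test.Holds, NatExp.eval, e10] at hb
    rw [show s'.nat 5 0 = m from le_antisymm hI.i_le (not_lt.1 hb)] at hI
    exact ⟨hI.isScan hm0, hidx⟩
  · simp only [Program.bound, NatExp.cost, Test.cost]
    nlinarith

/-- Compute the two chains of the points with indices in the array `8`, of length `var 10`, in
the arrays `14` and `12`, of length `var 15` and `var 13`. -/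
def scanBoth : Program :=
  .seq (fill 11 10 (.get 8 (var 7))) (.seq scan (.seq (fill 14 13 (.get 12 (var 7)))
    (.seq (assign 15 (var 13)) (.seq (fill 11 10 (.get 8 (.sub (.sub (var 10) (.lit 1)) (var 7))))
      scan))))

lemma runs_scanBoth {s : State} {m : ℕ} {u : Plane} (hm : s.nat 10 0 = m) (hm0 : 0 < m)
    (hQ : ∀ a b, a < b → b < m → lin u (pt s (s.nat 8 a)) < lin u (pt s (s.nat 8 b))) :
    Runs scanBoth s ((m + 1) * (4 * scanStep.bound + 200)) fun s' =>
      IsScan u (fun k => pt s (s.nat 8 k)) m (s'.nat 15 0) (fun j => pt s (s'.nat 14 j)) ∧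
      IsScan (-u) (fun k => pt s (s.nat 8 (m - 1 - k))) m (s'.nat 13 0)
        (fun j => pt s (s'.nat 12 j)) ∧
      (∀ j < s'.nat 15 0, ∃ k < m, s'.nat 14 j = s.nat 8 k) ∧
      ∀ j < s'.nat 13 0, ∃ k < m, s'.nat 12 j = s.nat 8 k := by
  refine Runs.le (Runs.seq
    (Q := fun s' => ∀ j, s'.nat 11 j = if j < m then s.nat 8 j else s.nat 11 j)
    (runs_fill hm ?_ ?_) fun s₁ hf₁ h₁ => Runs.seq
    (Q := fun s' =>
      IsScan u (fun k => pt s (s.nat 8 k)) m (s'.nat 13 0) (fun j => pt s (s'.nat 12 j)) ∧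
      ∀ j < s'.nat 13 0, ∃ k < m, s'.nat 12 j = s.nat 8 k)
    (Runs.mono (runs_scan (m := m) (u := u) ?_ hm0 ?_) le_rfl ?_) fun s₂ hf₂ h₂ => Runs.seq
    (Q := fun s' => ∀ j < s₂.nat 13 0, s'.nat 14 j = s₂.nat 12 j) (c := (m + 1) * 30)
    (Runs.mono (runs_fill (f := s₂.nat 12) rfl ?_ ?_) ?_ ?_) fun s₃ hf₃ h₃ => Runs.seq
    (Runs.of_loopFree (Q := fun s' => s'.nat 15 0 = s₃.nat 13 0) rfl ?_) fun s₄ hf₄ h₄ =>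
    Runs.seq (Q := fun s' => ∀ j < m, s'.nat 11 j = s.nat 8 (m - 1 - j))
    (Runs.mono (runs_fill (f := fun j => s.nat 8 (m - 1 - j)) (L := m) ?_ ?_ ?_) le_rfl ?_)
    fun s₅ hf₅ h₅ => Runs.mono (runs_scan (m := m) (u := -u) ?_ hm0 ?_) le_rfl ?_) ?_
  · decide
  · intro s' _ h
    simp [NatExp.eval, h 8 (by decide) (by decide)]
  · rw [hf₁.2 10 rfl, hm]
  · intro a b hab hb
    rw [pt_congr (hf₁.1 rfl), h₁, h₁, if_pos hb, if_pos (hab.trans hb)]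
    exact hQ a b hab hb
  · rintro s' hf ⟨h1, h2⟩
    rw [pt_congr (hf₁.1 rfl)] at h1
    refine ⟨h1.congr (fun k hk => ?_) fun _ _ => rfl, fun j hj => ?_⟩
    · rw [h₁, if_pos hk]
    · obtain ⟨k, hk, he⟩ := h2 j hj
      rw [h₁, if_pos hk] at he
      exact ⟨k, hk, he⟩
  · decide
  · intro s' _ h
    simp [NatExp.eval, h 12 (by decide) (by decide)]
  · have := h₂.1.len_le
    exact Nat.mul_le_mul (by omega) (by simp [NatExp.cost])
  · intro s' _ h j hj
    rw [h, if_pos hj]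
  · simp [Program.run, NatExp.eval]
  · rw [hf₄.2 10 rfl, hf₃.2 10 rfl, hf₂.2 10 rfl, hf₁.2 10 rfl, hm]
  · decide
  · intro s' _ h
    simp only [NatExp.eval]
    rw [h 8 (by decide) (by decide), h 10 (by decide) (by decide), hf₄.2 8 rfl, hf₃.2 8 rfl,
      hf₂.2 8 rfl, hf₁.2 8 rfl, hf₄.2 10 rfl, hf₃.2 10 rfl, hf₂.2 10 rfl, hf₁.2 10 rfl, hm]
  · intro s' _ h j hj
    rw [h, if_pos hj]
  · rw [hf₅.2 10 rfl, hf₄.2 10 rfl, hf₃.2 10 rfl, hf₂.2 10 rfl, hf₁.2 10 rfl, hm]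
  · intro a b hab hb
    have er : s₅.real = s.real := (hf₅.1 rfl).trans ((hf₄.1 rfl).trans ((hf₃.1 rfl).trans
      ((hf₂.1 rfl).trans (hf₁.1 rfl))))
    rw [pt_congr er, h₅ b hb, h₅ a (hab.trans hb), lin_neg, lin_neg, neg_lt_neg_iff]
    exact hQ _ _ (by omega) (by omega)
  · rintro s' hf ⟨h1, h2⟩
    have er : s₅.real = s.real := (hf₅.1 rfl).trans ((hf₄.1 rfl).trans ((hf₃.1 rfl).trans
      ((hf₂.1 rfl).trans (hf₁.1 rfl))))
    have e15 : s'.nat 15 0 = s₂.nat 13 0 := by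
      rw [hf.2 15 rfl, hf₅.2 15 rfl, h₄, hf₃.2 13 rfl]
    have e14 : ∀ j < s₂.nat 13 0, s'.nat 14 j = s₂.nat 12 j := fun j hj => by
      rw [hf.2 14 rfl, hf₅.2 14 rfl, hf₄.2 14 rfl, h₃ j hj]
    rw [pt_congr er] at h1
    rw [e15]
    refine ⟨h₂.1.congr (fun _ _ => rfl) fun j hj => ?_, h1.congr (fun k hk => ?_)
      fun _ _ => rfl, fun j hj => ?_, fun j hj => ?_⟩
    · rw [e14 j hj]
    · rw [h₅ k hk]
    · rw [e14 j hj]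
      exact h₂.2 j hj
    · obtain ⟨k, hk, he⟩ := h2 j hj
      rw [h₅ k hk] at he
      exact ⟨_, by omega, he⟩
  · simp only [Program.bound, NatExp.cost]
    generalize scanStep.bound = a
    nlinarith

end

end RealRAM

/-! ### Splitting a list of indices -/

namespace RealRAM

noncomputable section

open UniversalGuards

/-- The first `n` entries of `a` are split, in order, into `m` unmarked entries `A` and `p`
marked entries `B`. -/
structure IsSplit (a M : ℕ → ℕ) (n m p : ℕ) (A B : ℕ → ℕ) : Prop where
  mem : ∀ j < m, ∃ k < n, A j = a k ∧ M (a k) < 1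
  order : ∀ i j, i < j → j < m → ∃ k l, k < l ∧ l < n ∧ A i = a k ∧ A j = a l
  surj : ∀ k < n, M (a k) < 1 → ∃ j < m, A j = a k
  mem' : ∀ j < p, ∃ k < n, B j = a k ∧ ¬M (a k) < 1
  surj' : ∀ k < n, ¬M (a k) < 1 → ∃ j < p, B j = a k
  total : m + p = n

lemma IsSplit.unmarked {a M : ℕ → ℕ} {n m p : ℕ} {A B A' : ℕ → ℕ} (h : IsSplit a M n m p A B)
    (hM : M (a n) < 1) (h1 : ∀ j < m, A' j = A j) (h2 : A' m = a n) :
    IsSplit a M (n + 1) (m + 1) p A' B where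
  mem j hj := by
    rcases Nat.lt_succ_iff_lt_or_eq.1 hj with hj | rfl
    · obtain ⟨k, hk, he, hk'⟩ := h.mem j hj
      exact ⟨k, by omega, (h1 j hj).trans he, hk'⟩
    · exact ⟨n, by omega, h2, hM⟩
  order i j hij hj := by
    rcases Nat.lt_succ_iff_lt_or_eq.1 hj with hj | rfl
    · obtain ⟨k, l, hkl, hl, e1, e2⟩ := h.order i j hij hj
      exact ⟨k, l, hkl, by omega, (h1 i (hij.trans hj)).trans e1, (h1 j hj).trans e2⟩
    · obtain ⟨k, hk, he, -⟩ := h.mem i hij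
      exact ⟨k, n, hk, by omega, (h1 i hij).trans he, h2⟩
  surj k hk hk' := by
    rcases Nat.lt_succ_iff_lt_or_eq.1 hk with hk | rfl
    · obtain ⟨j, hj, he⟩ := h.surj k hk hk'
      exact ⟨j, by omega, (h1 j hj).trans he⟩
    · exact ⟨m, by omega, h2⟩
  mem' j hj := by
    obtain ⟨k, hk, he⟩ := h.mem' j hj
    exact ⟨k, by omega, he⟩
  surj' k hk hk' := by
    rcases Nat.lt_succ_iff_lt_or_eq.1 hk with hk | rfl
    · exact h.surj' k hk hk'
    · exact absurd hM hk'
  total := by have := h.total; omega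

lemma IsSplit.marked {a M : ℕ → ℕ} {n m p : ℕ} {A B B' : ℕ → ℕ} (h : IsSplit a M n m p A B)
    (hM : ¬M (a n) < 1) (h1 : ∀ j < p, B' j = B j) (h2 : B' p = a n) :
    IsSplit a M (n + 1) m (p + 1) A B' where
  mem j hj := by
    obtain ⟨k, hk, he⟩ := h.mem j hj
    exact ⟨k, by omega, he⟩
  order i j hij hj := by
    obtain ⟨k, l, hkl, hl, he⟩ := h.order i j hij hj
    exact ⟨k, l, hkl, by omega, he⟩
  surj k hk hk' := by
    rcases Nat.lt_succ_iff_lt_or_eq.1 hk with hk | rfl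
    · exact h.surj k hk hk'
    · exact absurd hk' hM
  mem' j hj := by
    rcases Nat.lt_succ_iff_lt_or_eq.1 hj with hj | rfl
    · obtain ⟨k, hk, he, hk'⟩ := h.mem' j hj
      exact ⟨k, by omega, (h1 j hj).trans he, hk'⟩
    · exact ⟨n, by omega, h2, hM⟩
  surj' k hk hk' := by
    rcases Nat.lt_succ_iff_lt_or_eq.1 hk with hk | rfl
    · obtain ⟨j, hj, he⟩ := h.surj' k hk hk'
      exact ⟨j, by omega, (h1 j hj).trans he⟩
    · exact ⟨p, by omega, h2⟩
  total := by have := h.total; omega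

/-- Move the next entry of the array `8` to the unmarked or the marked ones. -/
def splitStep : Program :=
  .seq (.ite (.natLt (.get 16 (.get 8 (var 7))) (.lit 1))
    (.seq (.setNat 8 (var 10) (.get 8 (var 7))) (assign 10 (.add (var 10) (.lit 1))))
    (.seq (.setNat 17 (var 18) (.get 8 (var 7))) (assign 18 (.add (var 18) (.lit 1)))))
  (assign 7 (.add (var 7) (.lit 1)))

/-- Split the first `var 0` entries of the array `8` by the marks in the array `16`: the unmarked
ones remain, their number is `var 10`; the marked ones go to the array `17`, their number is
`var 18`. -/
def split : Program :=
  .seq (.seq (assign 10 (.lit 0)) (.seq (assign 18 (.lit 0)) (assign 7 (.lit 0))))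
    (.while (.natLt (var 7) (var 0)) splitStep)

lemma runs_split {s : State} {n : ℕ} (hn : s.nat 0 0 = n) :
    Runs split s ((n + 1) * (splitStep.bound + 20)) fun s' =>
      IsSplit (s.nat 8) (s.nat 16) n (s'.nat 10 0) (s'.nat 18 0) (s'.nat 8) (s'.nat 17) := by
  refine Runs.le (Runs.seq (Runs.of_loopFree (Q := fun s' => s'.nat 10 0 = 0 ∧ s'.nat 18 0 = 0 ∧
    s'.nat 7 0 = 0) rfl ?_) fun s₁ hf₁ h₁ => Runs.mono (Runs.while (c := splitStep.bound)
      (fun k s' => s'.nat 7 0 + k = n ∧ IsSplit (s.nat 8) (s.nat 16) (s'.nat 7 0) (s'.nat 10 0)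
        (s'.nat 18 0) (s'.nat 8) (s'.nat 17) ∧ ∀ j, s'.nat 7 0 ≤ j → s'.nat 8 j = s.nat 8 j)
      (k := n) ?_ ?_) le_rfl ?_) ?_
  · simp [Program.run, NatExp.eval]
  · obtain ⟨e10, e18, e7⟩ := h₁
    rw [e10, e18, e7]
    refine ⟨by omega, ?_, fun j _ => by rw [hf₁.2 8 rfl]⟩
    constructor <;> omega
  · rintro k s' hf ⟨hk, hI, h8⟩ hb
    have e0 : s'.nat 0 0 = n := by rw [hf.2 0 rfl, hf₁.2 0 rfl, hn]
    have e16 : s'.nat 16 = s.nat 16 := (hf.2 16 rfl).trans (hf₁.2 16 rfl)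
    have e8 := h8 _ le_rfl
    -- The number of retained entries never exceeds the number of entries read, so the compaction in
    -- place overwrites no unread entry.
    have htot := hI.total
    simp only [Test.Holds, NatExp.eval, e0] at hb
    refine Runs.of_loopFree rfl ⟨k - 1, by omega, ?_⟩
    by_cases hc : s.nat 16 (s.nat 8 (s'.nat 7 0)) < 1
    · have hc' : (Test.natLt (.get 16 (.get 8 (var 7))) (.lit 1)).Holds s' := by
        simpa only [Test.Holds, NatExp.eval, e16, e8] using hc
      have := hI.unmarked hc
        (A' := fun j => if j = s'.nat 10 0 then s.nat 8 (s'.nat 7 0) else s'.nat 8 j)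
        (fun j hj => by simp [hj.ne]) (by simp)
      simp only [splitStep, Program.run, if_pos hc', NatExp.eval, State.updateNat_nat,
        Nat.reduceEqDiff, false_and, if_false, and_self, if_true, true_and, e8]
      refine ⟨by omega, ?_, fun j hj => ?_⟩
      · convert this using 1 <;> (funext j; simp)
      · rw [if_neg (by omega)]
        exact h8 j (by omega)
    · have hc' : ¬(Test.natLt (.get 16 (.get 8 (var 7))) (.lit 1)).Holds s' := by
        simpa only [Test.Holds, NatExp.eval, e16, e8] using hc
      have := hI.marked hc
        (B' := fun j => if j = s'.nat 18 0 then s.nat 8 (s'.nat 7 0) else s'.nat 17 j)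
        (fun j hj => by simp [hj.ne]) (by simp)
      simp only [splitStep, Program.run, if_neg hc', NatExp.eval, State.updateNat_nat,
        Nat.reduceEqDiff, false_and, if_false, and_self, if_true, e8]
      refine ⟨by omega, ?_, fun j hj => h8 j (by omega)⟩
      convert this using 1 <;> (funext j; simp)
  · rintro s' hf ⟨⟨k, hk, hI, -⟩, hb⟩
    have e0 : s'.nat 0 0 = n := by rw [hf.2 0 rfl, hf₁.2 0 rfl, hn]
    simp only [Test.Holds, NatExp.eval, e0] at hb
    rwa [show s'.nat 7 0 = n by omega] at hI
  · simp only [Program.bound, NatExp.cost, Test.cost]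
    nlinarith

/-! ### The number of vertices without guards -/

/-- Compute the least number `var 19` whose square is at least a sixth of `var 0`. -/
def root : Program :=
  .seq (.seq (assign 19 (.lit 0)) (assign 20 (.lit 0))) (.while (.natLt (var 20) (var 0))
    -- Variable 20 holds 6k² for the number k in variable 19; the increment 12k + 6 is composed of
    -- additions because natural numbers cannot be multiplied.
    (.seq (assign 20 (.add (var 20) (.add (.lit 6) (.add
      (.add (.add (var 19) (var 19)) (.add (var 19) (var 19)))
      (.add (.add (.add (var 19) (var 19)) (.add (var 19) (var 19)))
        (.add (.add (var 19) (var 19)) (.add (var 19) (var 19))))))))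
      (assign 19 (.add (var 19) (.lit 1)))))

lemma runs_root {s : State} {n : ℕ} (hn : s.nat 0 0 = n) :
    Runs root s ((n + 1) * 100) fun s' => n ≤ 6 * (s'.nat 19 0 * s'.nat 19 0) ∧
      (s'.nat 19 0 = 0 ∨ 6 * ((s'.nat 19 0 - 1) * (s'.nat 19 0 - 1)) < n) := by
  refine Runs.le (Runs.seq (Runs.of_loopFree (Q := fun s' => s'.nat 19 0 = 0 ∧ s'.nat 20 0 = 0)
    rfl ?_) fun s₁ hf₁ h₁ => Runs.mono (Runs.while (fun k s' => n - s'.nat 20 0 = k ∧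
      s'.nat 20 0 = 6 * (s'.nat 19 0 * s'.nat 19 0) ∧
      (s'.nat 19 0 = 0 ∨ 6 * ((s'.nat 19 0 - 1) * (s'.nat 19 0 - 1)) < n)) (k := n) ?_
      fun k s' hf hI hb => Runs.of_loopFree rfl ?_) le_rfl ?_) ?_
  · simp [Program.run, NatExp.eval]
  · simp [h₁]
  · obtain ⟨hk, h1, h2⟩ := hI
    have e0 : s'.nat 0 0 = n := by rw [hf.2 0 rfl, hf₁.2 0 rfl, hn]
    simp only [Test.Holds, NatExp.eval, e0] at hb
    simp only [Program.run, NatExp.eval, State.updateNat_nat, Nat.reduceEqDiff, false_and,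
      if_false, and_self, if_true]
    refine ⟨_, ?_, rfl, ?_, .inr ?_⟩
    · omega
    · rw [h1]; ring
    · rw [Nat.add_sub_cancel]; omega
  · rintro s' hf ⟨⟨k, hk, h1, h2⟩, hb⟩
    have e0 : s'.nat 0 0 = n := by rw [hf.2 0 rfl, hf₁.2 0 rfl, hn]
    simp only [Test.Holds, NatExp.eval, e0] at hb
    exact ⟨by omega, h2⟩
  · simp only [Program.bound, NatExp.cost, Test.cost]
    omega

/-! ### Searching a block -/

/-- Test whether the point with index `17[var 22]` passes the block of the chain `12` with
`var 23` edges that starts at `var 21`. -/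
def passTest : Test :=
  .or (.and
      (leftTest (.get 12 (var 21)) (.get 12 (.add (var 21) (.lit 1))) (.get 17 (var 22)))
      (leftTest (.get 12 (.sub (.add (var 21) (var 23)) (.lit 1)))
        (.get 12 (.add (var 21) (var 23))) (.get 17 (var 22))))
    (.and
      (.not (leftTest (.get 12 (var 21)) (.get 12 (.add (var 21) (.lit 1))) (.get 17 (var 22))))
      (.and
        (.not (leftTest (.get 12 (.sub (.add (var 21) (var 23)) (.lit 1)))
          (.get 12 (.add (var 21) (var 23))) (.get 17 (var 22))))
        (.not (leftTest (.get 12 (var 21)) (.get 12 (.add (var 21) (var 23)))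
          (.get 17 (var 22))))))

lemma holds_passTest {s : State} : passTest.Holds s ↔
    Passes (fun j => pt s (s.nat 12 j)) (s.nat 21 0) (s.nat 23 0) (pt s (s.nat 17 (s.nat 22 0))) := by
  simp only [passTest, Test.Holds, holds_leftTest, NatExp.eval, Passes]
  tauto

/-- Test one point against the current block; continue with the next block if it fails. -/
def searchStep : Program :=
  .ite passTest (assign 22 (.add (var 22) (.lit 1)))
    (.seq (assign 21 (.add (var 21) (var 23))) (assign 22 (.lit 0)))

/-- Search the chain `12`, of length `var 13`, for a block of `var 23` edges that is passed by the
points with indices in the array `17`, of length `var 18`. -/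
def search : Program :=
  .seq (.seq (assign 21 (.lit 0)) (assign 22 (.lit 0)))
    (.while (.and (.natLt (.add (var 21) (var 23)) (var 13)) (.natLt (var 22) (var 18)))
      searchStep)

/-- A block is left after at most `p` tests, which is fewer than its `E` edges, so the single loop
is linear although it runs over blocks and points. A chain of `len` points has `len - 1` edges,
whence the strict inequalities. -/
lemma runs_search {s : State} {len E p : ℕ} {c : ℕ → Plane} (hlen : s.nat 13 0 = len)
    (hE : s.nat 23 0 = E) (hp : s.nat 18 0 = p) (hp0 : 0 < p) (hpE : p + 1 ≤ E)
    (hc : ∀ j, pt s (s.nat 12 j) = c j) :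
    Runs search s ((len + p + 1) * (searchStep.bound + 30)) fun s' =>
      (s'.nat 22 0 = p ∧ s'.nat 21 0 + E < len ∧
        ∀ t < p, Passes c (s'.nat 21 0) E (pt s (s.nat 17 t))) ∨
      (s'.nat 22 0 < p ∧
        ∀ b, b * E + E < len → ∃ t < p, ¬Passes c (b * E) E (pt s (s.nat 17 t))) := by
  have hc : (fun j => pt s (s.nat 12 j)) = c := funext hc
  refine Runs.le (Runs.seq (Runs.of_loopFree (Q := fun s' => s'.nat 21 0 = 0 ∧ s'.nat 22 0 = 0)
    rfl ?_) fun s₁ hf₁ h₁ => Runs.mono (Runs.while (c := searchStep.bound) (fun k s' =>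
      ∃ b, s'.nat 21 0 = b * E ∧ s'.nat 22 0 ≤ p ∧ (0 < s'.nat 22 0 → s'.nat 21 0 + E < len) ∧
      (∀ b' < b, ∃ t < p, ¬Passes c (b' * E) E (pt s (s.nat 17 t))) ∧
      (∀ t < s'.nat 22 0, Passes c (s'.nat 21 0) E (pt s (s.nat 17 t))) ∧ b ≤ len / E ∧
      k = (len / E - b) * (p + 1) + (p - s'.nat 22 0)) (k := len / E * (p + 1) + p) ?_ ?_)
      le_rfl ?_) ?_
  · simp [Program.run, NatExp.eval]
  · refine ⟨0, ?_⟩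
    simp [h₁]
  · rintro k s' hf ⟨b, h21, h22, hpos, hfail, hpass, hbl, hk⟩ hb
    have e13 : s'.nat 13 0 = len := by rw [hf.2 13 rfl, hf₁.2 13 rfl, hlen]
    have e23 : s'.nat 23 0 = E := by rw [hf.2 23 rfl, hf₁.2 23 rfl, hE]
    have e18 : s'.nat 18 0 = p := by rw [hf.2 18 rfl, hf₁.2 18 rfl, hp]
    have e12 : s'.nat 12 = s.nat 12 := (hf.2 12 rfl).trans (hf₁.2 12 rfl)
    have e17 : s'.nat 17 = s.nat 17 := (hf.2 17 rfl).trans (hf₁.2 17 rfl)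
    have er : pt s' = pt s := pt_congr ((hf.1 rfl).trans (hf₁.1 rfl))
    simp only [Test.Holds, NatExp.eval, e13, e23, e18] at hb
    have htest := holds_passTest (s := s')
    rw [er, e12, e17, e23, hc] at htest
    refine Runs.of_loopFree rfl ?_
    by_cases ht : passTest.Holds s'
    · rw [searchStep, Program.run, if_pos ht]
      rw [htest] at ht
      simp only [Program.run, NatExp.eval, State.updateNat_nat, Nat.reduceEqDiff, false_and,
        if_false, and_self, if_true]
      refine ⟨_, ?_, b, h21, hb.2, fun _ => hb.1, hfail, fun t ht' => ?_, hbl, rfl⟩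
      · omega
      · rcases Nat.lt_succ_iff_lt_or_eq.1 ht' with h | rfl
        · exact hpass t h
        · exact ht
    · rw [searchStep, Program.run, if_neg ht]
      rw [htest] at ht
      simp only [Program.run, NatExp.eval, State.updateNat_nat, Nat.reduceEqDiff, false_and,
        if_false, and_self, if_true, e23]
      have hb1 : b + 1 ≤ len / E := by
        rw [Nat.le_div_iff_mul_le (by omega), Nat.add_mul, one_mul, ← h21]
        exact hb.1.le
      refine ⟨_, ?_, b + 1, by rw [h21, Nat.add_mul, one_mul], by omega, by omega,
        fun b' hb' => ?_, by omega, hb1, rfl⟩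
      · rw [hk, show len / E - b = len / E - (b + 1) + 1 by omega, Nat.add_mul]
        omega
      · rcases Nat.lt_succ_iff_lt_or_eq.1 hb' with h | rfl
        · exact hfail b' h
        · exact ⟨_, hb.2, by rwa [← h21]⟩
  · rintro s' hf ⟨⟨k, b, h21, h22, hpos, hfail, hpass, -, -⟩, hb⟩
    have e13 : s'.nat 13 0 = len := by rw [hf.2 13 rfl, hf₁.2 13 rfl, hlen]
    have e23 : s'.nat 23 0 = E := by rw [hf.2 23 rfl, hf₁.2 23 rfl, hE]
    have e18 : s'.nat 18 0 = p := by rw [hf.2 18 rfl, hf₁.2 18 rfl, hp]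
    simp only [Test.Holds, NatExp.eval, e13, e23, e18] at hb
    rcases h22.eq_or_lt with h | h
    · exact .inl ⟨h, hpos (by omega), h ▸ hpass⟩
    · refine .inr ⟨h, fun b' hb' => hfail b' ?_⟩
      have : b' * E < b * E := by omega
      exact Nat.lt_of_mul_lt_mul_right this
  · have h1 : len / E * (p + 1) ≤ len :=
      (Nat.mul_le_mul_left _ hpE).trans (Nat.div_mul_le_self _ _)
    simp only [Program.bound, NatExp.cost, Test.cost]
    generalize searchStep.bound = a
    have := Nat.mul_le_mul_right (a + 20) (show len / E * (p + 1) + p + 1 ≤ len + p + 1 by omega)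
    nlinarith

end

end RealRAM

/-! ### The algorithm -/

namespace RealRAM

noncomputable section

open UniversalGuards

/-- The state after the preparations: the indices of the inner points are in the array `8`, in
lexicographic order, those of the shell in the array `17`, the number of vertices to be left
without guards is `var 19`, and all points are marked as guards. -/
structure Prepared (P : ℕ → Plane) (S : Finset Plane) (n : ℕ) (s : State) : Prop where
  pt_eq : pt s = P
  inj : ∀ a < n, ∀ b < n, P a = P b → a = b
  mem : ∀ z, z ∈ S ↔ ∃ v < n, P v = z
  card : S.card = n
  inner_lt : ∀ j < s.nat 10 0, s.nat 8 j < n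
  inner_lex : ∀ i j, i < j → j < s.nat 10 0 → LexLt (P (s.nat 8 i)) (P (s.nat 8 j))
  mem_inner : ∀ z, z ∈ S \ shell S ↔ ∃ j < s.nat 10 0, P (s.nat 8 j) = z
  card_inner : (S \ shell S).card = s.nat 10 0
  outer_lt : ∀ j < s.nat 18 0, s.nat 17 j < n
  mem_outer : ∀ z, z ∈ shell S ↔ ∃ j < s.nat 18 0, P (s.nat 17 j) = z
  card_outer : (shell S).card = s.nat 18 0
  le_root : n ≤ 6 * (s.nat 19 0 * s.nat 19 0)
  root_lt : s.nat 19 0 = 0 ∨ 6 * ((s.nat 19 0 - 1) * (s.nat 19 0 - 1)) < n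
  out : ∀ v < n, s.nat 1 v = 1

/-- The array `1` marks a universal guard set that omits at least `K` points. -/
def Solved (P : ℕ → Plane) (S : Finset Plane) (n K : ℕ) (s : State) : Prop :=
  ∃ B ⊆ S, IsUniversalGuardSet S (S \ B) ∧ K ≤ B.card ∧ ∀ v < n, s.nat 1 v = 1 ↔ P v ∉ B

lemma runs_clear_shell {P : ℕ → Plane} {S : Finset Plane} {n : ℕ} {s : State}
    (h : Prepared P S n s) (hS : LiesOnShells 2 S) (hK : s.nat 19 0 ≤ s.nat 18 0) :
    Runs (scatter 1 18 (.get 17 (var 7)) 0) s ((n + 1) * 30) (Solved P S n (s.nat 19 0)) := by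
  have hle : s.nat 18 0 ≤ n := by
    rw [← h.card_outer, ← h.card]
    exact Finset.card_le_card (shell_subset S)
  refine Runs.mono (runs_scatter (f := s.nat 17) rfl (by decide) ?_)
    (Nat.mul_le_mul (by omega) (by decide)) ?_
  · intro s' h'
    simp only [NatExp.eval]
    rw [h' 17 (by decide) (by decide)]
  · rintro s' - ⟨h1, h2⟩
    refine ⟨shell S, shell_subset S, isUniversalGuardSet_sdiff_shell hS.two.1,
      by rw [h.card_outer]; exact hK, fun v hv => ?_⟩
    rw [h.mem_outer]
    constructor
    · rintro h3 ⟨j, hj, he⟩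
      have := h.inj _ (h.outer_lt j hj) _ hv he
      subst this
      have := h1 j hj
      omega
    · intro h3
      rw [h2 v fun k hk he => h3 ⟨k, hk, by rw [he]⟩]
      exact h.out v hv

/-- The array `12` contains a chain of inner points, with a block of `E` edges starting at
`var 21` that all points of the shell pass. -/
def Found (P : ℕ → Plane) (S : Finset Plane) (n E : ℕ) (s : State) : Prop :=
  ∃ u N, IsChain u (S \ shell S) N (fun j => P (s.nat 12 j)) ∧ s.nat 21 0 + E ≤ N ∧
    (∀ w ∈ shell S, Passes (fun j => P (s.nat 12 j)) (s.nat 21 0) E w) ∧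
    ∀ j ≤ N, s.nat 12 j < n

lemma runs_clear_block {P : ℕ → Plane} {S : Finset Plane} {n m : ℕ} {s : State}
    (hinj : ∀ a < n, ∀ b < n, P a = P b → a = b) (hout : ∀ v < n, s.nat 1 v = 1)
    (hf : Found P S n (2 * m) s) (hm : 0 < m) (hK : s.nat 19 0 = m + 1) :
    Runs (scatter 1 19 (.get 12 (.add (var 21) (.add (var 7) (var 7)))) 0) s ((m + 2) * 40)
      (Solved P S n (m + 1)) := by
  classical
  obtain ⟨u, N, hc, hN, hp, hlt⟩ := hf
  obtain ⟨hg, hcard⟩ := guards_of_passing hc hm hN hp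
  refine Runs.mono (runs_scatter (f := fun k => s.nat 12 (s.nat 21 0 + 2 * k)) hK (by decide) ?_)
    (Nat.mul_le_mul (by omega) (by decide)) ?_
  · intro s' h'
    simp only [NatExp.eval]
    rw [h' 12 (by decide) (by decide), h' 21 (by decide) (by decide), two_mul]
  · rintro s' - ⟨h1, h2⟩
    refine ⟨_, ?_, hg, hcard.ge, fun v hv => ?_⟩
    · intro z hz
      obtain ⟨i, hi, rfl⟩ := Finset.mem_image.1 hz
      exact Finset.sdiff_subset (hc.mem _ (by have := Finset.mem_range.1 hi; omega))
    · rw [Finset.mem_image]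
      constructor
      · rintro h3 ⟨j, hj, he⟩
        rw [Finset.mem_range] at hj
        have := hinj _ (hlt _ (by omega)) _ hv he
        have h4 := h1 j hj
        rw [this] at h4
        omega
      · intro h3
        rw [h2 v fun k hk he => h3 ⟨k, Finset.mem_range.2 hk, by rw [he]⟩]
        exact hout v hv

lemma runs_search_shell {P : ℕ → Plane} {S : Finset Plane} {n p E len : ℕ} {u : Plane} {s : State}
    (hP : pt s = P) (hE : s.nat 23 0 = E) (hp : s.nat 18 0 = p) (hp0 : 0 < p) (hpE : p + 1 ≤ E)
    (hB : ∀ z, z ∈ shell S ↔ ∃ j < p, P (s.nat 17 j) = z) (hlen : s.nat 13 0 = len)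
    (hlen0 : 0 < len) (hn : len + p ≤ 2 * n)
    (hc : IsChain u (S \ shell S) (len - 1) fun j => P (s.nat 12 j))
    (hlt : ∀ j < len, s.nat 12 j < n) :
    Runs search s ((2 * n + 1) * (searchStep.bound + 30)) fun s' =>
      (¬s'.nat 22 0 < p ∧ Found P S n E s') ∨ (s'.nat 22 0 < p ∧
        ∀ b, b * E + E ≤ len - 1 →
          ∃ w ∈ shell S, ¬Passes (fun j => P (s.nat 12 j)) (b * E) E w) := by
  refine Runs.mono (runs_search (c := fun j => P (s.nat 12 j)) hlen hE hp hp0 hpE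
    fun j => by rw [hP]) (Nat.mul_le_mul_right _ (by omega)) ?_
  rintro s' hf (⟨h1, h2, h3⟩ | ⟨h1, h2⟩)
  · refine .inl ⟨by omega, u, len - 1, ?_, by omega, fun w hw => ?_, fun j hj => ?_⟩
    · rwa [hf.2 12 rfl]
    · obtain ⟨t, ht, rfl⟩ := (hB w).1 hw
      rw [hf.2 12 rfl, ← hP]
      rw [← hP] at h3
      exact h3 t ht
    · rw [hf.2 12 rfl]
      exact hlt j (by omega)
  · refine .inr ⟨h1, fun b hb => ?_⟩
    obtain ⟨t, ht, h3⟩ := h2 b (by omega)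
    exact ⟨_, (hB _).2 ⟨t, ht, rfl⟩, by rwa [← hP] at h3 ⊢⟩

/-- Search the chain `14` if the chain `12` has been searched in vain. -/
def searchOther : Program :=
  .ite (.natLt (var 22) (var 18))
    (.seq (fill 12 15 (.get 14 (var 7))) (.seq (assign 13 (var 15)) search)) .skip

lemma runs_searchOther {P : ℕ → Plane} {S : Finset Plane} {n p E len : ℕ} {u : Plane} {s : State}
    (hP : pt s = P) (hE : s.nat 23 0 = E) (hp : s.nat 18 0 = p) (hp0 : 0 < p) (hpE : p + 1 ≤ E)
    (hB : ∀ z, z ∈ shell S ↔ ∃ j < p, P (s.nat 17 j) = z) (hlen : s.nat 15 0 = len)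
    (hlen0 : 0 < len) (hn : len + p ≤ 2 * n)
    (hc : IsChain u (S \ shell S) (len - 1) fun j => P (s.nat 14 j))
    (hlt : ∀ j < len, s.nat 14 j < n)
    (h1 : ¬s.nat 22 0 < p → Found P S n E s)
    (h2 : s.nat 22 0 < p → ¬∀ b, b * E + E ≤ len - 1 →
      ∃ w ∈ shell S, ¬Passes (fun j => P (s.nat 14 j)) (b * E) E w) :
    Runs searchOther s ((2 * n + 1) * (searchStep.bound + 100)) (Found P S n E) := by
  refine Runs.le (Runs.ite (c := (2 * n + 1) * 30 + (5 + (2 * n + 1) * (searchStep.bound + 30)))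
    (fun hb => Runs.seq (Q := fun s' => ∀ j < len, s'.nat 12 j = s.nat 14 j)
      (Runs.mono (runs_fill (L := len) (f := s.nat 14) hlen (by decide) ?_)
        (Nat.mul_le_mul (by omega) (by decide)) ?_) fun s₁ hf₁ h₁ => Runs.seq
      (Q := fun s' => s'.nat 13 0 = len) ((Runs.of_loopFree rfl ?_).le (by decide))
      fun s₂ hf₂ h₂ => ?_)
    (fun hb => (Runs.of_loopFree rfl ?_).le ?_)) ?_
  · intro s' _ h
    simp only [NatExp.eval]
    rw [h 14 (by decide) (by decide)]
  · intro s' _ h j hj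
    rw [h, if_pos hj]
  · simp [Program.run, NatExp.eval, hf₁.2 15 rfl, hlen]
  · have e12 : ∀ j < len, s₂.nat 12 j = s.nat 14 j := fun j hj => by rw [hf₂.2 12 rfl, h₁ j hj]
    have e17 : s₂.nat 17 = s.nat 17 := (hf₂.2 17 rfl).trans (hf₁.2 17 rfl)
    have hcong : ∀ j ≤ len - 1, P (s₂.nat 12 j) = P (s.nat 14 j) := fun j hj => by
      rw [e12 j (by omega)]
    simp only [Test.Holds, NatExp.eval, hp] at hb
    refine Runs.mono (runs_search_shell (P := P) (S := S) (E := E) (p := p) (n := n) (u := u) ?_ ?_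
      ?_ hp0 hpE ?_ h₂ hlen0 hn ?_ ?_) le_rfl ?_
    · rw [pt_congr ((hf₂.1 rfl).trans (hf₁.1 rfl)), hP]
    · rw [hf₂.2 23 rfl, hf₁.2 23 rfl, hE]
    · rw [hf₂.2 18 rfl, hf₁.2 18 rfl, hp]
    · rwa [e17]
    · refine ⟨fun j hj => ?_, fun j hj => ?_, fun j hj z hz => ?_⟩
      · simp only [hcong j hj]
        exact hc.mem j hj
      · simp only [hcong j hj.le, hcong (j + 1) hj]
        exact hc.lt j hj
      · simp only [hcong j hj.le, hcong (j + 1) hj]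
        exact hc.below j hj z hz
    · intro j hj
      rw [e12 j hj]
      exact hlt j hj
    · rintro s' - (h | ⟨-, h⟩)
      · exact h.2
      · refine absurd (fun b hbE => ?_) (h2 hb)
        obtain ⟨w, hw, hw'⟩ := h b hbE
        refine ⟨w, hw, ?_⟩
        have hE0 : 0 < E := by omega
        simp only [Passes] at hw' ⊢
        rwa [hcong _ (by omega), hcong _ (by omega), hcong _ (by omega), hcong _ (by omega)] at hw'
  · simp only [Test.Holds, NatExp.eval, hp] at hb
    exact h1 hb
  · simp only [Program.bound]
    omega
  · simp only [Test.cost, NatExp.cost]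
    generalize searchStep.bound = a
    nlinarith

/-- Clear the guards of every other vertex of a block of a chain of inner points. -/
def clearBlock : Program :=
  .seq (assign 23 (.add (.sub (var 19) (.lit 1)) (.sub (var 19) (.lit 1))))
  (.seq scanBoth
  (.seq search
  (.seq searchOther
    (scatter 1 19 (.get 12 (.add (var 21) (.add (var 7) (var 7)))) 0))))

/-- With m one less than the root K, the block has 2m edges and m + 1 = K even vertices; the
minimality of K gives 6m² < n. Both searches cannot fail, by `exists_passing`: on two shells every
inner point lies on one of the two chains. -/
lemma runs_clearBlock {P : ℕ → Plane} {S : Finset Plane} {n : ℕ} {s : State}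
    (h : Prepared P S n s) (hS : LiesOnShells 2 S) (hK : s.nat 18 0 < s.nat 19 0) :
    Runs clearBlock s ((n + 1) * (4 * scanStep.bound + 4 * searchStep.bound + 1000))
      (Solved P S n (s.nat 19 0)) := by
  have h3 := three_le_card_shell hS.two.1
  obtain ⟨m, hm⟩ : ∃ m, s.nat 19 0 = m + 1 := ⟨s.nat 19 0 - 1, by omega⟩
  have hroot := h.root_lt
  rw [hm, Nat.add_sub_cancel] at hroot
  have hroot : 6 * (m * m) < n := hroot.resolve_left (by omega)
  have hsum : s.nat 10 0 + s.nat 18 0 = n := by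
    rw [← h.card_inner, ← h.card_outer, ← h.card]
    exact Finset.card_sdiff_add_card_eq_card (shell_subset S)
  have hout := h.card_outer
  have hmm : m ≤ m * m := Nat.le_mul_self m
  -- There are more than 6m² points and at most m of them on the shell, so the inner chains have
  -- edges.
  have hin : 2 ≤ s.nat 10 0 := by omega
  obtain ⟨u, hu⟩ := exists_lin_of_lex S
  have hSA : ∀ j < s.nat 10 0, P (s.nat 8 j) ∈ S := fun j hj =>
    (h.mem _).2 ⟨_, h.inner_lt j hj, rfl⟩
  have hQ : ∀ a b, a < b → b < s.nat 10 0 → lin u (P (s.nat 8 a)) < lin u (P (s.nat 8 b)) :=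
    fun a b hab hb => hu _ (hSA a (hab.trans hb)) _ (hSA b hb) (h.inner_lex a b hab hb)
  have hT : ∀ z, z ∈ S \ shell S ↔ ∃ k < s.nat 10 0, P (s.nat 8 k) = z := h.mem_inner
  have hT' : ∀ z, z ∈ S \ shell S ↔
      ∃ k < s.nat 10 0, P (s.nat 8 (s.nat 10 0 - 1 - k)) = z := by
    intro z
    rw [hT]
    constructor
    · rintro ⟨k, hk, he⟩
      exact ⟨s.nat 10 0 - 1 - k, by omega, by rwa [show s.nat 10 0 - 1 - (s.nat 10 0 - 1 - k) = k
        by omega]⟩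
    · rintro ⟨k, hk, he⟩
      exact ⟨_, by omega, he⟩
  rw [hm]
  refine Runs.le (Runs.seq (Runs.of_loopFree (Q := fun s' => s'.nat 23 0 = 2 * m) rfl ?_)
    fun s₁ hf₁ h₁ => Runs.seq
    (Q := fun s' => IsScan u (fun k => P (s.nat 8 k)) (s.nat 10 0) (s'.nat 15 0)
        (fun j => P (s'.nat 14 j)) ∧
      IsScan (-u) (fun k => P (s.nat 8 (s.nat 10 0 - 1 - k))) (s.nat 10 0) (s'.nat 13 0)
        (fun j => P (s'.nat 12 j)) ∧
      (∀ j < s'.nat 15 0, s'.nat 14 j < n) ∧ ∀ j < s'.nat 13 0, s'.nat 12 j < n)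
    (Runs.mono (runs_scanBoth (m := s.nat 10 0) (u := u) ?_ (by omega) ?_) le_rfl ?_)
    fun s₂ hf₂ h₂ => Runs.seq
    (runs_search_shell (P := P) (S := S) (E := 2 * m) (p := s.nat 18 0) (n := n) (u := -u) ?_ ?_
      ?_ (by omega) (by omega) ?_ rfl h₂.2.1.pos ?_ ?_ h₂.2.2.2) fun s₃ hf₃ h₃ => Runs.seq
    (runs_searchOther (P := P) (S := S) (n := n) (E := 2 * m) (p := s.nat 18 0) (u := u) ?_ ?_
      ?_ (by omega) (by omega) ?_ rfl ?_ ?_ ?_ ?_ ?_ ?_) fun s₄ hf₄ h₄ =>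
      runs_clear_block (n := n) h.inj ?_ h₄ (by omega) ?_) ?_
  · simp [Program.run, NatExp.eval, hm, two_mul]
  · rw [hf₁.2 10 rfl]
  · intro a b hab hb
    rw [pt_congr (hf₁.1 rfl), h.pt_eq, hf₁.2 8 rfl]
    exact hQ a b hab hb
  · rintro s' - ⟨g1, g2, g3, g4⟩
    rw [pt_congr (hf₁.1 rfl), h.pt_eq, hf₁.2 8 rfl] at g1 g2
    rw [hf₁.2 8 rfl] at g3 g4
    refine ⟨g1, g2, fun j hj => ?_, fun j hj => ?_⟩
    · obtain ⟨k, hk, he⟩ := g3 j hj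
      rw [he]
      exact h.inner_lt k hk
    · obtain ⟨k, hk, he⟩ := g4 j hj
      rw [he]
      exact h.inner_lt k hk
  · rw [pt_congr ((hf₂.1 rfl).trans (hf₁.1 rfl)), h.pt_eq]
  · rw [hf₂.2 23 rfl, h₁]
  · rw [hf₂.2 18 rfl, hf₁.2 18 rfl]
  · rw [hf₂.2 17 rfl, hf₁.2 17 rfl]
    exact h.mem_outer
  · have := h₂.2.1.len_le
    omega
  · exact h₂.2.1.isChain hT'
  · rw [pt_congr ((hf₃.1 rfl).trans ((hf₂.1 rfl).trans (hf₁.1 rfl))), h.pt_eq]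
  · rw [hf₃.2 23 rfl, hf₂.2 23 rfl, h₁]
  · rw [hf₃.2 18 rfl, hf₂.2 18 rfl, hf₁.2 18 rfl]
  · rw [hf₃.2 17 rfl, hf₂.2 17 rfl, hf₁.2 17 rfl]
    exact h.mem_outer
  · rw [hf₃.2 15 rfl]
    exact h₂.1.pos
  · rw [hf₃.2 15 rfl]
    have := h₂.1.len_le
    omega
  · rw [hf₃.2 15 rfl, hf₃.2 14 rfl]
    exact h₂.1.isChain hT
  · rw [hf₃.2 15 rfl, hf₃.2 14 rfl]
    exact h₂.2.2.1
  · intro hb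
    exact (h₃.resolve_right fun h' => hb h'.1).2
  · intro hb hfail
    rw [hf₃.2 15 rfl, hf₃.2 14 rfl] at hfail
    have hfail' := (h₃.resolve_left fun h' => h'.1 hb).2
    have hcard : (S \ shell S).card ≤ s₂.nat 15 0 + s₂.nat 13 0 := by
      have hsub : S \ shell S ⊆ (Finset.range (s₂.nat 15 0)).image (fun j => P (s₂.nat 14 j)) ∪
          (Finset.range (s₂.nat 13 0)).image (fun j => P (s₂.nat 12 j)) := by
        intro z hz
        obtain ⟨k, hk, rfl⟩ := (hT z).1 hz
        simp only [Finset.mem_union, Finset.mem_image, Finset.mem_range]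
        exact (scan_mem_iff hin hQ h₂.1 h₂.2.1 hT hk).2 (hS.two.2 _ hz)
      refine (Finset.card_le_card hsub).trans ((Finset.card_union_le _ _).trans ?_)
      exact add_le_add (Finset.card_image_le.trans (Finset.card_range _).le)
        (Finset.card_image_le.trans (Finset.card_range _).le)
    refine exists_passing hS (h₂.1.isChain hT) (h₂.2.1.isChain hT') (m := m) ?_ ?_ ?_ hfail hfail'
    · have := h₂.1.pos
      have := h₂.2.1.pos
      omega
    · rw [h.card]
      exact hroot
    · omega
  · intro v hv
    rw [hf₄.2 1 rfl, hf₃.2 1 rfl, hf₂.2 1 rfl, hf₁.2 1 rfl]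
    exact h.out v hv
  · rw [hf₄.2 19 rfl, hf₃.2 19 rfl, hf₂.2 19 rfl, hf₁.2 19 rfl, hm]
  · simp only [Program.bound, NatExp.cost]
    generalize scanStep.bound = a
    generalize searchStep.bound = b
    have h1 : (s.nat 10 0 + 1) * (4 * a + 200) ≤ (n + 1) * (4 * a + 200) :=
      Nat.mul_le_mul_right _ (by omega)
    have h2 : (m + 2) * 40 ≤ (n + 2) * 40 := Nat.mul_le_mul_right _ (by omega)
    nlinarith

end

end RealRAM

/-! ### Marking the shell, the preparations, and the complete program. -/

namespace RealRAM

noncomputable section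

open UniversalGuards

/-- Sort the points and mark those of the shell in the array `16`. -/
def markShell : Program :=
  .seq sort (.seq (assign 10 (var 0)) (.seq scanBoth
    (.seq (scatter 16 13 (.get 12 (var 7)) 1) (scatter 16 15 (.get 14 (var 7)) 1))))

/-- A factor in the running time of `markShell`. -/
def markCost : ℕ := 2 * mergeCost + 4 * scanStep.bound + 600

lemma markCost_bound {a b N q : ℕ} (h0 : 0 < N) (h : N ≤ q) :
    (2 * a + 300) * q + (4 + (N * (4 * b + 200) + (N * 30 + N * 30))) ≤
      (2 * a + 4 * b + 600) * q := by
  have := Nat.mul_le_mul_right b h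
  nlinarith

/-- The points on the two chains are those not interior to the hull, which is membership in the
shell. Array 16 starts with zeros and receives ones along both chains, so points on both are marked
consistently. -/
lemma runs_markShell {P : ℕ → Plane} {S : Finset Plane} {n : ℕ} {s : State}
    (hn : s.nat 0 0 = n) (hn2 : 2 ≤ n) (h16 : ∀ v, s.nat 16 v = 0) (hP : pt s = P)
    (hinj : ∀ a < n, ∀ b < n, P a = P b → a = b) (hS : ∀ z, z ∈ S ↔ ∃ v < n, P v = z) :
    Runs markShell s (markCost * ((n + 1) * (Nat.log 2 n + 2))) fun s' =>
      IsSorted s n (s'.nat 8) ∧ ∀ v < n, s'.nat 16 v < 1 ↔ P v ∉ shell S := by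
  obtain ⟨u, hu⟩ := exists_lin_of_lex S
  refine Runs.le (Runs.seq (runs_sort hn (by omega) (by rwa [hP])) fun s₁ hf₁ h₁ => Runs.seq
    (Runs.of_loopFree (Q := fun s' => s'.nat 10 0 = n) rfl ?_) fun s₂ hf₂ h₂ => Runs.seq
    (Q := fun s' => IsScan u (fun k => P (s₁.nat 8 k)) n (s'.nat 15 0) (fun j => P (s'.nat 14 j)) ∧
      IsScan (-u) (fun k => P (s₁.nat 8 (n - 1 - k))) n (s'.nat 13 0) (fun j => P (s'.nat 12 j)) ∧
      (∀ j < s'.nat 15 0, ∃ k < n, s'.nat 14 j = s₁.nat 8 k) ∧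
      ∀ j < s'.nat 13 0, ∃ k < n, s'.nat 12 j = s₁.nat 8 k)
    (Runs.mono (runs_scanBoth (u := u) h₂ (by omega) ?_) le_rfl ?_) fun s₃ hf₃ h₃ => Runs.seq
    (c := (n + 1) * 30)
    (Runs.mono (Q' := fun s' => (∀ k < s₃.nat 13 0, s'.nat 16 (s₃.nat 12 k) = 1) ∧
      ∀ j, (∀ k < s₃.nat 13 0, s₃.nat 12 k ≠ j) → s'.nat 16 j = s₃.nat 16 j)
      (runs_scatter (f := s₃.nat 12) rfl (by decide) ?_) ?_ fun _ _ h => h) fun s₄ hf₄ h₄ =>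
    Runs.mono (c' := (n + 1) * 30)
      (runs_scatter (f := s₃.nat 14) (L := s₃.nat 15 0) ?_ (by decide) ?_) ?_ ?_) ?_
  · simp [Program.run, NatExp.eval, hf₁.2 0 rfl, hn]
  · intro a b hab hb
    rw [pt_congr ((hf₂.1 rfl).trans (hf₁.1 rfl)), hf₂.2 8 rfl]
    refine hu _ ((hS _).2 ⟨_, h₁.lt a (hab.trans hb), ?_⟩) _ ((hS _).2 ⟨_, h₁.lt b hb, ?_⟩)
      (h₁.lex a b hab hb)
    · rw [hP]
    · rw [hP]
  · rintro s' -
    rw [pt_congr ((hf₂.1 rfl).trans (hf₁.1 rfl)), hP, hf₂.2 8 rfl]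
    exact id
  · intro s' h'
    simp only [NatExp.eval]
    rw [h' 12 (by decide) (by decide)]
  · have := h₃.2.1.len_le
    exact Nat.mul_le_mul (by omega) (by decide)
  · rw [hf₄.2 15 rfl]
  · intro s' h'
    simp only [NatExp.eval]
    rw [h' 14 (by decide) (by decide), hf₄.2 14 rfl]
  · have := h₃.1.len_le
    exact Nat.mul_le_mul (by omega) (by decide)
  · rintro s' hf ⟨g1, g2⟩
    have e8 : s'.nat 8 = s₁.nat 8 := by
      rw [hf.2 8 rfl, hf₄.2 8 rfl, hf₃.2 8 rfl, hf₂.2 8 rfl]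
    rw [e8]
    refine ⟨h₁, fun v hv => ?_⟩
    obtain ⟨k, hk, rfl⟩ := h₁.surj v hv
    have hT : ∀ z, z ∈ S ↔ ∃ k < n, P (s₁.nat 8 k) = z := by
      intro z
      rw [hS]
      constructor
      · rintro ⟨v, hv, he⟩
        obtain ⟨x, hx, rfl⟩ := h₁.surj v hv
        exact ⟨x, hx, he⟩
      · rintro ⟨x, hx, he⟩
        exact ⟨_, h₁.lt x hx, he⟩
    have hQ : ∀ a b, a < b → b < n → lin u (P (s₁.nat 8 a)) < lin u (P (s₁.nat 8 b)) := by
      intro a b hab hb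
      have := h₁.lex a b hab hb
      rw [hP] at this
      exact hu _ ((hT _).2 ⟨a, hab.trans hb, rfl⟩) _ ((hT _).2 ⟨b, hb, rfl⟩) this
    have hiff := scan_mem_iff hn2 hQ h₃.1 h₃.2.1 hT hk
    rw [mem_shell, not_and, not_not]
    have hz : ∀ v, s₄.nat 16 v = 1 ∨ s₄.nat 16 v = 0 := by
      intro v
      by_cases h : ∀ k < s₃.nat 13 0, s₃.nat 12 k ≠ v
      · rw [h₄.2 v h, hf₃.2 16 rfl, hf₂.2 16 rfl, hf₁.2 16 rfl]
        exact .inr (h16 v)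
      · push Not at h
        obtain ⟨k, hk, rfl⟩ := h
        exact .inl (h₄.1 k hk)
    constructor
    · intro hlt _
      by_contra hint
      rcases hiff.2 hint with ⟨j, hj, he⟩ | ⟨j, hj, he⟩
      · obtain ⟨k', hk', hj'⟩ := h₃.2.2.1 j hj
        have := hinj _ (hj' ▸ h₁.lt k' hk') _ (h₁.lt k hk) he
        have := this ▸ g1 j hj
        omega
      · obtain ⟨k', hk', hj'⟩ := h₃.2.2.2 j hj
        have := hinj _ (hj' ▸ h₁.lt k' hk') _ (h₁.lt k hk) he
        have h5 : s₄.nat 16 (s₁.nat 8 k) = 1 := this ▸ h₄.1 j hj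
        by_cases h6 : ∀ i < s₃.nat 15 0, s₃.nat 14 i ≠ s₁.nat 8 k
        · have := g2 _ h6
          omega
        · push Not at h6
          obtain ⟨i, hi, he'⟩ := h6
          have := he' ▸ g1 i hi
          omega
    · intro hint
      have hint := hint ((hT _).2 ⟨k, hk, rfl⟩)
      have hno := fun h => hiff.1 h hint
      rw [g2 _ fun j hj he => hno (.inl ⟨j, hj, by rw [he]⟩),
        h₄.2 _ fun j hj he => hno (.inr ⟨j, hj, by rw [he]⟩), hf₃.2 16 rfl, hf₂.2 16 rfl,
        hf₁.2 16 rfl, h16]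
      exact one_pos
  · exact markCost_bound (Nat.succ_pos _) (Nat.le_mul_of_pos_right _ (Nat.succ_pos _))

/-- Sort the points, split them into the shell and the inner points, compute the number of
vertices to be left without guards, and mark all points as guards. -/
def prepare : Program := .seq markShell (.seq split (.seq root (fill 1 0 (.lit 1))))

lemma prepareCost_bound {a b N q : ℕ} (h : N ≤ q) :
    a * q + (N * (b + 20) + (N * 100 + N * 21)) ≤ (a + b + 200) * q := by
  nlinarith

lemma runs_prepare {P : ℕ → Plane} {S : Finset Plane} {n : ℕ} {s : State}
    (hn : s.nat 0 0 = n) (hn2 : 2 ≤ n) (h16 : ∀ v, s.nat 16 v = 0) (hP : pt s = P)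
    (hinj : ∀ a < n, ∀ b < n, P a = P b → a = b) (hS : ∀ z, z ∈ S ↔ ∃ v < n, P v = z) :
    Runs prepare s ((markCost + splitStep.bound + 200) * ((n + 1) * (Nat.log 2 n + 2)))
      (Prepared P S n) := by
  classical
  refine Runs.le (Runs.seq (runs_markShell hn hn2 h16 hP hinj hS) fun s₁ hf₁ h₁ => Runs.seq
    (runs_split (n := n) ?_) fun s₂ hf₂ h₂ => Runs.seq (runs_root (n := n) ?_)
    fun s₃ hf₃ h₃ => Runs.mono (runs_fill (L := n) (f := fun _ => 1) ?_ (by decide) ?_) le_rfl ?_)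
    ?_
  · rw [hf₁.2 0 rfl, hn]
  · rw [hf₂.2 0 rfl, hf₁.2 0 rfl, hn]
  · rw [hf₃.2 0 rfl, hf₂.2 0 rfl, hf₁.2 0 rfl, hn]
  · intro _ _ _
    rfl
  · intro s' hf h
    have e8 : s'.nat 8 = s₂.nat 8 := by rw [hf.2 8 rfl, hf₃.2 8 rfl]
    have e10 : s'.nat 10 = s₂.nat 10 := by rw [hf.2 10 rfl, hf₃.2 10 rfl]
    have e17 : s'.nat 17 = s₂.nat 17 := by rw [hf.2 17 rfl, hf₃.2 17 rfl]
    have e18 : s'.nat 18 = s₂.nat 18 := by rw [hf.2 18 rfl, hf₃.2 18 rfl]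
    have e19 : s'.nat 19 = s₃.nat 19 := hf.2 19 rfl
    obtain ⟨hsort, hmark⟩ := h₁
    have hlt := hsort.lt
    have hlex := hsort.lex
    rw [hP] at hlex
    have hcard : S.card = n := by
      have : S = (Finset.range n).image P := by
        ext z
        simp [hS]
      rw [this, Finset.card_image_of_injOn, Finset.card_range]
      intro a ha b hb he
      exact hinj a (by simpa using ha) b (by simpa using hb) he
    have hinner : ∀ z, z ∈ S \ shell S ↔ ∃ j < s₂.nat 10 0, P (s₂.nat 8 j) = z := by
      intro z
      rw [Finset.mem_sdiff, hS]
      constructor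
      · rintro ⟨⟨v, hv, rfl⟩, hz⟩
        obtain ⟨x, hx, rfl⟩ := hsort.surj v hv
        obtain ⟨j, hj, he⟩ := h₂.surj x hx ((hmark _ hv).2 hz)
        exact ⟨j, hj, by rw [he]⟩
      · rintro ⟨j, hj, rfl⟩
        obtain ⟨k, hk, he, hM⟩ := h₂.mem j hj
        rw [he]
        exact ⟨⟨_, hlt k hk, rfl⟩, (hmark _ (hlt k hk)).1 hM⟩
    have houter : ∀ z, z ∈ shell S ↔ ∃ j < s₂.nat 18 0, P (s₂.nat 17 j) = z := by
      intro z
      constructor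
      · intro hz
        obtain ⟨v, hv, rfl⟩ := (hS z).1 (shell_subset S hz)
        obtain ⟨x, hx, rfl⟩ := hsort.surj v hv
        obtain ⟨j, hj, he⟩ := h₂.surj' x hx fun h => (hmark _ hv).1 h hz
        exact ⟨j, hj, by rw [he]⟩
      · rintro ⟨j, hj, rfl⟩
        obtain ⟨k, hk, he, hM⟩ := h₂.mem' j hj
        rw [he]
        by_contra hc
        exact hM ((hmark _ (hlt k hk)).2 hc)
    have hsum : (S \ shell S).card + (shell S).card = n := by
      rw [← hcard]
      exact Finset.card_sdiff_add_card_eq_card (shell_subset S)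
    have hle : (S \ shell S).card ≤ s₂.nat 10 0 := by
      have : S \ shell S = (Finset.range (s₂.nat 10 0)).image fun j => P (s₂.nat 8 j) := by
        ext z
        simp only [hinner, Finset.mem_image, Finset.mem_range]
      rw [this]
      exact Finset.card_image_le.trans (Finset.card_range _).le
    have hle' : (shell S).card ≤ s₂.nat 18 0 := by
      have : shell S = (Finset.range (s₂.nat 18 0)).image fun j => P (s₂.nat 17 j) := by
        ext z
        simp only [houter, Finset.mem_image, Finset.mem_range]
      rw [this]
      exact Finset.card_image_le.trans (Finset.card_range _).le
    have htot := h₂.total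
    constructor
    · rw [pt_congr ((hf.1 rfl).trans ((hf₃.1 rfl).trans ((hf₂.1 rfl).trans (hf₁.1 rfl)))), hP]
    · exact hinj
    · exact hS
    · exact hcard
    · rw [e8, e10]
      intro j hj
      obtain ⟨k, hk, he, -⟩ := h₂.mem j hj
      rw [he]
      exact hlt k hk
    · rw [e8, e10]
      intro i j hij hj
      obtain ⟨k, l, hkl, hl, e1, e2⟩ := h₂.order i j hij hj
      rw [e1, e2]
      exact hlex k l hkl hl
    · rwa [e8, e10]
    · rw [e10]
      omega
    · rw [e17, e18]
      intro j hj
      obtain ⟨k, hk, he, -⟩ := h₂.mem' j hj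
      rw [he]
      exact hlt k hk
    · rwa [e17, e18]
    · rw [e18]
      omega
    · rw [e19]
      exact h₃.1
    · rw [e19]
      exact h₃.2
    · intro v hv
      rw [h, if_pos hv]
  · exact prepareCost_bound (Nat.le_mul_of_pos_right _ (Nat.succ_pos _))

/-- The algorithm: if the shell has enough points, they need no guards; otherwise every other
vertex of a block of a chain of inner points is left without a guard. -/
def guardProgram : Program :=
  .seq prepare (.ite (.natLt (var 18) (var 19)) clearBlock (scatter 1 18 (.get 17 (var 7)) 0))

/-- A factor in the running time of `guardProgram`. -/
def guardCost : ℕ :=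
  markCost + splitStep.bound + 4 * scanStep.bound + 4 * searchStep.bound + 2000

lemma guardCost_bound {a b c d N q : ℕ} (h0 : 0 < N) (h : N ≤ q) :
    (a + b + 200) * q + (5 + N * (4 * c + 4 * d + 1000) + 1) ≤
      (a + b + 4 * c + 4 * d + 2000) * q := by
  have := Nat.mul_le_mul_right (4 * c + 4 * d) h
  nlinarith

lemma runs_guardProgram {P : ℕ → Plane} {S : Finset Plane} {n : ℕ} {s : State}
    (hn : s.nat 0 0 = n) (hn2 : 2 ≤ n) (h16 : ∀ v, s.nat 16 v = 0) (hP : pt s = P)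
    (hinj : ∀ a < n, ∀ b < n, P a = P b → a = b) (hS : ∀ z, z ∈ S ↔ ∃ v < n, P v = z)
    (hS2 : LiesOnShells 2 S) :
    Runs guardProgram s (guardCost * ((n + 1) * (Nat.log 2 n + 2))) fun s' =>
      ∃ K, n ≤ 6 * (K * K) ∧ Solved P S n K s' := by
  refine Runs.le (Runs.seq (runs_prepare hn hn2 h16 hP hinj hS) fun s₁ hf₁ h₁ => Runs.mono
    (Runs.ite (c := (n + 1) * (4 * scanStep.bound + 4 * searchStep.bound + 1000))
      (fun hb => runs_clearBlock h₁ hS2 hb)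
      (fun hb => (runs_clear_shell h₁ hS2 (not_lt.1 hb)).le ?_)) le_rfl
    fun s' _ h => ⟨_, h₁.le_root, h⟩) ?_
  · exact Nat.mul_le_mul_left _ (by omega)
  · exact guardCost_bound (Nat.succ_pos _) (Nat.le_mul_of_pos_right _ (Nat.succ_pos _))

end

end RealRAM

/-! ### Conversion of the bounds to real numbers, and the theorem. -/

namespace RealRAM

open UniversalGuards

/-- Keeps `log n` away from zero, so that `n log n` can absorb lower-order terms. -/
lemma four_le_of_liesOnShells {n : ℕ} {p : Fin n ↪ Plane}
    (h : LiesOnShells 2 (Finset.univ.map p)) : 4 ≤ n := by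
  have h1 := three_le_card_shell h.two.1
  have h2 := h.two.1.card_pos
  have h3 := Finset.card_sdiff_add_card_eq_card (shell_subset (Finset.univ.map p))
  rw [Finset.card_map, Finset.card_univ, Fintype.card_fin] at h3
  omega

/-- As n > e, `log n ≥ 1`; as `log 2 > 1/2`, the binary logarithm is at most twice the natural one.
The factors are thus at most 2n and 4 log n. -/
lemma log_bound {n : ℕ} (hn : 4 ≤ n) :
    (((n + 1) * (Nat.log 2 n + 2) : ℕ) : ℝ) ≤ 8 * (n * Real.log n) := by
  have hn' : (4 : ℝ) ≤ n := by exact_mod_cast hn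
  have h1 : 1 ≤ Real.log n := by
    rw [Real.le_log_iff_exp_le (by linarith)]
    linarith [Real.exp_one_lt_d9]
  have h2 : (Nat.log 2 n : ℝ) * Real.log 2 ≤ Real.log n := by
    rw [← Real.log_pow]
    refine Real.log_le_log (by positivity) ?_
    exact_mod_cast Nat.pow_log_le_self 2 (by omega)
  have h3 : (Nat.log 2 n : ℝ) ≤ 2 * Real.log n := by
    have : (0 : ℝ) ≤ Nat.log 2 n := Nat.cast_nonneg _
    nlinarith [Real.log_two_gt_d9]
  push_cast
  calc ((n : ℝ) + 1) * (Nat.log 2 n + 2) ≤ (2 * n) * (4 * Real.log n) :=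
        mul_le_mul (by linarith) (by linarith) (by positivity) (by linarith)
    _ = 8 * (n * Real.log n) := by ring

/-- Multiplying n ≤ 6K² by n and taking roots gives n/√(6n) ≤ K. -/
lemma card_bound {n K g : ℕ} (hn : 0 < n) (hK : n ≤ 6 * (K * K)) (hg : g + K ≤ n) :
    (g : ℝ) ≤ (1 - 1 / √(6 * (n : ℝ))) * n := by
  have hn' : (0 : ℝ) < n := by exact_mod_cast hn
  have hK' : (n : ℝ) ≤ 6 * (K * K) := by exact_mod_cast hK
  have hg' : (g : ℝ) + K ≤ n := by exact_mod_cast hg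
  have h1 : (n : ℝ) ≤ K * √(6 * n) := by
    refine (pow_le_pow_iff_left₀ hn'.le (by positivity) two_ne_zero).1 ?_
    rw [mul_pow, Real.sq_sqrt (by positivity)]
    nlinarith
  have h2 : (n : ℝ) / √(6 * n) ≤ K := (div_le_iff₀ (by positivity)).2 h1
  have h3 : (1 - 1 / √(6 * (n : ℝ))) * n = n - n / √(6 * n) := by ring
  linarith

theorem guardProgram_spec {n : ℕ} (p : Fin n ↪ Plane)
    (h : LiesOnShells 2 (Finset.univ.map p)) :
    ∃ s t, Exec guardProgram (input p) s t ∧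
      (t : ℝ) ≤ 8 * (guardCost : ℝ) * ((n : ℝ) * Real.log n) ∧
      IsUniversalGuardSet (Finset.univ.map p) (output p s) ∧
      ((output p s).card : ℝ) ≤ (1 - 1 / √(6 * (n : ℝ))) * n := by
  have hn := four_le_of_liesOnShells h
  have hpt : ∀ v (hv : v < n), pt (input p) v = p ⟨v, hv⟩ := by
    intro v hv
    simp [pt, input, hv]
  obtain ⟨s, t, he, ht, K, hK, B, hB, hguard, hcard, hout⟩ :=
    runs_guardProgram (P := pt (input p)) (S := Finset.univ.map p) (n := n) (s := input p)
      (by simp [input]) (by omega) (by simp [input]) rfl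
      (fun a ha b hb hab => by
        rw [hpt a ha, hpt b hb] at hab
        exact congrArg Fin.val (p.injective hab))
      (fun z => by
        simp only [Finset.mem_map, Finset.mem_univ, true_and]
        constructor
        · rintro ⟨v, rfl⟩
          exact ⟨v, v.2, hpt v v.2⟩
        · rintro ⟨v, hv, rfl⟩
          exact ⟨⟨v, hv⟩, (hpt v hv).symm⟩) h
  have houtput : output p s = Finset.univ.map p \ B := by
    ext z
    simp only [output, Finset.mem_map, Finset.mem_filter, Finset.mem_univ, true_and,
      Finset.mem_sdiff]
    constructor
    · rintro ⟨v, hv, rfl⟩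
      have := (hout v v.2).1 hv
      rw [hpt v v.2] at this
      exact ⟨⟨v, rfl⟩, this⟩
    · rintro ⟨⟨v, rfl⟩, hv⟩
      refine ⟨v, (hout v v.2).2 ?_, rfl⟩
      rwa [hpt v v.2]
  refine ⟨s, t, he, ?_, houtput ▸ hguard, card_bound (by omega) hK ?_⟩
  · calc (t : ℝ) ≤ ((guardCost * ((n + 1) * (Nat.log 2 n + 2)) : ℕ) : ℝ) := by exact_mod_cast ht
      _ = guardCost * (((n + 1) * (Nat.log 2 n + 2) : ℕ) : ℝ) := Nat.cast_mul _ _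
      _ ≤ guardCost * (8 * (n * Real.log n)) :=
        mul_le_mul_of_nonneg_left (log_bound hn) (Nat.cast_nonneg _)
      _ = 8 * (guardCost : ℝ) * ((n : ℝ) * Real.log n) := by ring
  · have h3 := Finset.card_sdiff_add_card_eq_card hB
    rw [Finset.card_map, Finset.card_univ, Fintype.card_fin] at h3
    rw [houtput]
    omega

end RealRAM

/-- Needed because the floor of a negative number is 0 in the natural numbers. -/
lemma UniversalGuards.bound_nonneg (n : ℕ) : 0 ≤ (1 - 1 / √(6 * (n : ℝ))) * n := by
  rcases Nat.eq_zero_or_pos n with rfl | hn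
  · simp
  · have hn' : (1 : ℝ) ≤ n := by exact_mod_cast hn
    have h1 : 1 ≤ √(6 * (n : ℝ)) := Real.one_le_sqrt.2 (by linarith)
    have h2 : 1 / √(6 * (n : ℝ)) ≤ 1 := (div_le_one (by linarith)).2 h1
    exact mul_nonneg (by linarith) (by linarith)

theorem mainTheorem3 :
    (∃ (A : RealRAM.Program) (C : ℝ), ∀ (n : ℕ) (p : Fin n ↪ Plane),
      UniversalGuards.LiesOnShells 2 (Finset.univ.map p) →
      ∃ (s : RealRAM.State) (t : ℕ),
        RealRAM.Exec A (RealRAM.input p) s t ∧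
        (t : ℝ) ≤ C * ((n : ℝ) * Real.log n) ∧
        UniversalGuards.IsUniversalGuardSet (Finset.univ.map p) (RealRAM.output p s) ∧
        ((RealRAM.output p s).card : ℝ) ≤ (1 - 1 / √(6 * (n : ℝ))) * n) ∧
    (∀ n : ℕ, ∃ k : ℕ, UniversalGuards.UG 2 n = (k : ℕ∞) ∧
      (k : ℝ) ≤ (1 - 1 / √(6 * (n : ℝ))) * n) := by
  refine ⟨⟨RealRAM.guardProgram, _, fun n p h => RealRAM.guardProgram_spec p h⟩, fun n => ?_⟩
  -- Rounding down makes the real bound comparable with extended natural numbers; it also shows that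
  -- the supremum is finite.
  have hle : UniversalGuards.UG 2 n ≤ (⌊(1 - 1 / √(6 * (n : ℝ))) * n⌋₊ : ℕ∞) := by
    refine iSup₂_le fun S hS => ?_
    obtain ⟨hcard, hS⟩ := hS
    let p : Fin n ↪ Plane :=
      (S.equivFinOfCardEq hcard).symm.toEmbedding.trans (Function.Embedding.subtype _)
    have hp : Finset.univ.map p = S := by
      ext z
      simp only [Finset.mem_map, Finset.mem_univ, true_and]
      constructor
      · rintro ⟨i, rfl⟩
        exact ((S.equivFinOfCardEq hcard).symm i).2
      · intro hz
        exact ⟨S.equivFinOfCardEq hcard ⟨z, hz⟩, by simp [p]⟩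
    -- Any enumeration of the points will do; only the output of the run is used, not its time.
    obtain ⟨s, t, -, -, hG, hb⟩ := RealRAM.guardProgram_spec p (hp ▸ hS)
    rw [hp] at hG
    exact (iInf₂_le _ hG).trans (by exact_mod_cast Nat.le_floor hb)
  obtain ⟨k, hk⟩ := ENat.ne_top_iff_exists.1 (ne_top_of_le_ne_top (ENat.natCast_ne_top _) hle)
  refine ⟨k, hk.symm, ?_⟩
  rw [← hk] at hle
  have : k ≤ ⌊(1 - 1 / √(6 * (n : ℝ))) * n⌋₊ := by exact_mod_cast hle
  exact (Nat.cast_le.2 this).trans (Nat.floor_le (UniversalGuards.bound_nonneg n))
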